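/- Fix $d\ge 1$. For each $n$ let $\alpha\in\mathbb R^n$ and $Z_{12}\in\mathbb R^{n\times d}$ (with rows $z_{1,12},\dots,z_{n,12}$) be non-random, all possibly depending on $n$, such that the columns of $Z_{12}$ sum to zero and such that $P=\alpha 1_n^T+1_n\alpha^T+Z_{12}Z_{12}^T$ has entries in $[0,1]$, is positive semidefinite, and satisfies $\max_i\sum_jP_{ij}>(\log n)^{4+a}$ for all large $n$, for some $a>0$. Let $P=XX^T$ with $X\in\mathbb R^{n\times d}$ (rows $x_1,\dots,x_n$), oriented such that $JX=Z_{12}$, where $J=I-n^{-1}1_n1_n^T$. Let $A$ be a symmetric random matrix with zero diagonal whose entries $A_{ij}$, $i<j$, are independent Bernoulli$(P_{ij})$ variables. Fix $i$ and assume that the limits $$\overline M_X=\lim_{n\to\infty}\frac{X^TX}{n}\ \text{(invertible)},\qquad Q_i=\lim_{n\to\infty}\frac1n\sum_{j\ne i}(x_i^Tx_j)(1-x_i^Tx_j)\,x_jx_j^T$$ exist. Let $\hat X=U_AS_A^{1/2}W$, where $S_A$ is the diagonal matrix of the $d$ largest singular values of $A$ in descending order, $U_A$ is the $n\times d$ matrix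 of corresponding orthonormal left singular vectors in a singular value decomposition of $A$, and $W$ is a (possibly data-dependent, measurable) $d\times d$ orthogonal matrix that resolves the rotation indeterminacy in one of the following two ways, almost surely for all large $n$: (a) $\hat X$ is closest to $X$ in Frobenius norm among all $\hat XO$ with $O$ orthogonal; or (b) $Z_{12}^TZ_{12}/n$ is diagonal for all large $n$, with diagonal elements whose pairwise differences are bounded away from zero; $(J\hat X)^TJ\hat X$ is diagonal as well, with diagonal elements in the same order as those of $Z_{12}^TZ_{12}$; and the column signs are fixed either by requiring that each column of $\hat X$ has non-negative inner product with the same column of $X$, or, when all entries of the first row of $Z_{12}$ are positive and bounded away from zero, by requiring that all entries of the first row of $J\hat X$ are non-negative. Let $\hat Z_{12}=J\hat X$, with rows $\hat z_{1,12},\dots,\hat z_{n,12}$. Then, as $n\to\infty$, $$\sqrt n\,(\hat z_{i,12}-z_{i,12})\ \longrightarrow\ \mathcal N\bigl(0,\ \overline M_X^{-1}Q_i\overline M_X^{-1}\bigr)\quad\text{in distribution.}$$ -/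

import Mathlib

open MeasureTheory ProbabilityTheory Filter Topology
open scoped Matrix

noncomputable section

/-- The matrix `P = α 1ᵀ + 1 αᵀ + Z Zᵀ` of connection probabilities. -/
def linkProb {n d : ℕ} (α : Fin n → ℝ) (Z : Matrix (Fin n) (Fin d) ℝ) :
    Matrix (Fin n) (Fin n) ℝ :=
  Matrix.of fun i j => α i + α j + ∑ a, Z i a * Z j a

/-- The centering matrix `I - 1 1ᵀ / n`. -/
def centering (n : ℕ) : Matrix (Fin n) (Fin n) ℝ :=
  1 - (n : ℝ)⁻¹ • Matrix.of fun _ _ => (1 : ℝ)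

/-- `A` is the random adjacency matrix of an undirected graph without self-loops whose edges are
independent, the edge `{i, j}` being present with probability `P i j`. -/
structure IsBernoulliNetwork {Ω : Type*} [MeasurableSpace Ω] (μ : Measure Ω) {n : ℕ}
    (P : Matrix (Fin n) (Fin n) ℝ) (A : Ω → Matrix (Fin n) (Fin n) ℝ) : Prop where
  measurable_entry : ∀ i j, Measurable fun ω => A ω i j
  symm : ∀ ω i j, A ω i j = A ω j i
  diag_eq_zero : ∀ ω i, A ω i i = 0
  binary : ∀ ω i j, A ω i j = 0 ∨ A ω i j = 1
  prob_edge : ∀ i j, i ≠ j → μ {ω | A ω i j = 1} = ENNReal.ofReal (P i j)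
  indep : iIndepFun (fun (e : {e : Fin n × Fin n // e.1 < e.2}) ω => A ω e.1.1 e.1.2) μ

/-- `Xhat = U_A S_A^{1/2}` is a `d`-dimensional adjacency spectral embedding of `A`: in some
singular value decomposition `A = U diag(σ) Vᵀ` with `σ` in descending order, `Xhat` consists of
the first `d` columns of `U`, each scaled by the square root of its singular value. -/
def IsASE {n d : ℕ} (A : Matrix (Fin n) (Fin n) ℝ) (Xhat : Matrix (Fin n) (Fin d) ℝ) : Prop :=
  ∃ (hd : d ≤ n) (U V : Matrix (Fin n) (Fin n) ℝ) (σ : Fin n → ℝ),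
    U ∈ Matrix.orthogonalGroup (Fin n) ℝ ∧ V ∈ Matrix.orthogonalGroup (Fin n) ℝ ∧
    (∀ k, 0 ≤ σ k) ∧ Antitone σ ∧ A = U * Matrix.diagonal σ * Vᵀ ∧
    ∀ i a, Xhat i a = U i (Fin.castLE hd a) * √(σ (Fin.castLE hd a))

/-- `Xhat` is an adjacency spectral embedding of `A` followed by an orthogonal transformation
of `ℝ^d` (a rotation, possibly with sign changes of the columns). -/
def IsRotatedASE {n d : ℕ} (A : Matrix (Fin n) (Fin n) ℝ) (Xhat : Matrix (Fin n) (Fin d) ℝ) :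
    Prop :=
  ∃ (X₀ : Matrix (Fin n) (Fin d) ℝ) (W : Matrix (Fin d) (Fin d) ℝ),
    IsASE A X₀ ∧ W ∈ Matrix.orthogonalGroup (Fin d) ℝ ∧ Xhat = X₀ * W

/-- Among all `Xhat * W` with `W` orthogonal, `Xhat` itself is closest to `X` in Frobenius norm. -/
def IsNearestRotation {n d : ℕ} (Xhat X : Matrix (Fin n) (Fin d) ℝ) : Prop :=
  ∀ W ∈ Matrix.orthogonalGroup (Fin d) ℝ,
    ∑ i, ∑ a, (Xhat i a - X i a) ^ 2 ≤ ∑ i, ∑ a, ((Xhat * W) i a - X i a) ^ 2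

/-- The second moment matrix `Mᵀ M / n` of the rows of `M`. -/
def secondMoment {n d : ℕ} (M : Matrix (Fin n) (Fin d) ℝ) : Matrix (Fin d) (Fin d) ℝ :=
  (n : ℝ)⁻¹ • (Mᵀ * M)

/-- `Zᵀ Z / n` is diagonal for all large `n`, with distinct diagonal elements whose
differences stay away from zero. -/
def HasSeparatedDiagonalGram {d : ℕ} (Z : ∀ n : ℕ, Matrix (Fin n) (Fin d) ℝ) : Prop :=
  ∃ c : ℝ, 0 < c ∧ ∀ᶠ n in atTop, (secondMoment (Z n)).IsDiag ∧
    ∀ a b, a ≠ b → c ≤ |secondMoment (Z n) a a - secondMoment (Z n) b b|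

/-- `Zhatᵀ Zhat` is diagonal, with diagonal elements arranged in the same order as those
of `Zᵀ Z`. -/
def HasMatchingDiagonalGram {n d : ℕ} (Zhat Z : Matrix (Fin n) (Fin d) ℝ) : Prop :=
  (secondMoment Zhat).IsDiag ∧
    ∀ a b, secondMoment Z a a < secondMoment Z b b →
      secondMoment Zhat a a ≤ secondMoment Zhat b b

/-- The row of `M` with (zero-based) index `i`, as a Euclidean vector; it is `0` when `M` has no
such row, which happens only for the finitely many `n ≤ i`. -/
def rowVec {n d : ℕ} (M : Matrix (Fin n) (Fin d) ℝ) (i : ℕ) : EuclideanSpace ℝ (Fin d) :=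
  if h : i < n then WithLp.toLp 2 (M ⟨i, h⟩) else 0

/-- `∑_{j ≠ i} (x_iᵀ x_j) (1 - x_iᵀ x_j) x_j x_jᵀ / n`, where `x_j` are the rows of `X`. -/
def scoreCov {n d : ℕ} (X : Matrix (Fin n) (Fin d) ℝ) (i : ℕ) : Matrix (Fin d) (Fin d) ℝ :=
  (n : ℝ)⁻¹ • ∑ j : Fin n, if (j : ℕ) = i then 0 else
    (inner ℝ (rowVec X i) (rowVec X j) * (1 - inner ℝ (rowVec X i) (rowVec X j))) •
      Matrix.vecMulVec (X j) (X j)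

end

/-
Up to its diagonal, which is bounded, `E = A - X Xᵀ` is a noise matrix `ξ` with independent centered
entries. Finitely many functions of `ξ`, such as `‖ξ ξ‖² / n³` and `‖Xᵀ ξ X‖² / n²` in the Frobenius
norm, have bounded means, so each of them exceeds a large constant only with small probability.
While they are bounded, the argument is deterministic. The spectral embedding that is closest to `X`
satisfies `Y Yᵀ Y = (X Xᵀ + E) Y` with `Xᵀ Y` symmetric and positive semidefinite, and `Y` differs
from `X` by `E X (Xᵀ X)⁻¹` in each row up to `O(n ^ (-3 / 4))`. Under the second convention the
Hoffman-Wielandt inequality shows that the embedding is within `O(n ^ (-3 / 4))` of this one, the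
column signs being the right ones. Centering does not change the leading term, because the mean of
all rows fluctuates less than a single row.

Hence `√n` times the error in row `i` is `√n` times row `i` of `ξ X (Xᵀ X)⁻¹` plus a term that tends
to zero on events of probability close to one. The leading term is a sum of independent variables,
whose characteristic function is compared with the Gaussian one factor by factor.
-/

section OperatorNorm

open Matrix
open scoped Matrix.Norms.L2Operator

variable {m n : Type*} [Fintype m] [Fintype n]

theorem norm_toLp_sq (v : n → ℝ) : ‖WithLp.toLp 2 v‖ ^ 2 = v ⬝ᵥ v := by
  simp only [EuclideanSpace.norm_sq_eq, dotProduct, Real.norm_eq_abs, sq_abs, ← sq]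

theorem dotProduct_self_nonneg (v : n → ℝ) : 0 ≤ v ⬝ᵥ v := by
  simpa using dotProduct_self_star_nonneg v

theorem dotProduct_self_pos {v : n → ℝ} (hv : v ≠ 0) : 0 < v ⬝ᵥ v :=
  (dotProduct_self_nonneg v).lt_of_ne' (dotProduct_self_eq_zero.not.2 hv)

theorem dotProduct_mulVec_mulVec (M N : Matrix m n ℝ) (u v : n → ℝ) :
    (M *ᵥ u) ⬝ᵥ (N *ᵥ v) = u ⬝ᵥ (Mᵀ * N) *ᵥ v := by
  rw [dotProduct_mulVec, vecMul_mulVec, ← dotProduct_mulVec]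

variable [DecidableEq n]

theorem dotProduct_mulVec_self_le (M : Matrix m n ℝ) (v : n → ℝ) :
    (M *ᵥ v) ⬝ᵥ (M *ᵥ v) ≤ ‖M‖ ^ 2 * (v ⬝ᵥ v) := by
  rw [← norm_toLp_sq, ← norm_toLp_sq, ← mul_pow]
  exact pow_le_pow_left₀ (norm_nonneg _) (l2_opNorm_mulVec M (WithLp.toLp 2 v)) 2

theorem l2_opNorm_le_of_dotProduct_le {M : Matrix m n ℝ} {C : ℝ} (hC : 0 ≤ C)
    (h : ∀ v, (M *ᵥ v) ⬝ᵥ (M *ᵥ v) ≤ C ^ 2 * (v ⬝ᵥ v)) : ‖M‖ ≤ C := by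
  rw [l2_opNorm_def]
  refine ContinuousLinearMap.opNorm_le_bound _ hC fun x => le_of_sq_le_sq ?_ (by positivity)
  have hx := h x.ofLp
  rw [← norm_toLp_sq, ← norm_toLp_sq, ← mul_pow] at hx
  exact hx

theorem abs_dotProduct_mulVec_le (M : Matrix m n ℝ) (u : m → ℝ) (v : n → ℝ) :
    |u ⬝ᵥ M *ᵥ v| ≤ ‖WithLp.toLp 2 u‖ * (‖M‖ * ‖WithLp.toLp 2 v‖) := by
  have h := abs_real_inner_le_norm (WithLp.toLp 2 (M *ᵥ v)) (WithLp.toLp 2 u)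
  rw [EuclideanSpace.inner_toLp_toLp, star_trivial, mul_comm] at h
  exact h.trans (by gcongr; exact l2_opNorm_mulVec M (WithLp.toLp 2 v))

theorem abs_dotProduct_mulVec_self_le (M : Matrix n n ℝ) (v : n → ℝ) :
    |v ⬝ᵥ M *ᵥ v| ≤ ‖M‖ * (v ⬝ᵥ v) := by
  refine (abs_dotProduct_mulVec_le M v v).trans_eq ?_
  rw [← norm_toLp_sq]
  ring

theorem l2_opNorm_sq_le_sum_sq (M : Matrix m n ℝ) : ‖M‖ ^ 2 ≤ ∑ i, ∑ j, M i j ^ 2 := by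
  have h0 : 0 ≤ ∑ i, ∑ j, M i j ^ 2 := by positivity
  rw [← Real.sq_sqrt h0]
  refine pow_le_pow_left₀ (norm_nonneg _)
    (l2_opNorm_le_of_dotProduct_le (Real.sqrt_nonneg _) fun v => ?_) 2
  rw [Real.sq_sqrt h0, Finset.sum_mul, dotProduct]
  refine Finset.sum_le_sum fun i _ => ?_
  simp only [mulVec, dotProduct, ← sq]
  exact Finset.sum_mul_sq_le_sq_mul_sq _ _ _

theorem abs_apply_le_l2_opNorm (M : Matrix m n ℝ) (i : m) (j : n) : |M i j| ≤ ‖M‖ := by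
  classical
  simpa using abs_dotProduct_mulVec_le M (Pi.single i 1) (Pi.single j 1)

theorem abs_trace_le (M : Matrix n n ℝ) : |M.trace| ≤ Fintype.card n * ‖M‖ := by
  refine (Finset.abs_sum_le_sum_abs _ _).trans ?_
  refine (Finset.sum_le_card_nsmul _ _ ‖M‖ fun i _ => abs_apply_le_l2_opNorm M i i).trans_eq ?_
  rw [nsmul_eq_mul, Finset.card_univ]

theorem l2_opNorm_transpose [DecidableEq m] (M : Matrix m n ℝ) : ‖Mᵀ‖ = ‖M‖ := by
  rw [← conjTranspose_eq_transpose_of_trivial, l2_opNorm_conjTranspose]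

theorem l2_opNorm_transpose_mul_self (M : Matrix m n ℝ) : ‖Mᵀ * M‖ = ‖M‖ ^ 2 := by
  rw [← conjTranspose_eq_transpose_of_trivial, l2_opNorm_conjTranspose_mul_self, sq]

end OperatorNorm

section OrthogonalGroup

open Matrix
open scoped Matrix.Norms.L2Operator

variable {n : Type*} [Fintype n] [DecidableEq n] {W : Matrix n n ℝ}

theorem transpose_mem_orthogonalGroup (hW : W ∈ orthogonalGroup n ℝ) :
    Wᵀ ∈ orthogonalGroup n ℝ := by
  rwa [mem_orthogonalGroup_iff', transpose_transpose, ← mem_orthogonalGroup_iff]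

theorem dotProduct_mulVec_of_mem_orthogonalGroup (hW : W ∈ orthogonalGroup n ℝ) (v : n → ℝ) :
    (W *ᵥ v) ⬝ᵥ (W *ᵥ v) = v ⬝ᵥ v := by
  rw [dotProduct_mulVec_mulVec, (mem_orthogonalGroup_iff' n ℝ).1 hW, one_mulVec]

theorem l2_opNorm_le_one_of_mem_orthogonalGroup (hW : W ∈ orthogonalGroup n ℝ) : ‖W‖ ≤ 1 :=
  l2_opNorm_le_of_dotProduct_le zero_le_one fun v => by
    rw [dotProduct_mulVec_of_mem_orthogonalGroup hW, one_pow, one_mul]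

end OrthogonalGroup

section Coercive

open Matrix
open scoped Matrix.Norms.L2Operator

variable {m n : Type*} [Fintype m] [Fintype n]

/-- Quantitative positive definiteness of a square matrix `M` that need not be symmetric: its
quadratic form is at least `c` times the squared Euclidean norm. -/
def CoerciveWith (c : ℝ) (M : Matrix n n ℝ) : Prop :=
  ∀ v, c * (v ⬝ᵥ v) ≤ v ⬝ᵥ M *ᵥ v

namespace CoerciveWith

variable {c : ℝ} {M : Matrix n n ℝ}

theorem norm_le_norm_mulVec (h : CoerciveWith c M) (w : n → ℝ) :
    c * ‖WithLp.toLp 2 w‖ ≤ ‖WithLp.toLp 2 (M *ᵥ w)‖ := by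
  rcases (norm_nonneg (WithLp.toLp 2 w)).eq_or_lt with h0 | h0
  · simp [← h0]
  have hin : w ⬝ᵥ M *ᵥ w ≤ ‖WithLp.toLp 2 (M *ᵥ w)‖ * ‖WithLp.toLp 2 w‖ := by
    simpa [EuclideanSpace.inner_toLp_toLp, dotProduct_comm] using
      real_inner_le_norm (WithLp.toLp 2 (M *ᵥ w)) (WithLp.toLp 2 w)
  have hw := (h w).trans hin
  rw [← norm_toLp_sq, sq, ← mul_assoc] at hw
  exact le_of_mul_le_mul_right hw h0

theorem le_apply_self (h : CoerciveWith c M) (a : n) : c ≤ M a a := by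
  classical
  simpa using h (Pi.single a 1)

variable [DecidableEq n]

theorem isUnit_det (h : CoerciveWith c M) (hc : 0 < c) : IsUnit M.det := by
  rw [isUnit_iff_ne_zero]
  intro h0
  obtain ⟨v, hv, hMv⟩ := exists_mulVec_eq_zero_iff.2 h0
  have hcv := h v
  rw [hMv, dotProduct_zero] at hcv
  exact absurd (mul_pos hc (dotProduct_self_pos hv)) hcv.not_gt

theorem l2_opNorm_inv_le (h : CoerciveWith c M) (hc : 0 < c) : ‖M⁻¹‖ ≤ c⁻¹ := by
  refine l2_opNorm_le_of_dotProduct_le (by positivity) fun v => ?_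
  have hw := h.norm_le_norm_mulVec (M⁻¹ *ᵥ v)
  rw [mulVec_mulVec, mul_nonsing_inv _ (h.isUnit_det hc), one_mulVec] at hw
  rw [← norm_toLp_sq, ← norm_toLp_sq, ← mul_pow]
  exact pow_le_pow_left₀ (norm_nonneg _) (by rwa [inv_mul_eq_div, le_div_iff₀' hc]) 2

end CoerciveWith

theorem coerciveWith_transpose_mul_self [DecidableEq n] {X : Matrix m n ℝ} {b : ℝ}
    (hX : IsUnit (Xᵀ * X).det) (hb : 0 < b) (hle : ‖(Xᵀ * X)⁻¹‖ ≤ b) :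
    CoerciveWith b⁻¹ (Xᵀ * X) := fun v => by
  classical
  set T := (Xᵀ * X)⁻¹ * Xᵀ with hT
  have hTX : T * X = 1 := by rw [hT, Matrix.mul_assoc, nonsing_inv_mul _ hX]
  have hnorm : ‖T‖ ^ 2 = ‖(Xᵀ * X)⁻¹‖ := by
    rw [← l2_opNorm_transpose, ← l2_opNorm_transpose_mul_self, transpose_transpose]
    conv_lhs => rw [hT]
    rw [transpose_mul, transpose_transpose, ← Matrix.mul_assoc, ← hT, hTX, Matrix.one_mul,
      transpose_nonsing_inv, transpose_mul, transpose_transpose]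
  have hv := dotProduct_mulVec_self_le T (X *ᵥ v)
  rw [mulVec_mulVec, hTX, one_mulVec, hnorm] at hv
  rw [inv_mul_le_iff₀ hb, ← dotProduct_mulVec_mulVec]
  exact hv.trans (mul_le_mul_of_nonneg_right hle (dotProduct_self_nonneg _))

end Coercive

section SpectralEmbedding

open Matrix
open scoped Matrix.Norms.L2Operator

variable {n d : ℕ} {X Y : Matrix (Fin n) (Fin d) ℝ} {A U V : Matrix (Fin n) (Fin n) ℝ}
  {σ : Fin n → ℝ} {γ δ : ℝ} {k : Fin n}

/-- `A = U diag(σ) Vᵀ` is a singular value decomposition of the square matrix `A`, with the singular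
values `σ` in descending order. -/
structure IsSVD (A U V : Matrix (Fin n) (Fin n) ℝ) (σ : Fin n → ℝ) : Prop where
  left_mem : U ∈ orthogonalGroup (Fin n) ℝ
  right_mem : V ∈ orthogonalGroup (Fin n) ℝ
  nonneg : ∀ k, 0 ≤ σ k
  antitone : Antitone σ
  eq_mul : A = U * diagonal σ * Vᵀ

theorem CoerciveWith.mul_dotProduct_mulVec_le {m : Type*} [Fintype m] {M : Matrix m m ℝ} {c : ℝ}
    (h : CoerciveWith c M) (hc : 0 ≤ c) (v : m → ℝ) :
    c * (v ⬝ᵥ M *ᵥ v) ≤ (M *ᵥ v) ⬝ᵥ (M *ᵥ v) := by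
  have hin : v ⬝ᵥ M *ᵥ v ≤ ‖WithLp.toLp 2 v‖ * ‖WithLp.toLp 2 (M *ᵥ v)‖ := by
    simpa [EuclideanSpace.inner_toLp_toLp, dotProduct_comm] using
      real_inner_le_norm (WithLp.toLp 2 v) (WithLp.toLp 2 (M *ᵥ v))
  rw [← norm_toLp_sq, sq]
  calc c * (v ⬝ᵥ M *ᵥ v) ≤ c * ‖WithLp.toLp 2 v‖ * ‖WithLp.toLp 2 (M *ᵥ v)‖ := by
        rw [mul_assoc]; gcongr
    _ ≤ _ := by gcongr; exact h.norm_le_norm_mulVec v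

theorem exists_ne_zero_mulVec_apply_eq_zero (M : Matrix (Fin n) (Fin d) ℝ) (hk : (k : ℕ) < d) :
    ∃ y ≠ 0, ∀ l < k, (M *ᵥ y) l = 0 := by
  let T : (Fin d → ℝ) →ₗ[ℝ] (Fin (k : ℕ) → ℝ) :=
    (LinearMap.funLeft ℝ ℝ (Fin.castLE k.2.le)).comp M.mulVecLin
  obtain ⟨y, hy, hy0⟩ := Submodule.exists_mem_ne_zero_of_ne_bot
    (LinearMap.ker_ne_bot_of_finrank_lt (f := T) (by simpa using hk))
  exact ⟨y, hy0, fun l hl => congrFun (LinearMap.mem_ker.1 hy) ⟨l, hl⟩⟩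

theorem mulVec_col_of_mul_eq (h : A * U = V * diagonal σ) (k : Fin n) :
    A *ᵥ U.col k = σ k • V.col k :=
  funext fun i => (congrFun (congrFun h i) k).trans ((mul_diagonal σ V i k).trans (mul_comm _ _))

namespace IsSVD

theorem mul_left_eq (h : IsSVD A U V σ) (hA : Aᵀ = A) : A * U = V * diagonal σ := by
  rw [← hA, h.eq_mul, transpose_mul, transpose_mul, transpose_transpose, diagonal_transpose,
    Matrix.mul_assoc, Matrix.mul_assoc, (mem_orthogonalGroup_iff' _ ℝ).1 h.left_mem,
    Matrix.mul_one]

theorem mul_right_eq (h : IsSVD A U V σ) : A * V = U * diagonal σ := by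
  rw [h.eq_mul, Matrix.mul_assoc, (mem_orthogonalGroup_iff' _ ℝ).1 h.right_mem, Matrix.mul_one]

theorem dotProduct_mulVec_le (h : IsSVD A U V σ) {w : Fin n → ℝ}
    (hw : ∀ l < k, (Uᵀ *ᵥ w) l = 0) : w ⬝ᵥ A *ᵥ w ≤ σ k * (w ⬝ᵥ w) := by
  have hA : w ⬝ᵥ A *ᵥ w = (Uᵀ *ᵥ w) ⬝ᵥ (diagonal σ *ᵥ (Vᵀ *ᵥ w)) := by
    rw [mulVec_mulVec, dotProduct_mulVec_mulVec, transpose_transpose, ← Matrix.mul_assoc,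
      ← h.eq_mul]
  have hU := dotProduct_mulVec_of_mem_orthogonalGroup (transpose_mem_orthogonalGroup h.left_mem) w
  have hV := dotProduct_mulVec_of_mem_orthogonalGroup (transpose_mem_orthogonalGroup h.right_mem) w
  have hterm : ∀ l, (Uᵀ *ᵥ w) l * (σ l * (Vᵀ *ᵥ w) l) ≤
      σ k / 2 * ((Uᵀ *ᵥ w) l * (Uᵀ *ᵥ w) l + (Vᵀ *ᵥ w) l * (Vᵀ *ᵥ w) l) := fun l => by
    rcases lt_or_ge l k with hl | hl
    · rw [hw l hl]
      nlinarith [h.nonneg k, mul_self_nonneg ((Vᵀ *ᵥ w) l)]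
    · nlinarith [h.nonneg l, h.antitone hl, mul_self_nonneg ((Uᵀ *ᵥ w) l - (Vᵀ *ᵥ w) l),
        mul_self_nonneg ((Uᵀ *ᵥ w) l), mul_self_nonneg ((Vᵀ *ᵥ w) l)]
  calc w ⬝ᵥ A *ᵥ w = ∑ l, (Uᵀ *ᵥ w) l * (σ l * (Vᵀ *ᵥ w) l) := by
        rw [hA]; simp only [dotProduct, mulVec_diagonal]
    _ ≤ _ := Finset.sum_le_sum fun l _ => hterm l
    _ = σ k / 2 * ((Uᵀ *ᵥ w) ⬝ᵥ (Uᵀ *ᵥ w) + (Vᵀ *ᵥ w) ⬝ᵥ (Vᵀ *ᵥ w)) := by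
        rw [← Finset.mul_sum, Finset.sum_add_distrib, dotProduct, dotProduct]
    _ = σ k * (w ⬝ᵥ w) := by rw [hU, hV]; ring

theorem sub_le_singularValue (h : IsSVD A U V σ) (hX : CoerciveWith γ (Xᵀ * X)) (hγ : 0 < γ)
    (hA : ‖A - X * Xᵀ‖ ≤ δ) (hk : (k : ℕ) < d) : γ - δ ≤ σ k := by
  obtain ⟨y, hy, hUy⟩ := exists_ne_zero_mulVec_apply_eq_zero (Uᵀ * X) hk
  have hw : 0 < (X *ᵥ y) ⬝ᵥ (X *ᵥ y) := by
    rw [dotProduct_mulVec_mulVec]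
    exact (mul_pos hγ (dotProduct_self_pos hy)).trans_le (hX y)
  have hupper := h.dotProduct_mulVec_le (w := X *ᵥ y) fun l hl => by
    rw [mulVec_mulVec]; exact hUy l hl
  have hsignal : γ * ((X *ᵥ y) ⬝ᵥ (X *ᵥ y)) ≤ (X *ᵥ y) ⬝ᵥ (X * Xᵀ) *ᵥ (X *ᵥ y) := by
    have hS := hX.mul_dotProduct_mulVec_le hγ.le y
    rwa [← dotProduct_mulVec_mulVec, ← mulVec_mulVec, dotProduct_mulVec_mulVec Xᵀ Xᵀ,
      transpose_transpose] at hS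
  have hnoise := (abs_le.1 (abs_dotProduct_mulVec_self_le (A - X * Xᵀ) (X *ᵥ y))).1
  have hδ := mul_le_mul_of_nonneg_right hA hw.le
  rw [sub_mulVec, dotProduct_sub] at hnoise
  exact le_of_mul_le_mul_right (by linarith) hw

-- A symmetric matrix maps `u - v` to `-σ (u - v)`, and it has no eigenvalue below `-δ`.
theorem col_right_eq_col_left (h : IsSVD A U V σ) (hAs : Aᵀ = A) (hA : ‖A - X * Xᵀ‖ ≤ δ)
    (hk : δ < σ k) : V.col k = U.col k := by
  set w := U.col k - V.col k with hw
  have hAw : A *ᵥ w = -σ k • w := by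
    rw [hw, mulVec_sub, mulVec_col_of_mul_eq (h.mul_left_eq hAs),
      mulVec_col_of_mul_eq h.mul_right_eq]
    module
  have hsignal : 0 ≤ w ⬝ᵥ (X * Xᵀ) *ᵥ w := by
    have hnn := dotProduct_self_nonneg (Xᵀ *ᵥ w)
    rwa [dotProduct_mulVec_mulVec, transpose_transpose] at hnn
  have hnoise := (abs_le.1 (abs_dotProduct_mulVec_self_le (A - X * Xᵀ) w)).1
  rw [sub_mulVec, dotProduct_sub w (A *ᵥ w), hAw, dotProduct_smul, smul_eq_mul] at hnoise
  by_contra hne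
  have hpos := dotProduct_self_pos (sub_ne_zero.2 (Ne.symm hne))
  nlinarith

end IsSVD

theorem IsASE.exists_isSVD (h : IsASE A Y) :
    ∃ (hd : d ≤ n) (U V : Matrix (Fin n) (Fin n) ℝ) (σ : Fin n → ℝ), IsSVD A U V σ ∧
      Y = U.submatrix id (Fin.castLE hd) * diagonal fun a => √(σ (Fin.castLE hd a)) := by
  obtain ⟨hd, U, V, σ, hU, hV, hσ, hmono, hA, hY⟩ := h
  refine ⟨hd, U, V, σ, ⟨hU, hV, hσ, hmono, hA⟩, ?_⟩
  ext i a
  rw [hY, mul_diagonal, submatrix_apply, id]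

-- The first `d` singular values of a small symmetric perturbation of `X Xᵀ` are eigenvalues.
theorem IsASE.exists_diagonal (h : IsASE A Y) (hX : CoerciveWith γ (Xᵀ * X)) (hAs : Aᵀ = A)
    (hA : ‖A - X * Xᵀ‖ ≤ δ) (hδ : 2 * δ < γ) :
    ∃ τ : Fin d → ℝ, Yᵀ * Y = diagonal τ ∧ A * Y = Y * diagonal τ ∧ ∀ a, γ - δ ≤ τ a := by
  have hδ0 : 0 ≤ δ := (norm_nonneg _).trans hA
  obtain ⟨hd, U, V, σ, hsvd, rfl⟩ := h.exists_isSVD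
  set c := Fin.castLE hd
  have hσ : ∀ a, γ - δ ≤ σ (c a) := fun a => hsvd.sub_le_singularValue hX (by linarith) hA a.2
  have hVU : V.submatrix id c = U.submatrix id c := by
    ext i a
    exact congrFun (hsvd.col_right_eq_col_left hAs hA (by linarith [hσ a])) i
  have hAU : A * U.submatrix id c = U.submatrix id c * diagonal (σ ∘ c) := by
    ext i a
    have hcol := congrFun (congrFun (hsvd.mul_left_eq hAs) i) (c a)
    rw [mul_diagonal] at hcol ⊢
    exact hcol.trans (congrArg (· * _) (congrFun (congrFun hVU i) a))
  refine ⟨σ ∘ c, ?_, ?_, hσ⟩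
  · have hUU : (U.submatrix id c)ᵀ * U.submatrix id c = 1 := by
      rw [transpose_submatrix, ← submatrix_mul _ _ _ _ _ Function.bijective_id,
        (mem_orthogonalGroup_iff' _ ℝ).1 hsvd.left_mem,
        submatrix_one _ (Fin.castLE_injective hd)]
    rw [transpose_mul, diagonal_transpose, Matrix.mul_assoc, ← Matrix.mul_assoc _ _ (diagonal _),
      hUU, Matrix.one_mul, diagonal_mul_diagonal]
    simp only [Real.mul_self_sqrt (hsvd.nonneg _), Function.comp_def]
  · rw [← Matrix.mul_assoc, hAU, Matrix.mul_assoc, Matrix.mul_assoc, diagonal_mul_diagonal,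
      diagonal_mul_diagonal]
    simp only [mul_comm]

theorem IsRotatedASE.mul_orthogonal {W : Matrix (Fin d) (Fin d) ℝ} (h : IsRotatedASE A Y)
    (hW : W ∈ orthogonalGroup (Fin d) ℝ) : IsRotatedASE A (Y * W) := by
  obtain ⟨Y₀, W₀, hY₀, hW₀, rfl⟩ := h
  exact ⟨Y₀, W₀ * W, hY₀, mul_mem hW₀ hW, Matrix.mul_assoc _ _ _⟩

theorem IsRotatedASE.mul_eq_and_coerciveWith (h : IsRotatedASE A Y)
    (hX : CoerciveWith γ (Xᵀ * X)) (hAs : Aᵀ = A) (hA : ‖A - X * Xᵀ‖ ≤ δ) (hδ : 2 * δ < γ) :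
    A * Y = Y * (Yᵀ * Y) ∧ CoerciveWith (γ - δ) (Yᵀ * Y) := by
  obtain ⟨Y₀, W, hY₀, hW, rfl⟩ := h
  obtain ⟨τ, hgram, hAY, hτ⟩ := hY₀.exists_diagonal hX hAs hA hδ
  have hgramW : (Y₀ * W)ᵀ * (Y₀ * W) = Wᵀ * (diagonal τ * W) := by
    rw [transpose_mul, Matrix.mul_assoc, ← Matrix.mul_assoc _ _ W, hgram]
  refine ⟨?_, fun v => ?_⟩
  · rw [hgramW, ← Matrix.mul_assoc, hAY, Matrix.mul_assoc Y₀ W, ← Matrix.mul_assoc W,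
      (mem_orthogonalGroup_iff _ ℝ).1 hW, Matrix.one_mul, Matrix.mul_assoc]
  · rw [hgramW, ← dotProduct_mulVec_mulVec, ← mulVec_mulVec,
      ← dotProduct_mulVec_of_mem_orthogonalGroup hW v, dotProduct, dotProduct, Finset.mul_sum]
    refine Finset.sum_le_sum fun a _ => ?_
    rw [mulVec_diagonal, mul_left_comm _ (τ a)]
    exact mul_le_mul_of_nonneg_right (hτ a) (mul_self_nonneg _)

theorem l2_opNorm_sq_le_of_mul_eq (h : A * Y = Y * (Yᵀ * Y)) : ‖Y‖ ^ 2 ≤ ‖A‖ := by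
  rcases (norm_nonneg Y).eq_or_lt with h0 | h0
  · simp [← h0]
  have hG : ‖Yᵀ * Y‖ ^ 2 = ‖Yᵀ * (A * Y)‖ := by
    rw [h, ← Matrix.mul_assoc, ← l2_opNorm_transpose_mul_self, transpose_mul, transpose_transpose]
  have hle : ‖Yᵀ * (A * Y)‖ ≤ ‖Y‖ * (‖A‖ * ‖Y‖) :=
    (l2_opNorm_mul _ _).trans (by rw [l2_opNorm_transpose]; gcongr; exact l2_opNorm_mul _ _)
  rw [l2_opNorm_transpose_mul_self] at hG
  exact le_of_mul_le_mul_left (by nlinarith) (pow_pos h0 2)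

end SpectralEmbedding

section Procrustes

open Matrix
open scoped Matrix.Norms.L2Operator

variable {m k : Type*} [Fintype m] [Fintype k]

theorem sum_sq_eq_trace (M : Matrix m k ℝ) :
    ∑ i, ∑ a, M i a ^ 2 = (Mᵀ * M).trace := by
  rw [Finset.sum_comm]
  simp only [trace, diag_apply, mul_apply, transpose_apply, sq]

variable [DecidableEq m] {H : Matrix m m ℝ} {n d : ℕ} {X Y : Matrix (Fin n) (Fin d) ℝ}

theorem exp_mem_orthogonalGroup {K : Matrix m m ℝ} (hK : Kᵀ = -K) :
    NormedSpace.exp K ∈ orthogonalGroup m ℝ := by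
  rw [mem_orthogonalGroup_iff', ← exp_transpose, hK,
    ← Matrix.exp_add_of_commute _ _ (Commute.refl K).neg_left, neg_add_cancel, NormedSpace.exp_zero]

theorem one_sub_vecMulVec_mem_orthogonalGroup {v : m → ℝ} (hv : v ≠ 0) :
    1 - (2 / (v ⬝ᵥ v)) • vecMulVec v v ∈ orthogonalGroup m ℝ := by
  have hvv : vecMulVec v v * vecMulVec v v = (v ⬝ᵥ v) • vecMulVec v v := by
    rw [vecMulVec_mul_vecMulVec, vecMulVec_smul]
  have hcoeff : 2 / (v ⬝ᵥ v) * (2 / (v ⬝ᵥ v)) * (v ⬝ᵥ v) = 2 / (v ⬝ᵥ v) + 2 / (v ⬝ᵥ v) := by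
    field_simp [(dotProduct_self_pos hv).ne']
    norm_num
  rw [mem_orthogonalGroup_iff', transpose_sub, transpose_one, transpose_smul, transpose_vecMulVec,
    Matrix.sub_mul, Matrix.mul_sub, Matrix.mul_sub, Matrix.one_mul, Matrix.one_mul, Matrix.mul_one,
    Matrix.smul_mul, Matrix.mul_smul, hvv, smul_smul, smul_smul, hcoeff]
  module

-- The derivative of `t ↦ tr (H exp (t (Hᵀ - H)))` at `0` is half the squared Frobenius norm of
-- `Hᵀ - H`.
theorem isSymm_of_trace_mul_le (h : ∀ W ∈ orthogonalGroup m ℝ, (H * W).trace ≤ H.trace) :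
    H.IsSymm := by
  set K := Hᵀ - H with hK
  have hKt : Kᵀ = -K := by rw [hK, transpose_sub, transpose_transpose, neg_sub]
  have hderiv : HasDerivAt (fun t : ℝ => (H * NormedSpace.exp (t • K)).trace) (H * K).trace 0 := by
    have hexp := (hasDerivAt_exp_smul_const K (0 : ℝ)).const_mul H
    rw [zero_smul, NormedSpace.exp_zero, one_mul] at hexp
    exact (traceLinearMap m ℝ ℝ).toContinuousLinearMap.hasFDerivAt.comp_hasDerivAt 0 hexp
  have hmax : IsLocalMax (fun t : ℝ => (H * NormedSpace.exp (t • K)).trace) 0 :=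
    Eventually.of_forall fun t => by
      simpa using h _ (exp_mem_orthogonalGroup (K := t • K) (by rw [transpose_smul, hKt, smul_neg]))
  have htr := hmax.hasDerivAt_eq_zero hderiv
  have hKK : (Kᴴ * K).trace = 0 := by
    have hsq : (Hᵀ * K).trace = -(H * K).trace := by
      rw [← trace_transpose, transpose_mul, hKt, transpose_transpose, Matrix.neg_mul, trace_neg,
        trace_mul_comm]
    rw [conjTranspose_eq_transpose_of_trivial, hK, transpose_sub, transpose_transpose, ← hK,
      Matrix.sub_mul, trace_sub, hsq, htr, neg_zero, sub_zero]
  exact sub_eq_zero.1 (trace_conjTranspose_mul_self_eq_zero_iff.1 hKK)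

theorem posSemidef_of_trace_mul_le (h : ∀ W ∈ orthogonalGroup m ℝ, (H * W).trace ≤ H.trace) :
    H.PosSemidef := by
  refine PosSemidef.of_dotProduct_mulVec_nonneg (isSymm_of_trace_mul_le h) fun v => ?_
  rw [star_trivial]
  rcases eq_or_ne v 0 with rfl | hv
  · simp
  have hrefl := h _ (one_sub_vecMulVec_mem_orthogonalGroup hv)
  rw [Matrix.mul_sub, Matrix.mul_one, Matrix.mul_smul, trace_sub, trace_smul, mul_vecMulVec,
    trace_vecMulVec, smul_eq_mul, sub_le_self_iff,
    dotProduct_comm (H *ᵥ v)] at hrefl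
  exact nonneg_of_mul_nonneg_right hrefl (div_pos two_pos (dotProduct_self_pos hv))

theorem isNearestRotation_iff_trace :
    IsNearestRotation Y X ↔ ∀ W ∈ orthogonalGroup (Fin d) ℝ,
      (Xᵀ * Y * W).trace ≤ (Xᵀ * Y).trace := by
  refine forall₂_congr fun W hW => ?_
  have hexpand (M : Matrix (Fin n) (Fin d) ℝ) : ∑ i, ∑ a, (M i a - X i a) ^ 2 =
      (Mᵀ * M).trace - 2 * (Xᵀ * M).trace + (Xᵀ * X).trace := by
    have hMX : (Mᵀ * X).trace = (Xᵀ * M).trace := by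
      rw [← trace_transpose, transpose_mul, transpose_transpose]
    refine (sum_sq_eq_trace (M - X)).trans ?_
    rw [transpose_sub, Matrix.sub_mul, Matrix.mul_sub, Matrix.mul_sub, trace_sub, trace_sub,
      trace_sub, hMX]
    ring
  have hgram : ((Y * W)ᵀ * (Y * W)).trace = (Yᵀ * Y).trace := by
    rw [transpose_mul, Matrix.mul_assoc, trace_mul_comm, Matrix.mul_assoc, Matrix.mul_assoc,
      (mem_orthogonalGroup_iff _ ℝ).1 hW, Matrix.mul_one]
  rw [hexpand, hexpand, hgram, ← Matrix.mul_assoc]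
  constructor <;> intro h <;> linarith

theorem IsNearestRotation.posSemidef (h : IsNearestRotation Y X) : (Xᵀ * Y).PosSemidef :=
  posSemidef_of_trace_mul_le (isNearestRotation_iff_trace.1 h)

theorem isCompact_orthogonalGroup : IsCompact (orthogonalGroup m ℝ : Set (Matrix m m ℝ)) := by
  refine Metric.isCompact_of_isClosed_isBounded ?_ <|
    (Metric.isBounded_closedBall (x := 0) (r := 1)).subset fun W hW =>
      mem_closedBall_zero_iff.2 (l2_opNorm_le_one_of_mem_orthogonalGroup hW)
  have hset : (orthogonalGroup m ℝ : Set (Matrix m m ℝ)) = {W | Wᵀ * W = 1} :=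
    Set.ext fun W => mem_orthogonalGroup_iff' m ℝ
  rw [hset]
  exact isClosed_eq (by fun_prop) continuous_const

theorem exists_isNearestRotation (X Y : Matrix (Fin n) (Fin d) ℝ) :
    ∃ W ∈ orthogonalGroup (Fin d) ℝ, IsNearestRotation (Y * W) X := by
  obtain ⟨W, hW, hmax⟩ := isCompact_orthogonalGroup.exists_isMaxOn ⟨1, one_mem _⟩
    (f := fun W => (Xᵀ * Y * W).trace) (Continuous.continuousOn (by fun_prop))
  refine ⟨W, hW, isNearestRotation_iff_trace.2 fun W' hW' => ?_⟩
  simpa only [Set.mem_ofPred_eq, Matrix.mul_assoc] using hmax (mul_mem hW hW')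

end Procrustes

section OrderCalculus

open Asymptotics Matrix
open scoped Matrix.Norms.L2Operator

variable {ι : Type*} {l : Filter ι} {n : ι → ℕ} {m k r : ι → Type*}
  [∀ i, Fintype (m i)] [∀ i, Fintype (k i)] [∀ i, Fintype (r i)]
  [∀ i, DecidableEq (k i)] [∀ i, DecidableEq (r i)] {p q : ℝ}

/-- Along the filter `l`, the operator norm of the matrix `M i` is `O((n i) ^ p)`. This is `IsBigO`
for a family of matrices whose dimensions depend on `i`. -/
def HasOrder (l : Filter ι) (n : ι → ℕ) (M : ∀ i, Matrix (m i) (k i) ℝ) (p : ℝ) : Prop :=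
  (fun i => ‖M i‖) =O[l] fun i => (n i : ℝ) ^ p

theorem hasOrder_of_l2_opNorm_le {M : ∀ i, Matrix (m i) (k i) ℝ} {C : ℝ}
    (h : ∀ᶠ i in l, ‖M i‖ ≤ C * (n i : ℝ) ^ p) : HasOrder l n M p :=
  IsBigO.of_bound C <| h.mono fun _ hi => by
    rwa [norm_norm, Real.norm_of_nonneg (Real.rpow_nonneg (Nat.cast_nonneg _) _)]

namespace HasOrder

variable {M N : ∀ i, Matrix (m i) (k i) ℝ}

theorem exists_pos_bound (h : HasOrder l n M p) :
    ∃ C > 0, ∀ᶠ i in l, ‖M i‖ ≤ C * (n i : ℝ) ^ p := by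
  obtain ⟨C, hC, hM⟩ := IsBigO.exists_pos h
  exact ⟨C, hC, hM.bound.mono fun i hi => by
    rwa [norm_norm, Real.norm_of_nonneg (Real.rpow_nonneg (Nat.cast_nonneg _) _)] at hi⟩

theorem congr' (h : HasOrder l n M p) (hMN : ∀ᶠ i in l, M i = N i) : HasOrder l n N p :=
  IsBigO.congr' h (hMN.mono fun _ hi => congrArg norm hi) .rfl

theorem mono (h : HasOrder l n M p) (hn : Tendsto n l atTop) (hpq : p ≤ q) : HasOrder l n M q := by
  refine IsBigO.trans h (IsBigO.of_bound 1 ?_)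
  filter_upwards [hn.eventually_ge_atTop 1] with i hi
  rw [one_mul, Real.norm_of_nonneg (by positivity), Real.norm_of_nonneg (by positivity)]
  exact Real.rpow_le_rpow_of_exponent_le (by exact_mod_cast hi) hpq

theorem add (hM : HasOrder l n M p) (hN : HasOrder l n N p) :
    HasOrder l n (fun i => M i + N i) p :=
  (IsBigO.of_bound 1 (.of_forall fun i => by
    simpa [abs_of_nonneg (add_nonneg (norm_nonneg (M i)) (norm_nonneg (N i)))] using
      norm_add_le (M i) (N i))).trans (IsBigO.add hM hN)

theorem neg (hM : HasOrder l n M p) : HasOrder l n (fun i => -M i) p :=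
  IsBigO.congr_left hM fun i => (norm_neg (M i)).symm

theorem sub (hM : HasOrder l n M p) (hN : HasOrder l n N p) :
    HasOrder l n (fun i => M i - N i) p := by
  simpa only [sub_eq_add_neg] using hM.add hN.neg

theorem mul {N : ∀ i, Matrix (k i) (r i) ℝ} (hM : HasOrder l n M p) (hN : HasOrder l n N q) :
    HasOrder l n (fun i => M i * N i) (p + q) := by
  have hprod : (fun i => ‖M i * N i‖) =O[l] fun i => ‖M i‖ * ‖N i‖ :=
    IsBigO.of_bound 1 (.of_forall fun i => by simpa using l2_opNorm_mul (M i) (N i))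
  refine (hprod.trans (IsBigO.mul hM hN)).trans (IsBigO.of_bound 1 (.of_forall fun i => ?_))
  rw [one_mul, Real.norm_of_nonneg (by positivity), Real.norm_of_nonneg (by positivity)]
  exact Real.le_rpow_add (Nat.cast_nonneg _) p q

theorem inv_smul (hM : HasOrder l n M p) :
    HasOrder l n (fun i => (n i : ℝ)⁻¹ • M i) (p - 1) := by
  obtain ⟨C, hC, hM⟩ := hM.exists_pos_bound
  refine hasOrder_of_l2_opNorm_le (C := C) (hM.mono fun i hi => ?_)
  rw [norm_smul, norm_inv, Real.norm_natCast]
  calc _ ≤ (n i : ℝ)⁻¹ * (C * (n i : ℝ) ^ p) := by gcongr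
    _ ≤ C * (n i : ℝ) ^ (p - 1) := by
      rw [mul_left_comm, ← Real.rpow_neg_one, sub_eq_neg_add]
      gcongr
      exact Real.le_rpow_add (Nat.cast_nonneg _) _ _

theorem transpose [∀ i, DecidableEq (m i)] (hM : HasOrder l n M p) :
    HasOrder l n (fun i => (M i)ᵀ) p :=
  IsBigO.congr_left hM fun i => (l2_opNorm_transpose (M i)).symm

theorem eventually_lt (h : HasOrder l n M p) (hn : Tendsto n l atTop) (hpq : p < q) {ε : ℝ}
    (hε : 0 < ε) : ∀ᶠ i in l, ‖M i‖ < ε * (n i : ℝ) ^ q := by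
  obtain ⟨C, -, hM⟩ := h.exists_pos_bound
  have hlarge : Tendsto (fun i => (n i : ℝ) ^ (q - p)) l atTop :=
    (tendsto_rpow_atTop (sub_pos.2 hpq)).comp (tendsto_natCast_atTop_atTop.comp hn)
  filter_upwards [hM, hn.eventually_gt_atTop 0, hlarge.eventually_gt_atTop (C / ε)] with i hMi hi hq
  have hpos : (0 : ℝ) < n i := by exact_mod_cast hi
  refine hMi.trans_lt ?_
  rw [Real.rpow_sub hpos, div_lt_div_iff₀ hε (Real.rpow_pos_of_pos hpos p)] at hq
  linarith

end HasOrder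

end OrderCalculus

section Perturbation

open Matrix
open scoped Matrix.Norms.L2Operator

section Algebra

variable {n d : ℕ} {X Y : Matrix (Fin n) (Fin d) ℝ} {E : Matrix (Fin n) (Fin n) ℝ}

/-- The matrix `K` for which `X K` approximates a factor `Y` of a perturbation of `X Xᵀ`; it is the
one with `X Xᵀ Y = X K (Yᵀ Y)`. -/
noncomputable def alignment (X Y : Matrix (Fin n) (Fin d) ℝ) : Matrix (Fin d) (Fin d) ℝ :=
  Xᵀ * Y * (Yᵀ * Y)⁻¹

/-- The part of a factor `Y` of a perturbation of `X Xᵀ` that is not explained by `X`. -/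
noncomputable def alignmentResidual (X Y : Matrix (Fin n) (Fin d) ℝ) : Matrix (Fin n) (Fin d) ℝ :=
  Y - X * alignment X Y

theorem mul_alignment_add_alignmentResidual (X Y : Matrix (Fin n) (Fin d) ℝ) :
    X * alignment X Y + alignmentResidual X Y = Y :=
  add_sub_cancel _ _

theorem alignmentResidual_eq (hY : (X * Xᵀ + E) * Y = Y * (Yᵀ * Y)) (hG : IsUnit (Yᵀ * Y).det) :
    alignmentResidual X Y = E * Y * (Yᵀ * Y)⁻¹ := by
  rw [alignmentResidual, sub_eq_iff_eq_add', alignment, ← Matrix.mul_assoc, ← Matrix.mul_assoc,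
    ← Matrix.add_mul, ← Matrix.add_mul, hY, mul_nonsing_inv_cancel_right _ _ hG]

theorem mul_alignmentResidual_eq {m : Type*} (q : Matrix m (Fin n) ℝ)
    (hY : (X * Xᵀ + E) * Y = Y * (Yᵀ * Y)) (hG : IsUnit (Yᵀ * Y).det) :
    q * alignmentResidual X Y = q * (E * X) * alignment X Y * (Yᵀ * Y)⁻¹ +
      q * E * alignmentResidual X Y * (Yᵀ * Y)⁻¹ := by
  calc q * alignmentResidual X Y = q * E * Y * (Yᵀ * Y)⁻¹ := by
        rw [alignmentResidual_eq hY hG]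
        simp only [Matrix.mul_assoc]
    _ = q * E * (X * alignment X Y + alignmentResidual X Y) * (Yᵀ * Y)⁻¹ := by
        rw [mul_alignment_add_alignmentResidual]
    _ = _ := by simp only [Matrix.mul_add, Matrix.add_mul, Matrix.mul_assoc]

theorem mul_alignment_sub_one_add_alignmentResidual (X Y : Matrix (Fin n) (Fin d) ℝ) :
    X * (alignment X Y - 1) + alignmentResidual X Y = Y - X := by
  rw [Matrix.mul_sub, Matrix.mul_one, sub_add_eq_add_sub, mul_alignment_add_alignmentResidual]

theorem CoerciveWith.mul_trace_le {m : Type*} [Fintype m] {G : Matrix m m ℝ} {c : ℝ}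
    (hG : CoerciveWith c G) {k : Type*} [Fintype k] (M : Matrix m k ℝ) :
    c * (Mᵀ * M).trace ≤ (Mᵀ * G * M).trace := by
  have hcol (N : Matrix m k ℝ) : (Mᵀ * N).trace = ∑ j, M.col j ⬝ᵥ N.col j := rfl
  rw [Matrix.mul_assoc, hcol, hcol, Finset.mul_sum]
  exact Finset.sum_le_sum fun j _ => hG (M.col j)

-- The trace of `Δ (G Δ + Δ H)` with `Δ = G - H` dominates the trace of `Δ G Δ`.
theorem CoerciveWith.mul_l2_opNorm_sub_le {m : Type*} [Fintype m] [DecidableEq m]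
    {G H : Matrix m m ℝ} {c : ℝ} (hc : 0 ≤ c) (hG : CoerciveWith c G) (hGt : Gᵀ = G)
    (hH : H.PosSemidef) :
    c * ‖G - H‖ ≤ Fintype.card m * ‖G * G - H * H‖ := by
  set Δ := G - H with hΔ
  have hHt : Hᵀ = H := hH.isHermitian
  have hΔt : Δᵀ = Δ := by rw [hΔ, transpose_sub, hGt, hHt]
  have hH0 : CoerciveWith 0 H := fun v => by simpa using hH.dotProduct_mulVec_nonneg v
  have hfactor : G * G - H * H = G * Δ + Δ * H := by rw [hΔ]; noncomm_ring
  have htrace : (Δ * (G * G - H * H)).trace = (Δᵀ * G * Δ).trace + (Δᵀ * H * Δ).trace := by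
    rw [hfactor, Matrix.mul_add, trace_add, hΔt, Matrix.mul_assoc, Matrix.mul_assoc Δ H,
      trace_mul_comm Δ (Δ * H), Matrix.mul_assoc Δ H, trace_mul_comm Δ (H * Δ), Matrix.mul_assoc]
  have hlower : c * ‖Δ‖ ^ 2 ≤ (Δ * (G * G - H * H)).trace := by
    have hfrob := (l2_opNorm_sq_le_sum_sq Δ).trans_eq (sum_sq_eq_trace Δ)
    linarith [mul_le_mul_of_nonneg_left hfrob hc, hG.mul_trace_le Δ, hH0.mul_trace_le Δ]
  have hupper : (Δ * (G * G - H * H)).trace ≤ Fintype.card m * (‖Δ‖ * ‖G * G - H * H‖) :=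
    (le_abs_self _).trans ((abs_trace_le _).trans (by gcongr; exact l2_opNorm_mul _ _))
  rcases (norm_nonneg Δ).eq_or_lt with h0 | h0
  · rw [← h0, mul_zero]
    positivity
  · exact le_of_mul_le_mul_right (by nlinarith) h0

end Algebra

variable {ι : Type*} {l : Filter ι} {n : ι → ℕ} {d : ℕ}
  {X Y : ∀ i, Matrix (Fin (n i)) (Fin d) ℝ} {E : ∀ i, Matrix (Fin (n i)) (Fin (n i)) ℝ}

/-- Along `l`, the matrix `X Xᵀ` with `n` rows has nonzero eigenvalues of exact order `n`, and the
perturbation `E` is as small as a matrix of independent centered bounded entries is. The exponent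
`3/4` only needs to lie between the true value `1/2` and `1`; it results from a Frobenius norm bound
on `E ^ 2`. -/
structure IsTamePerturbation (l : Filter ι) (n : ι → ℕ) (X : ∀ i, Matrix (Fin (n i)) (Fin d) ℝ)
    (E : ∀ i, Matrix (Fin (n i)) (Fin (n i)) ℝ) : Prop where
  tendsto : Tendsto n l atTop
  symm : ∀ᶠ i in l, (E i)ᵀ = E i
  exists_coercive : ∃ c > 0, ∀ᶠ i in l, CoerciveWith (c * n i) ((X i)ᵀ * X i)
  signal : HasOrder l n X (1 / 2)
  noise : HasOrder l n E (3 / 4)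
  noise_mul : HasOrder l n (fun i => E i * X i) 1
  quadratic : HasOrder l n (fun i => (X i)ᵀ * (E i * X i)) 1

/-- `Y` is a well-conditioned factor of the part of `X Xᵀ + E` that corresponds to an invariant
subspace of dimension `d`. -/
structure IsPerturbedFactor (l : Filter ι) (n : ι → ℕ) (X : ∀ i, Matrix (Fin (n i)) (Fin d) ℝ)
    (E : ∀ i, Matrix (Fin (n i)) (Fin (n i)) ℝ) (Y : ∀ i, Matrix (Fin (n i)) (Fin d) ℝ) : Prop
    extends IsTamePerturbation l n X E where
  mul_eq : ∀ᶠ i in l, (X i * (X i)ᵀ + E i) * Y i = Y i * ((Y i)ᵀ * Y i)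
  exists_coercive_gram : ∃ c > 0, ∀ᶠ i in l, CoerciveWith (c * n i) ((Y i)ᵀ * Y i)

theorem IsTamePerturbation.isPerturbedFactor (h : IsTamePerturbation l n X E)
    (hY : ∀ᶠ i in l, IsRotatedASE (X i * (X i)ᵀ + E i) (Y i)) : IsPerturbedFactor l n X E Y := by
  obtain ⟨c, hc, hX⟩ := h.exists_coercive
  have hgap : ∀ᶠ i in l, (X i * (X i)ᵀ + E i) * Y i = Y i * ((Y i)ᵀ * Y i) ∧
      CoerciveWith (c * n i - c / 3 * n i) ((Y i)ᵀ * Y i) := by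
    filter_upwards [hY, hX, h.symm, h.tendsto.eventually_gt_atTop 0,
      h.noise.eventually_lt h.tendsto (by norm_num : (3 / 4 : ℝ) < 1) (div_pos hc three_pos)]
      with i hYi hXi hEt hi hE
    have hpos : (0 : ℝ) < n i := by exact_mod_cast hi
    rw [Real.rpow_one] at hE
    refine hYi.mul_eq_and_coerciveWith hXi ?_ (by rw [add_sub_cancel_left]; exact hE.le) ?_
    · rw [transpose_add, transpose_mul, transpose_transpose, hEt]
    · nlinarith
  refine ⟨h, hgap.mono fun i hi => hi.1, c - c / 3, by linarith, hgap.mono fun i hi => ?_⟩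
  rw [sub_mul]
  exact hi.2

theorem hasOrder_inv_of_coerciveWith {M : ι → Matrix (Fin d) (Fin d) ℝ} (hn : Tendsto n l atTop)
    (hM : ∃ c > 0, ∀ᶠ i in l, CoerciveWith (c * n i) (M i)) :
    HasOrder l n (fun i => (M i)⁻¹) (-1) := by
  obtain ⟨c, hc, hM⟩ := hM
  refine hasOrder_of_l2_opNorm_le (C := c⁻¹) ?_
  filter_upwards [hM, hn.eventually_gt_atTop 0] with i hi hpos
  rw [Real.rpow_neg_one, ← mul_inv]
  exact hi.l2_opNorm_inv_le (by positivity)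

namespace IsPerturbedFactor

theorem isUnit_det (h : IsPerturbedFactor l n X E Y) :
    ∀ᶠ i in l, IsUnit ((Y i)ᵀ * Y i).det := by
  obtain ⟨c, hc, hY⟩ := h.exists_coercive_gram
  filter_upwards [hY, h.tendsto.eventually_gt_atTop 0] with i hi hpos
  exact hi.isUnit_det (by positivity)

theorem hasOrder_inv_gram (h : IsPerturbedFactor l n X E Y) :
    HasOrder l n (fun i => ((Y i)ᵀ * Y i)⁻¹) (-1) :=
  hasOrder_inv_of_coerciveWith h.tendsto h.exists_coercive_gram

theorem hasOrder (h : IsPerturbedFactor l n X E Y) : HasOrder l n Y (1 / 2) := by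
  have hA : HasOrder l n (fun i => X i * (X i)ᵀ + E i) 1 :=
    ((h.signal.mul h.signal.transpose).mono h.tendsto (by norm_num)).add
      (h.noise.mono h.tendsto (by norm_num))
  obtain ⟨C, hC, hA⟩ := hA.exists_pos_bound
  refine hasOrder_of_l2_opNorm_le (C := √C) ?_
  filter_upwards [hA, h.mul_eq] with i hAi hYi
  rw [← Real.sqrt_eq_rpow, ← Real.sqrt_mul hC.le]
  rw [Real.rpow_one] at hAi
  exact Real.le_sqrt_of_sq_le ((l2_opNorm_sq_le_of_mul_eq hYi).trans hAi)

theorem hasOrder_alignment (h : IsPerturbedFactor l n X E Y) :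
    HasOrder l n (fun i => alignment (X i) (Y i)) 0 :=
  ((h.signal.transpose.mul h.hasOrder).mul h.hasOrder_inv_gram).mono h.tendsto (by norm_num)

theorem hasOrder_mul_alignmentResidual (h : IsPerturbedFactor l n X E Y) {m : ι → Type*}
    [∀ i, Fintype (m i)] {q : ∀ i, Matrix (m i) (Fin (n i)) ℝ} {a b r : ℝ}
    (hEX : HasOrder l n (fun i => q i * (E i * X i)) a) (hE : HasOrder l n (fun i => q i * E i) b)
    (hV : HasOrder l n (fun i => alignmentResidual (X i) (Y i)) r) (har : a ≤ b + r) :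
    HasOrder l n (fun i => q i * alignmentResidual (X i) (Y i)) (b + r - 1) := by
  have hbound := (((hEX.mul h.hasOrder_alignment).mul h.hasOrder_inv_gram).mono h.tendsto
    (by linarith : a + 0 + -1 ≤ b + r + -1)).add ((hE.mul hV).mul h.hasOrder_inv_gram)
  refine (hbound.congr' ?_).mono h.tendsto (by linarith)
  filter_upwards [h.mul_eq, h.isUnit_det] with i hYi hG
  exact (mul_alignmentResidual_eq (q i) hYi hG).symm

end IsPerturbedFactor

end Perturbation

section AlignedPerturbation

open Matrix
open scoped Matrix.Norms.L2Operator

variable {ι : Type*} {l : Filter ι} {n : ι → ℕ} {d : ℕ}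
  {X Y : ∀ i, Matrix (Fin (n i)) (Fin d) ℝ} {E : ∀ i, Matrix (Fin (n i)) (Fin (n i)) ℝ}

namespace IsPerturbedFactor

theorem hasOrder_alignmentResidual (h : IsPerturbedFactor l n X E Y) :
    HasOrder l n (fun i => alignmentResidual (X i) (Y i)) 0 := by
  have hcrude : HasOrder l n (fun i => alignmentResidual (X i) (Y i)) (1 / 4) := by
    refine (((h.noise.mul h.hasOrder).mul h.hasOrder_inv_gram).congr' ?_).mono h.tendsto
      (by norm_num)
    filter_upwards [h.mul_eq, h.isUnit_det] with i hYi hG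
    exact (alignmentResidual_eq hYi hG).symm
  have hone := h.hasOrder_mul_alignmentResidual (m := fun i => Fin (n i))
    (q := fun i => (1 : Matrix (Fin (n i)) (Fin (n i)) ℝ)) (a := 1) (b := 3 / 4)
    (by simpa only [Matrix.one_mul] using h.noise_mul)
    (by simpa only [Matrix.one_mul] using h.noise) hcrude (by norm_num)
  simp only [Matrix.one_mul] at hone
  exact hone.mono h.tendsto (by norm_num)

theorem hasOrder_transpose_mul_alignmentResidual (h : IsPerturbedFactor l n X E Y) :
    HasOrder l n (fun i => (X i)ᵀ * alignmentResidual (X i) (Y i)) 0 := by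
  have hXE : HasOrder l n (fun i => (X i)ᵀ * E i) 1 :=
    h.noise_mul.transpose.congr' (h.symm.mono fun i hi => by rw [transpose_mul, hi])
  exact (h.hasOrder_mul_alignmentResidual h.quadratic hXE h.hasOrder_alignmentResidual
    (by norm_num)).mono h.tendsto (by norm_num)

theorem hasOrder_quadratic (h : IsPerturbedFactor l n X E Y) :
    HasOrder l n (fun i => (Y i)ᵀ * (E i * Y i)) 1 := by
  have hK := h.hasOrder_alignment
  have hV := h.hasOrder_alignmentResidual
  have hXEX := ((hK.transpose.mul h.quadratic).mul hK).mono h.tendsto (q := 1) (by norm_num)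
  have hVEX := ((hV.transpose.mul h.noise_mul).mul hK).mono h.tendsto (q := 1) (by norm_num)
  have hVEV := (hV.transpose.mul (h.noise.mul hV)).mono h.tendsto (q := 1) (by norm_num)
  refine (((hXEX.add hVEX).add hVEX.transpose).add hVEV).congr' ?_
  filter_upwards [h.symm] with i hE
  conv_rhs => rw [← mul_alignment_add_alignmentResidual (X i) (Y i)]
  simp only [transpose_mul, transpose_add, transpose_transpose, hE, Matrix.mul_add,
    Matrix.add_mul, Matrix.mul_assoc]
  abel

end IsPerturbedFactor

/-- The orders of magnitude that the terms in the expansion of a factor of `X Xᵀ + E` have in a row,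
or in a linear combination `q` of rows. -/
structure IsTameRow (l : Filter ι) (n : ι → ℕ) (X : ∀ i, Matrix (Fin (n i)) (Fin d) ℝ)
    (E : ∀ i, Matrix (Fin (n i)) (Fin (n i)) ℝ) {m : ι → Type*} [∀ i, Fintype (m i)]
    (q : ∀ i, Matrix (m i) (Fin (n i)) ℝ) : Prop where
  signal : HasOrder l n (fun i => q i * X i) 0
  noise : HasOrder l n (fun i => q i * E i) (1 / 2)
  noise_mul : HasOrder l n (fun i => q i * (E i * X i)) (1 / 2)
  noise_noise_mul : HasOrder l n (fun i => q i * E i * (E i * X i)) (5 / 4)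

/-- A perturbed factor `Y` of `X Xᵀ` that is rotated so as to be closest to `X` in Frobenius norm,
which by the Procrustes criterion means that `Xᵀ Y` is positive semidefinite. -/
structure IsAlignedFactor (l : Filter ι) (n : ι → ℕ) (X : ∀ i, Matrix (Fin (n i)) (Fin d) ℝ)
    (E : ∀ i, Matrix (Fin (n i)) (Fin (n i)) ℝ) (Y : ∀ i, Matrix (Fin (n i)) (Fin d) ℝ) : Prop
    extends IsPerturbedFactor l n X E Y where
  posSemidef : ∀ᶠ i in l, ((X i)ᵀ * Y i).PosSemidef

namespace IsAlignedFactor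

-- As `Xᵀ Y` is symmetric, its square differs from that of `Yᵀ Y` by `Yᵀ E Y`.
theorem hasOrder_gram_sub (h : IsAlignedFactor l n X E Y) :
    HasOrder l n (fun i => (Y i)ᵀ * Y i - (X i)ᵀ * Y i) 0 := by
  obtain ⟨c, hc, hG⟩ := h.exists_coercive_gram
  obtain ⟨C, -, hC⟩ := h.hasOrder_quadratic.exists_pos_bound
  refine hasOrder_of_l2_opNorm_le (C := d * C / c) ?_
  filter_upwards [hG, hC, h.mul_eq, h.posSemidef, h.tendsto.eventually_gt_atTop 0]
    with i hGi hCi hYi hH hpos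
  have hsq : ((Y i)ᵀ * Y i) * ((Y i)ᵀ * Y i) - ((X i)ᵀ * Y i) * ((X i)ᵀ * Y i) =
      (Y i)ᵀ * (E i * Y i) := by
    have hHt : (Y i)ᵀ * X i = (X i)ᵀ * Y i := by
      simpa [transpose_mul] using hH.isHermitian.eq
    rw [Matrix.mul_assoc, ← hYi, ← hHt, Matrix.mul_assoc (Y i)ᵀ (X i), hHt]
    simp only [Matrix.add_mul, Matrix.mul_add, Matrix.mul_assoc, add_sub_cancel_left]
  have hnpos : (0 : ℝ) < n i := by exact_mod_cast hpos
  have hGt : ((Y i)ᵀ * Y i)ᵀ = (Y i)ᵀ * Y i := by rw [transpose_mul, transpose_transpose]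
  have hle := hGi.mul_l2_opNorm_sub_le (by positivity) hGt hH
  rw [hsq, Fintype.card_fin] at hle
  rw [Real.rpow_one] at hCi
  rw [Real.rpow_zero, mul_one, le_div_iff₀ hc]
  refine le_of_mul_le_mul_right ?_ hnpos
  calc _ = c * n i * ‖(Y i)ᵀ * Y i - (X i)ᵀ * Y i‖ := by ring
    _ ≤ d * (C * n i) := hle.trans (by gcongr)
    _ = d * C * n i := by ring

theorem hasOrder_alignment_sub_one (h : IsAlignedFactor l n X E Y) :
    HasOrder l n (fun i => alignment (X i) (Y i) - 1) (-1) := by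
  refine ((h.hasOrder_gram_sub.neg.mul h.hasOrder_inv_gram).congr' ?_).mono h.tendsto
    (by norm_num)
  filter_upwards [h.isUnit_det] with i hG
  rw [neg_sub, Matrix.sub_mul, mul_nonsing_inv _ hG, alignment]

theorem hasOrder_transpose_mul_sub (h : IsAlignedFactor l n X E Y) :
    HasOrder l n (fun i => (X i)ᵀ * (Y i - X i)) 0 := by
  refine (((h.signal.transpose.mul (h.signal.mul h.hasOrder_alignment_sub_one)).mono h.tendsto
    (by norm_num)).add h.hasOrder_transpose_mul_alignmentResidual).congr' (.of_forall fun i => ?_)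
  rw [← mul_alignment_sub_one_add_alignmentResidual (X i) (Y i), Matrix.mul_add]

theorem hasOrder_alignment_mul_inv_sub (h : IsAlignedFactor l n X E Y) :
    HasOrder l n (fun i => alignment (X i) (Y i) * ((Y i)ᵀ * Y i)⁻¹ - ((X i)ᵀ * X i)⁻¹) (-2) := by
  have hK := (h.hasOrder_alignment_sub_one.mul h.hasOrder_inv_gram).mono h.tendsto (q := -2)
    (by norm_num)
  have hS := hasOrder_inv_of_coerciveWith h.tendsto h.exists_coercive
  have hGS := h.hasOrder_gram_sub.add h.hasOrder_transpose_mul_sub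
  refine (hK.sub (((hS.mul hGS).mul h.hasOrder_inv_gram).mono h.tendsto (q := -2)
    (by norm_num))).congr' ?_
  obtain ⟨c, hc, hX⟩ := h.exists_coercive
  filter_upwards [hX, h.isUnit_det, h.tendsto.eventually_gt_atTop 0] with i hXi hG hpos
  rw [Matrix.mul_sub, sub_add_sub_cancel, Matrix.mul_sub, Matrix.sub_mul, Matrix.sub_mul,
    Matrix.one_mul, mul_nonsing_inv_cancel_right _ _ hG,
    nonsing_inv_mul _ (hXi.isUnit_det (by positivity)), Matrix.one_mul, sub_sub_sub_cancel_right]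

theorem hasOrder_mul_sub_sub (h : IsAlignedFactor l n X E Y) {m : ι → Type*} [∀ i, Fintype (m i)]
    {q : ∀ i, Matrix (m i) (Fin (n i)) ℝ} (hq : IsTameRow l n X E q) :
    HasOrder l n (fun i => q i * (Y i - X i) - q i * (E i * X i) * ((X i)ᵀ * X i)⁻¹)
      (-3 / 4) := by
  have hqEV := (h.hasOrder_mul_alignmentResidual hq.noise_noise_mul (hq.noise.mul h.noise)
    h.hasOrder_alignmentResidual (by norm_num)).mul h.hasOrder_inv_gram
  have hmain := hq.noise_mul.mul h.hasOrder_alignment_mul_inv_sub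
  refine ((((hq.signal.mul h.hasOrder_alignment_sub_one).mono h.tendsto (by norm_num)).add
    (hmain.mono h.tendsto (by norm_num))).add (hqEV.mono h.tendsto (by norm_num))).congr' ?_
  filter_upwards [h.mul_eq, h.isUnit_det] with i hYi hG
  rw [← mul_alignment_sub_one_add_alignmentResidual (X i) (Y i), Matrix.mul_add,
    mul_alignmentResidual_eq (q i) hYi hG]
  simp only [Matrix.mul_sub, Matrix.mul_assoc]
  abel

end IsAlignedFactor

end AlignedPerturbation

section Identifiability

open Matrix
open scoped Matrix.Norms.L2Operator

variable {m : Type*} [Fintype m]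

theorem sum_sum_sq_le_of_abs_apply_le {M : Matrix m m ℝ} {ε : ℝ} (hM : ∀ a b, |M a b| ≤ ε) :
    ∑ a, ∑ b, M a b ^ 2 ≤ (Fintype.card m * ε) ^ 2 := by
  calc ∑ a, ∑ b, M a b ^ 2 ≤ ∑ _a : m, ∑ _b : m, ε ^ 2 :=
        Finset.sum_le_sum fun a _ => Finset.sum_le_sum fun b _ =>
          sq_le_sq' (abs_le.1 (hM a b)).1 (abs_le.1 (hM a b)).2
    _ = (Fintype.card m * ε) ^ 2 := by
        simp only [Finset.sum_const, Finset.card_univ, nsmul_eq_mul]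
        ring

theorem sum_erase_le_card_mul [DecidableEq m] {f : m → ℝ} {C : ℝ} (hC : 0 ≤ C) {a : m}
    (hf : ∀ b, a ≠ b → f b ≤ C) : ∑ b ∈ Finset.univ.erase a, f b ≤ Fintype.card m * C := by
  refine (Finset.sum_le_card_nsmul _ _ C fun b hb =>
    hf b (Finset.ne_of_mem_erase hb).symm).trans ?_
  rw [nsmul_eq_mul]
  gcongr
  exact Finset.card_le_univ _

theorem neg_half_lt_of_dotProduct_nonneg {u r : m → ℝ} {p q ε : ℝ} {a : m} (hε : 0 ≤ ε)
    (hr : ∀ b, a ≠ b → |r b| ≤ ε) (hp0 : 0 < p) (hp : p ≤ u a) (hq : ∀ b, |u b| ≤ q)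
    (hpq : 2 * (Fintype.card m * (q * ε)) < p) (hnonneg : 0 ≤ u ⬝ᵥ r) : -(1 / 2) < r a := by
  classical
  by_contra! hle
  have hq0 : 0 ≤ q := (abs_nonneg _).trans (hq a)
  have hrest : ∑ b ∈ Finset.univ.erase a, u b * r b ≤ Fintype.card m * (q * ε) :=
    sum_erase_le_card_mul (by positivity) fun b hab => (le_abs_self _).trans
      ((abs_mul _ _).trans_le (mul_le_mul (hq b) (hr b hab) (abs_nonneg _) hq0))
  rw [dotProduct, ← Finset.add_sum_erase _ _ (Finset.mem_univ a)] at hnonneg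
  nlinarith

variable [DecidableEq m]

theorem sum_sum_mul_mul_le_of_monovary {B : Matrix m m ℝ} (hB : B ∈ doublyStochastic ℝ m)
    {f g : m → ℝ} (hfg : Monovary f g) :
    ∑ a, ∑ b, B a b * (f a * g b) ≤ ∑ a, f a * g a := by
  have hlin : IsLinearMap ℝ fun M : Matrix m m ℝ => ∑ a, ∑ b, M a b * (f a * g b) :=
    ⟨fun M N => by simp only [Matrix.add_apply, add_mul, Finset.sum_add_distrib],
      fun r M => by simp only [Matrix.smul_apply, smul_eq_mul, Finset.mul_sum, mul_assoc]⟩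
  have hperm : B ∈ convexHull ℝ {M | ∃ σ : Equiv.Perm m, σ.permMatrix ℝ = M} := by
    rwa [← doublyStochastic_eq_convexHull_permMatrix]
  refine convexHull_min ?_ (convex_halfSpace_le hlin (∑ a, f a * g a)) hperm
  rintro _ ⟨σ, rfl⟩
  simpa [Equiv.Perm.permMatrix, PEquiv.toMatrix_apply] using
    hfg.sum_smul_comp_perm_le_sum_smul (σ := σ)

variable {W : Matrix m m ℝ}

theorem sum_sq_row_of_mem_orthogonalGroup (hW : W ∈ orthogonalGroup m ℝ) (a : m) :
    ∑ b, W a b ^ 2 = 1 := by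
  have h := congrFun₂ ((mem_orthogonalGroup_iff m ℝ).1 hW) a a
  simpa only [mul_apply, transpose_apply, ← sq, one_apply_eq] using h

theorem sq_mem_doublyStochastic_of_mem_orthogonalGroup (hW : W ∈ orthogonalGroup m ℝ) :
    (of fun a b => W a b ^ 2) ∈ doublyStochastic ℝ m :=
  mem_doublyStochastic_iff_sum.2 ⟨fun _ _ => sq_nonneg _, sum_sq_row_of_mem_orthogonalGroup hW,
    sum_sq_row_of_mem_orthogonalGroup (transpose_mem_orthogonalGroup hW)⟩

-- The Hoffman-Wielandt inequality.
theorem sum_sq_sub_le_of_monovary (hW : W ∈ orthogonalGroup m ℝ) {v w : m → ℝ}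
    (hwv : Monovary w v) : ∑ a, (w a - v a) ^ 2 ≤ ∑ a, ∑ b, ((w a - v b) * W a b) ^ 2 := by
  have hrow : ∑ a, ∑ b, w a ^ 2 * W a b ^ 2 = ∑ a, w a ^ 2 := by
    simp only [← Finset.mul_sum, sum_sq_row_of_mem_orthogonalGroup hW, mul_one]
  have hcol : ∑ a, ∑ b, v b ^ 2 * W a b ^ 2 = ∑ b, v b ^ 2 := by
    have hWt := sum_sq_row_of_mem_orthogonalGroup (transpose_mem_orthogonalGroup hW)
    simp only [transpose_apply] at hWt
    rw [Finset.sum_comm]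
    simp only [← Finset.mul_sum, hWt, mul_one]
  have hmixed := sum_sum_mul_mul_le_of_monovary
    (sq_mem_doublyStochastic_of_mem_orthogonalGroup hW) hwv
  calc ∑ a, (w a - v a) ^ 2 = ∑ a, w a ^ 2 + ∑ a, v a ^ 2 - 2 * ∑ a, w a * v a := by
        rw [Finset.mul_sum, ← Finset.sum_add_distrib, ← Finset.sum_sub_distrib]
        exact Finset.sum_congr rfl fun _ _ => by ring
    _ ≤ ∑ a, ∑ b, w a ^ 2 * W a b ^ 2 + ∑ a, ∑ b, v b ^ 2 * W a b ^ 2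
          - 2 * ∑ a, ∑ b, W a b ^ 2 * (w a * v b) := by
        rw [hrow, hcol]
        simp only [of_apply] at hmixed
        linarith
    _ = ∑ a, ∑ b, ((w a - v b) * W a b) ^ 2 := by
        simp only [Finset.mul_sum, ← Finset.sum_add_distrib, ← Finset.sum_sub_distrib]
        exact Finset.sum_congr rfl fun _ _ => Finset.sum_congr rfl fun _ _ => by ring

theorem abs_apply_le_of_intertwining (hW : W ∈ orthogonalGroup m ℝ) {v w : m → ℝ}
    (hwv : Monovary w v) {c η : ℝ} (hc : 0 < c) (hsep : ∀ a b, a ≠ b → c ≤ |v a - v b|)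
    (hη : ‖diagonal w * W - W * diagonal v‖ ≤ η) (hηc : 2 * (Fintype.card m * η) ≤ c) {a b : m}
    (hab : a ≠ b) : |W a b| ≤ 2 * η / c := by
  have hentry (a b : m) : |(w a - v b) * W a b| ≤ η := by
    refine Eq.trans_le ?_ ((abs_apply_le_l2_opNorm _ a b).trans hη)
    rw [Matrix.sub_apply, diagonal_mul, mul_diagonal, sub_mul, mul_comm (W a b)]
  have hη0 : 0 ≤ η := (norm_nonneg _).trans hη
  have hclose : |w a - v a| ≤ Fintype.card m * η := by
    refine abs_le_of_sq_le_sq ?_ (by positivity)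
    calc (w a - v a) ^ 2 ≤ ∑ a, (w a - v a) ^ 2 :=
          Finset.single_le_sum (f := fun a => (w a - v a) ^ 2) (fun _ _ => sq_nonneg _)
            (Finset.mem_univ a)
      _ ≤ ∑ a, ∑ b, ((w a - v b) * W a b) ^ 2 := sum_sq_sub_le_of_monovary hW hwv
      _ ≤ (Fintype.card m * η) ^ 2 :=
          sum_sum_sq_le_of_abs_apply_le (M := of fun a b => (w a - v b) * W a b) hentry
  have hfar : c / 2 ≤ |w a - v b| := by
    have htri := abs_sub_le (v a) (w a) (v b)
    rw [abs_sub_comm (v a) (w a)] at htri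
    linarith [hsep a b hab]
  rw [le_div_iff₀ hc]
  have hmul := hentry a b
  rw [abs_mul] at hmul
  nlinarith [abs_nonneg (W a b)]

-- The diagonal of `W` is quadratically close to `±1`, hence to `1` when the sign is known.
theorem l2_opNorm_sub_one_le (hW : W ∈ orthogonalGroup m ℝ) {ε : ℝ} (hε : 0 ≤ ε)
    (hεm : 2 * (Fintype.card m * ε) ≤ 1) (hoff : ∀ a b, a ≠ b → |W a b| ≤ ε)
    (hdiag : ∀ a, -(1 / 2) < W a a) : ‖W - 1‖ ≤ Fintype.card m * ε := by
  have hentry (a b : m) : |(W - 1) a b| ≤ ε := by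
    rw [Matrix.sub_apply]
    rcases eq_or_ne a b with rfl | hab
    · have hrow := sum_sq_row_of_mem_orthogonalGroup hW a
      rw [← Finset.add_sum_erase _ _ (Finset.mem_univ a)] at hrow
      have hrest : ∑ b ∈ Finset.univ.erase a, W a b ^ 2 ≤ Fintype.card m * ε ^ 2 :=
        sum_erase_le_card_mul (sq_nonneg ε) fun b hab =>
          sq_le_sq' (abs_le.1 (hoff a b hab)).1 (abs_le.1 (hoff a b hab)).2
      have hle := (abs_le.1 ((abs_apply_le_l2_opNorm W a a).trans
        (l2_opNorm_le_one_of_mem_orthogonalGroup hW))).2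
      rw [one_apply_eq, abs_sub_comm, abs_of_nonneg (by linarith)]
      nlinarith [hdiag a]
    · rw [one_apply_ne hab, sub_zero]
      exact hoff a b hab
  exact le_of_sq_le_sq ((l2_opNorm_sq_le_sum_sq _).trans (sum_sum_sq_le_of_abs_apply_le hentry))
    (by positivity)

end Identifiability

section RotationResolution

open Matrix
open scoped Matrix.Norms.L2Operator

/-- The row vector `1ᵀ / n`, which averages the rows of a matrix. -/
noncomputable def meanRow (n : ℕ) : Matrix Unit (Fin n) ℝ :=
  of fun _ _ => (n : ℝ)⁻¹

theorem meanRow_mul_transpose {n : ℕ} (hn : 0 < n) :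
    meanRow n * (meanRow n)ᵀ = (n : ℝ)⁻¹ • 1 := by
  ext a b
  simp only [meanRow, mul_apply, of_apply, transpose_apply, Finset.sum_const, Finset.card_univ,
    Fintype.card_fin, nsmul_eq_mul, Matrix.smul_apply, Subsingleton.elim a b, one_apply_eq,
    smul_eq_mul]
  field_simp

theorem centering_eq_one_sub (n : ℕ) :
    centering n = 1 - (n : ℝ) • ((meanRow n)ᵀ * meanRow n) := by
  ext a b
  rcases n.eq_zero_or_pos with rfl | hn
  · exact a.elim0
  simp [centering, meanRow, mul_apply, hn.ne']

theorem centering_mul_self (n : ℕ) : (centering n)ᵀ * centering n = centering n := by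
  rcases n.eq_zero_or_pos with rfl | hn
  · exact Subsingleton.elim _ _
  have hproj : (meanRow n)ᵀ * meanRow n * ((meanRow n)ᵀ * meanRow n) =
      (n : ℝ)⁻¹ • ((meanRow n)ᵀ * meanRow n) := by
    rw [Matrix.mul_assoc, ← Matrix.mul_assoc (meanRow n), meanRow_mul_transpose hn,
      Matrix.smul_mul, Matrix.one_mul, Matrix.mul_smul]
  rw [centering_eq_one_sub, transpose_sub, transpose_one, transpose_smul, transpose_mul,
    transpose_transpose, Matrix.mul_sub, Matrix.mul_one, Matrix.sub_mul, Matrix.one_mul,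
    Matrix.smul_mul, Matrix.mul_smul, hproj, smul_inv_smul₀ (by positivity), sub_self, sub_zero]

theorem secondMoment_centering_mul {n d : ℕ} (M : Matrix (Fin n) (Fin d) ℝ) :
    secondMoment (centering n * M) = secondMoment M - (meanRow n * M)ᵀ * (meanRow n * M) := by
  rcases n.eq_zero_or_pos with rfl | hn
  · simp [secondMoment, Subsingleton.elim M 0]
  rw [secondMoment, transpose_mul, Matrix.mul_assoc, ← Matrix.mul_assoc _ _ M, centering_mul_self,
    centering_eq_one_sub, Matrix.sub_mul, Matrix.mul_sub, Matrix.one_mul, Matrix.smul_mul,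
    Matrix.mul_smul, smul_sub, inv_smul_smul₀ (by positivity), secondMoment, transpose_mul]
  simp only [Matrix.mul_assoc]

variable {ι : Type*} {l : Filter ι} {n : ι → ℕ} {d : ℕ}
  {X Y : ∀ i, Matrix (Fin (n i)) (Fin d) ℝ} {E : ∀ i, Matrix (Fin (n i)) (Fin (n i)) ℝ}

theorem hasOrder_meanRow (hn : Tendsto n l atTop) :
    HasOrder l n (fun i => meanRow (n i)) (-1 / 2) := by
  refine hasOrder_of_l2_opNorm_le (C := 1) ?_
  filter_upwards [hn.eventually_gt_atTop 0] with i hi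
  rw [one_mul, neg_div, Real.rpow_neg (Nat.cast_nonneg _), ← Real.sqrt_eq_rpow, ← Real.sqrt_inv]
  refine Real.le_sqrt_of_sq_le ((l2_opNorm_sq_le_sum_sq _).trans_eq ?_)
  have hpos : (n i : ℝ) ≠ 0 := by positivity
  simp only [meanRow, of_apply, Finset.univ_unique, Finset.sum_const, Finset.card_univ,
    Finset.card_singleton, Fintype.card_fin, nsmul_eq_mul, one_smul]
  field_simp

theorem IsTamePerturbation.isTameRow_meanRow (h : IsTamePerturbation l n X E)
    (hE : HasOrder l n (fun i => meanRow (n i) * (E i * X i)) 0) :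
    IsTameRow l n X E fun i => meanRow (n i) where
  signal := ((hasOrder_meanRow h.tendsto).mul h.signal).mono h.tendsto (by norm_num)
  noise := ((hasOrder_meanRow h.tendsto).mul h.noise).mono h.tendsto (by norm_num)
  noise_mul := hE.mono h.tendsto (by norm_num)
  noise_noise_mul := (((hasOrder_meanRow h.tendsto).mul h.noise).mul h.noise_mul).mono h.tendsto
    (by norm_num)

theorem IsTamePerturbation.isAlignedFactor (h : IsTamePerturbation l n X E)
    (hY : ∀ᶠ i in l, IsRotatedASE (X i * (X i)ᵀ + E i) (Y i))
    (hYX : ∀ᶠ i in l, IsNearestRotation (Y i) (X i)) : IsAlignedFactor l n X E Y :=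
  ⟨h.isPerturbedFactor hY, hYX.mono fun _ hi => hi.posSemidef⟩

namespace IsAlignedFactor

theorem hasOrder_mul_sub (h : IsAlignedFactor l n X E Y) {m : ι → Type*} [∀ i, Fintype (m i)]
    {q : ∀ i, Matrix (m i) (Fin (n i)) ℝ} (hq : IsTameRow l n X E q) {b : ℝ} (hb : 1 / 4 ≤ b)
    (hqE : HasOrder l n (fun i => q i * (E i * X i)) b) :
    HasOrder l n (fun i => q i * (Y i - X i)) (b - 1) := by
  refine (((h.hasOrder_mul_sub_sub hq).mono h.tendsto (by linarith)).add ((hqE.mul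
    (hasOrder_inv_of_coerciveWith h.tendsto h.exists_coercive)).mono h.tendsto
    (by linarith))).congr' (.of_forall fun i => sub_add_cancel _ _)

theorem hasOrder_secondMoment_centering_sub (h : IsAlignedFactor l n X E Y)
    (hE : HasOrder l n (fun i => meanRow (n i) * (E i * X i)) 0) :
    HasOrder l n (fun i => secondMoment (centering (n i) * Y i) -
      secondMoment (centering (n i) * X i)) (-3 / 4) := by
  have hrow := h.isTameRow_meanRow hE
  have hΔ := (h.hasOrder_mul_sub hrow le_rfl (hE.mono h.tendsto (by norm_num)))
  have hmixed := (hrow.signal.transpose.mul hΔ).mono h.tendsto (q := -3 / 4) (by norm_num)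
  have hgram := ((h.hasOrder_gram_sub.add h.hasOrder_transpose_mul_sub).inv_smul).mono h.tendsto
    (q := -3 / 4) (by norm_num)
  refine (hgram.sub ((hmixed.add hmixed.transpose).add
    ((hΔ.transpose.mul hΔ).mono h.tendsto (by norm_num)))).congr' (.of_forall fun i => ?_)
  rw [secondMoment_centering_mul, secondMoment_centering_mul, secondMoment, secondMoment]
  simp only [Matrix.mul_sub, transpose_sub, Matrix.sub_mul, transpose_mul, transpose_transpose,
    smul_sub, smul_add, Matrix.mul_assoc]
  abel

end IsAlignedFactor

section NearIdentity

variable {V D D' M : ι → Matrix (Fin d) (Fin d) ℝ}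

theorem exists_abs_apply_le_of_hasOrder (hn : Tendsto n l atTop)
    (hV : ∀ᶠ i in l, V i ∈ orthogonalGroup (Fin d) ℝ) (hD : ∀ᶠ i in l, (D i).IsDiag)
    (hsep : ∃ c > 0, ∀ᶠ i in l, ∀ a b, a ≠ b → c ≤ |D i a a - D i b b|)
    (hD' : ∀ᶠ i in l, (D' i).IsDiag) (hmono : ∀ᶠ i in l, Monovary (D' i).diag (D i).diag)
    (hR : HasOrder l n (fun i => (V i)ᵀ * D' i * V i - D i) (-3 / 4)) :
    ∃ C, ∀ᶠ i in l, ∀ a b, a ≠ b → |V i a b| ≤ C * (n i : ℝ) ^ (-3 / 4 : ℝ) := by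
  obtain ⟨c, hc, hsep⟩ := hsep
  have hV0 : HasOrder l n V 0 := hasOrder_of_l2_opNorm_le (C := 1) <| hV.mono fun i hi => by
    rw [Real.rpow_zero, mul_one]
    exact l2_opNorm_le_one_of_mem_orthogonalGroup hi
  have hN : HasOrder l n (fun i => D' i * V i - V i * D i) (-3 / 4) := by
    refine ((hV0.mul hR).congr' (hV.mono fun i hi => ?_)).mono hn (by norm_num)
    rw [Matrix.mul_sub, ← Matrix.mul_assoc, ← Matrix.mul_assoc,
      (mem_orthogonalGroup_iff _ ℝ).1 hi, Matrix.one_mul]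
  obtain ⟨C, -, hC⟩ := hN.exists_pos_bound
  refine ⟨2 * C / c, ?_⟩
  filter_upwards [hV, hD, hD', hmono, hsep, hC,
    hN.eventually_lt hn (by norm_num : (-3 / 4 : ℝ) < 0) (ε := c / (2 * (d + 1))) (by positivity)]
    with i hVi hDi hDi' hmonoi hsepi hCi hsmall a b hab
  rw [← hDi.diagonal_diag, ← hDi'.diagonal_diag] at hCi hsmall
  rw [Real.rpow_zero, mul_one, lt_div_iff₀ (by positivity)] at hsmall
  refine (abs_apply_le_of_intertwining hVi hmonoi hc hsepi le_rfl ?_ hab).trans ?_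
  · rw [Fintype.card_fin]
    nlinarith [norm_nonneg (diagonal (D' i).diag * V i - V i * diagonal (D i).diag)]
  · rw [div_mul_eq_mul_div, mul_assoc]
    gcongr

theorem hasOrder_sub_one (hn : Tendsto n l atTop)
    (hV : ∀ᶠ i in l, V i ∈ orthogonalGroup (Fin d) ℝ)
    (hoff : ∃ C, ∀ᶠ i in l, ∀ a b, a ≠ b → |V i a b| ≤ C * (n i : ℝ) ^ (-3 / 4 : ℝ))
    (hM : HasOrder l n M 0) (hdiag : ∃ c > 0, ∀ᶠ i in l, ∀ a, c ≤ M i a a)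
    (hsign : ∀ᶠ i in l, ∀ a, 0 ≤ (M i * (V i)ᵀ) a a) :
    HasOrder l n (fun i => V i - 1) (-3 / 4) := by
  obtain ⟨C, hoff⟩ := hoff
  obtain ⟨c, hc, hdiag⟩ := hdiag
  obtain ⟨q, -, hM⟩ := hM.exists_pos_bound
  have hlim : Tendsto (fun i => |C| * (n i : ℝ) ^ (-3 / 4 : ℝ)) l (𝓝 0) := by
    rw [← mul_zero |C|, neg_div]
    exact ((tendsto_rpow_neg_atTop (by norm_num)).comp
      (tendsto_natCast_atTop_atTop.comp hn)).const_mul _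
  refine hasOrder_of_l2_opNorm_le (C := d * |C|) ?_
  filter_upwards [hV, hoff, hdiag, hM, hsign,
    (hlim.const_mul (2 * (d : ℝ))).eventually_le_const (by rw [mul_zero]; exact one_pos),
    (hlim.const_mul (2 * (d : ℝ) * q)).eventually_lt_const (by rwa [mul_zero] : _ < c)]
    with i hVi hoffi hdiagi hMi hsigni hsmall hsmall'
  have hoffi' (a b : Fin d) (hab : a ≠ b) : |V i a b| ≤ |C| * (n i : ℝ) ^ (-3 / 4 : ℝ) :=
    (hoffi a b hab).trans (by gcongr; exact le_abs_self C)
  have hVdiag (a : Fin d) : -(1 / 2) < V i a a :=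
    neg_half_lt_of_dotProduct_nonneg (u := M i a) (q := q) (by positivity) (hoffi' a) hc (hdiagi a)
      (fun b => (abs_apply_le_l2_opNorm _ a b).trans (by rwa [Real.rpow_zero, mul_one] at hMi))
      (by rw [Fintype.card_fin]; linarith) (hsigni a)
  have hV1 := l2_opNorm_sub_one_le hVi (by positivity)
    (by rw [Fintype.card_fin]; linarith) hoffi' hVdiag
  rwa [Fintype.card_fin, ← mul_assoc] at hV1

end NearIdentity

end RotationResolution

section NearAlignment

open Matrix
open scoped Matrix.Norms.L2Operator

variable {ι : Type*} {l : Filter ι} {n : ι → ℕ} {d : ℕ}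
  {X Y : ∀ i, Matrix (Fin (n i)) (Fin d) ℝ} {E : ∀ i, Matrix (Fin (n i)) (Fin (n i)) ℝ}

/-- Up to rotations at distance `O(n ^ (-3 / 4))` from the identity, `Y` is a perturbed factor of
`X Xᵀ` that is closest to `X`. This is what all ways to resolve the indeterminacy of an embedding
have in common. -/
def IsNearlyAligned (l : Filter ι) (n : ι → ℕ) (X : ∀ i, Matrix (Fin (n i)) (Fin d) ℝ)
    (E : ∀ i, Matrix (Fin (n i)) (Fin (n i)) ℝ) (Y : ∀ i, Matrix (Fin (n i)) (Fin d) ℝ) : Prop :=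
  ∃ V : ι → Matrix (Fin d) (Fin d) ℝ, (∀ i, V i ∈ orthogonalGroup (Fin d) ℝ) ∧
    IsAlignedFactor l n X E (fun i => Y i * V i) ∧ HasOrder l n (fun i => V i - 1) (-3 / 4)

theorem IsNearlyAligned.hasOrder_mul_sub_sub (h : IsNearlyAligned l n X E Y) {m : ι → Type*}
    [∀ i, Fintype (m i)] {q : ∀ i, Matrix (m i) (Fin (n i)) ℝ} (hq : IsTameRow l n X E q) :
    HasOrder l n (fun i => q i * (Y i - X i) - q i * (E i * X i) * ((X i)ᵀ * X i)⁻¹)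
      (-3 / 4) := by
  obtain ⟨V, hV, hYV, hV1⟩ := h
  have hqYV : HasOrder l n (fun i => q i * (Y i * V i)) 0 :=
    (((hYV.hasOrder_mul_sub hq (by norm_num) hq.noise_mul).mono hYV.tendsto (by norm_num)).add
      hq.signal).congr' (.of_forall fun i => by rw [Matrix.mul_sub, sub_add_cancel])
  refine ((hYV.hasOrder_mul_sub_sub hq).add ((hqYV.mul hV1.transpose).mono hYV.tendsto
    (by norm_num))).congr' (.of_forall fun i => ?_)
  have hYVV : q i * (Y i * V i) * (V i)ᵀ = q i * Y i := by
    rw [Matrix.mul_assoc, Matrix.mul_assoc, (mem_orthogonalGroup_iff _ ℝ).1 (hV i),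
      Matrix.mul_one]
  rw [transpose_sub, transpose_one, Matrix.mul_sub _ _ (1 : Matrix _ _ ℝ), hYVV, Matrix.mul_one]
  simp only [Matrix.mul_sub]
  abel

theorem IsTamePerturbation.isNearlyAligned (h : IsTamePerturbation l n X E)
    (hY : ∀ᶠ i in l, IsRotatedASE (X i * (X i)ᵀ + E i) (Y i))
    (hYX : ∀ᶠ i in l, IsNearestRotation (Y i) (X i)) : IsNearlyAligned l n X E Y := by
  refine ⟨fun _ => 1, fun _ => one_mem _, ?_, ?_⟩
  · simpa only [Matrix.mul_one] using h.isAlignedFactor hY hYX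
  · exact hasOrder_of_l2_opNorm_le (C := 0) (.of_forall fun i => by simp)

theorem IsTamePerturbation.exists_isAlignedFactor (h : IsTamePerturbation l n X E)
    (hY : ∀ᶠ i in l, IsRotatedASE (X i * (X i)ᵀ + E i) (Y i)) :
    ∃ V : ι → Matrix (Fin d) (Fin d) ℝ, (∀ i, V i ∈ orthogonalGroup (Fin d) ℝ) ∧
      IsAlignedFactor l n X E (fun i => Y i * V i) := by
  choose V hV hYV using fun i => exists_isNearestRotation (X i) (Y i)
  exact ⟨V, hV, h.isAlignedFactor (hY.mono fun i hi => hi.mul_orthogonal (hV i)) (.of_forall hYV)⟩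

section IdentifiedFactors

variable {V : ι → Matrix (Fin d) (Fin d) ℝ}

theorem IsAlignedFactor.exists_abs_apply_le (h : IsAlignedFactor l n X E (fun i => Y i * V i))
    (hE : HasOrder l n (fun i => meanRow (n i) * (E i * X i)) 0)
    (hV : ∀ i, V i ∈ orthogonalGroup (Fin d) ℝ)
    (hsep : ∃ c > 0, ∀ᶠ i in l, (secondMoment (centering (n i) * X i)).IsDiag ∧ ∀ a b, a ≠ b →
      c ≤ |secondMoment (centering (n i) * X i) a a - secondMoment (centering (n i) * X i) b b|)
    (hmatch : ∀ᶠ i in l,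
      HasMatchingDiagonalGram (centering (n i) * Y i) (centering (n i) * X i)) :
    ∃ C, ∀ᶠ i in l, ∀ a b, a ≠ b → |V i a b| ≤ C * (n i : ℝ) ^ (-3 / 4 : ℝ) := by
  obtain ⟨c, hc, hsep⟩ := hsep
  refine exists_abs_apply_le_of_hasOrder h.tendsto (.of_forall hV) (hsep.mono fun i hi => hi.1)
    ⟨c, hc, hsep.mono fun i hi => hi.2⟩ (hmatch.mono fun i hi => hi.1)
    (hmatch.mono fun i hi => hi.2) ((h.hasOrder_secondMoment_centering_sub hE).congr'
      (.of_forall fun i => ?_))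
  simp only [secondMoment, transpose_mul, Matrix.mul_assoc, Matrix.smul_mul, Matrix.mul_smul]

theorem IsAlignedFactor.hasOrder_sub_one_of_column_signs
    (h : IsAlignedFactor l n X E (fun i => Y i * V i))
    (hV : ∀ i, V i ∈ orthogonalGroup (Fin d) ℝ)
    (hoff : ∃ C, ∀ᶠ i in l, ∀ a b, a ≠ b → |V i a b| ≤ C * (n i : ℝ) ^ (-3 / 4 : ℝ))
    (hsign : ∀ᶠ i in l, ∀ a, 0 ≤ ∑ j, Y i j a * X i j a) :
    HasOrder l n (fun i => V i - 1) (-3 / 4) := by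
  have hΔ := h.hasOrder_transpose_mul_sub.inv_smul
  have hM : HasOrder l n (fun i => (n i : ℝ)⁻¹ • ((X i)ᵀ * (Y i * V i))) 0 :=
    ((h.signal.transpose.mul h.hasOrder).inv_smul).mono h.tendsto (by norm_num)
  refine hasOrder_sub_one h.tendsto (.of_forall hV) hoff hM ?_ ?_
  · obtain ⟨c, hc, hX⟩ := h.exists_coercive
    refine ⟨c / 2, half_pos hc, ?_⟩
    filter_upwards [hX, h.tendsto.eventually_gt_atTop 0,
      hΔ.eventually_lt h.tendsto (by norm_num : (0 - 1 : ℝ) < 0) (half_pos hc)]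
      with i hXi hpos hΔi a
    rw [Real.rpow_zero, mul_one] at hΔi
    have hentry := (abs_lt.1 ((abs_apply_le_l2_opNorm _ a a).trans_lt hΔi)).1
    have hXa : c ≤ (n i : ℝ)⁻¹ * ((X i)ᵀ * X i) a a := by
      rw [le_inv_mul_iff₀ (by positivity), mul_comm]
      exact hXi.le_apply_self a
    rw [Matrix.smul_apply, Matrix.mul_sub, Matrix.sub_apply, smul_eq_mul, mul_sub] at hentry
    rw [Matrix.smul_apply, smul_eq_mul]
    linarith
  · refine hsign.mono fun i hi a => ?_
    rw [Matrix.smul_mul, Matrix.mul_assoc, Matrix.mul_assoc,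
      (mem_orthogonalGroup_iff _ ℝ).1 (hV i), Matrix.mul_one, Matrix.smul_apply, smul_eq_mul]
    refine mul_nonneg (by positivity) ((hi a).trans_eq ?_)
    simp only [mul_apply, transpose_apply, mul_comm]

theorem IsAlignedFactor.hasOrder_sub_one_of_row_signs
    (h : IsAlignedFactor l n X E (fun i => Y i * V i))
    (hV : ∀ i, V i ∈ orthogonalGroup (Fin d) ℝ)
    (hoff : ∃ C, ∀ᶠ i in l, ∀ a b, a ≠ b → |V i a b| ≤ C * (n i : ℝ) ^ (-3 / 4 : ℝ))
    {q : ∀ i, Matrix Unit (Fin (n i)) ℝ} (hq : IsTameRow l n X E q)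
    (hpos : ∃ c > 0, ∀ᶠ i in l, ∀ a, c ≤ (q i * X i) () a)
    (hsign : ∀ᶠ i in l, ∀ a, 0 ≤ (q i * Y i) () a) :
    HasOrder l n (fun i => V i - 1) (-3 / 4) := by
  have hΔ := h.hasOrder_mul_sub hq (by norm_num) hq.noise_mul
  have hqYV : HasOrder l n (fun i => q i * (Y i * V i)) 0 :=
    ((hΔ.mono h.tendsto (by norm_num)).add hq.signal).congr'
      (.of_forall fun i => by rw [Matrix.mul_sub, sub_add_cancel])
  have hones : HasOrder l n (fun _ => (of fun _ _ => 1 : Matrix (Fin d) Unit ℝ)) 0 :=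
    hasOrder_of_l2_opNorm_le (.of_forall fun i => by rw [Real.rpow_zero, mul_one])
  have hM := (hones.mul hqYV).mono h.tendsto (add_zero 0).le
  have hMapply (M : Matrix Unit (Fin d) ℝ) (a b : Fin d) :
      ((of fun _ _ => 1 : Matrix (Fin d) Unit ℝ) * M) a b = M () b := by simp [mul_apply]
  refine hasOrder_sub_one h.tendsto (.of_forall hV) hoff hM ?_ ?_
  · obtain ⟨c, hc, hX⟩ := hpos
    refine ⟨c / 2, half_pos hc, ?_⟩
    filter_upwards [hX, hΔ.eventually_lt h.tendsto (by norm_num : (1 / 2 - 1 : ℝ) < 0)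
      (half_pos hc)] with i hXi hΔi a
    rw [Real.rpow_zero, mul_one] at hΔi
    have hentry := (abs_lt.1 ((abs_apply_le_l2_opNorm _ () a).trans_lt hΔi)).1
    rw [Matrix.mul_sub, Matrix.sub_apply] at hentry
    rw [hMapply]
    linarith [hXi a]
  · refine hsign.mono fun i hi a => ?_
    rw [Matrix.mul_assoc, Matrix.mul_assoc, Matrix.mul_assoc,
      (mem_orthogonalGroup_iff _ ℝ).1 (hV i), Matrix.mul_one, hMapply]
    exact hi a

end IdentifiedFactors

end NearAlignment

section NoiseMoments

open Matrix

variable {Ω : Type*} [MeasurableSpace Ω] {μ : Measure Ω}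

/-- `f` is integrable, with mean at most `B`. This combines the two facts about `f` that Markov's
inequality needs. -/
def HasMeanLE (μ : Measure Ω) (f : Ω → ℝ) (B : ℝ) : Prop :=
  Integrable f μ ∧ ∫ ω, f ω ∂μ ≤ B

namespace HasMeanLE

variable {f g : Ω → ℝ} {B B' : ℝ}

theorem mono (h : HasMeanLE μ f B) (hB : B ≤ B') : HasMeanLE μ f B' := ⟨h.1, h.2.trans hB⟩

theorem add (hf : HasMeanLE μ f B) (hg : HasMeanLE μ g B') :
    HasMeanLE μ (fun ω => f ω + g ω) (B + B') :=
  ⟨hf.1.add hg.1, (integral_add hf.1 hg.1).trans_le (add_le_add hf.2 hg.2)⟩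

theorem const_mul (hf : HasMeanLE μ f B) {c : ℝ} (hc : 0 ≤ c) :
    HasMeanLE μ (fun ω => c * f ω) (c * B) :=
  ⟨hf.1.const_mul c, (integral_const_mul _ _).trans_le (mul_le_mul_of_nonneg_left hf.2 hc)⟩

theorem sum {ι : Type*} {s : Finset ι} {f : ι → Ω → ℝ} {B : ι → ℝ}
    (h : ∀ i ∈ s, HasMeanLE μ (f i) (B i)) :
    HasMeanLE μ (fun ω => ∑ i ∈ s, f i ω) (∑ i ∈ s, B i) :=
  ⟨integrable_finsetSum s fun i hi => (h i hi).1,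
    (integral_finsetSum s fun i hi => (h i hi).1).trans_le
      (Finset.sum_le_sum fun i hi => (h i hi).2)⟩

theorem of_le (hg : HasMeanLE μ g B) (hf : AEStronglyMeasurable f μ) (h0 : ∀ ω, 0 ≤ f ω)
    (h : ∀ ω, f ω ≤ g ω) : HasMeanLE μ f B := by
  have hint : Integrable f μ := hg.1.mono' hf (ae_of_all _ fun ω =>
    (Real.norm_of_nonneg (h0 ω)).trans_le (h ω))
  exact ⟨hint, (integral_mono hint hg.1 h).trans hg.2⟩

end HasMeanLE

theorem hasMeanLE_const [IsProbabilityMeasure μ] (c : ℝ) : HasMeanLE μ (fun _ => c) c :=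
  ⟨integrable_const c, by simp⟩

theorem hasMeanLE_sq_sum [IsProbabilityMeasure μ] {T : Type*} [Fintype T] {f : T → Ω → ℝ}
    (hf : ∀ t, Measurable (f t)) (hb : ∀ t ω, |f t ω| ≤ 1) (τ : Equiv.Perm T)
    (horth : ∀ s t, t ≠ s → t ≠ τ s → ∫ ω, f s ω * f t ω ∂μ = 0) (c : T → ℝ) :
    HasMeanLE μ (fun ω => (∑ t, f t ω * c t) ^ 2) (2 * ∑ t, c t ^ 2) := by
  classical
  have hbound (s t : T) (ω : Ω) : ‖f s ω * f t ω‖ ≤ 1 := by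
    rw [norm_mul]
    exact mul_le_one₀ (hb s ω) (norm_nonneg _) (hb t ω)
  have hpair (s t : T) : HasMeanLE μ (fun ω => f s ω * f t ω * (c s * c t))
      (((if t = s then 1 else 0) + if t = τ s then 1 else 0) * ((c s ^ 2 + c t ^ 2) / 2)) := by
    have hcov : |∫ ω, f s ω * f t ω ∂μ| ≤
        (if t = s then 1 else 0) + if t = τ s then 1 else 0 := by
      by_cases h : t = s ∨ t = τ s
      · have hle := norm_integral_le_of_norm_le_const (μ := μ) (ae_of_all _ (hbound s t))
        rw [probReal_univ, mul_one, Real.norm_eq_abs] at hle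
        exact hle.trans (by split_ifs <;> simp_all)
      · rw [horth s t (not_or.1 h).1 (not_or.1 h).2, abs_zero]
        positivity
    refine ⟨(Integrable.of_bound ((hf s).mul (hf t)).aestronglyMeasurable 1
      (ae_of_all _ (hbound s t))).mul_const _, (integral_mul_const _ _).trans_le ?_⟩
    refine (le_abs_self _).trans ((abs_mul _ _).trans_le ?_)
    gcongr
    rw [abs_mul]
    nlinarith [sq_nonneg (|c s| - |c t|), sq_abs (c s), sq_abs (c t)]
  have hexp (ω : Ω) : (∑ t, f t ω * c t) ^ 2 = ∑ s, ∑ t, f s ω * f t ω * (c s * c t) := by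
    simp only [sq, Finset.sum_mul_sum, mul_mul_mul_comm]
  simp only [hexp]
  refine (HasMeanLE.sum fun s _ => HasMeanLE.sum fun t _ => hpair s t).mono ?_
  simp only [add_mul, ite_mul, one_mul, zero_mul, Finset.sum_add_distrib, Finset.sum_ite_eq',
    Finset.mem_univ, if_true, add_div]
  rw [Equiv.sum_comp τ fun t => c t ^ 2 / 2, ← Finset.sum_div]
  linarith

section Independent

variable {κ : Type*} {η : κ → Ω → ℝ}

theorem integral_mul_eq_zero_of_ne (hη : ∀ e, Measurable (η e)) (hind : iIndepFun η μ)
    {a b : κ} (hmean : ∫ ω, η a ω ∂μ = 0) (hab : a ≠ b) : ∫ ω, η a ω * η b ω ∂μ = 0 := by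
  rw [(hind.indepFun hab).integral_fun_mul_eq_mul_integral (hη a).aestronglyMeasurable
    (hη b).aestronglyMeasurable, hmean, zero_mul]

theorem integral_mul_mul_mul_eq_zero_of_ne [Finite κ] (hη : ∀ e, Measurable (η e))
    (hind : iIndepFun η μ) {a b c d : κ} (hmean : ∫ ω, η a ω ∂μ = 0) (hab : a ≠ b) (hac : a ≠ c)
    (had : a ≠ d) : ∫ ω, η a ω * η b ω * (η c ω * η d ω) ∂μ = 0 := by
  classical
  cases nonempty_fintype κ
  let m : κ → ℕ := fun e => (if e = a then 1 else 0) + (if e = b then 1 else 0) +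
    ((if e = c then 1 else 0) + if e = d then 1 else 0)
  have hprod (ω : Ω) : η a ω * η b ω * (η c ω * η d ω) = ∏ e, η e ω ^ m e := by
    simp only [m, pow_add, Finset.prod_mul_distrib, pow_ite, pow_one, pow_zero,
      Finset.prod_ite_eq', Finset.mem_univ, if_true]
  simp only [hprod]
  rw [hind.integral_fun_prod_comp (f := fun e x => x ^ m e) (fun e => (hη e).aemeasurable)
    (fun e => (measurable_id.pow_const (m e)).aestronglyMeasurable)]
  refine Finset.prod_eq_zero (Finset.mem_univ a) ?_
  simpa [m, hab, hac, had] using hmean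

end Independent

/-- `ξ` is a symmetric matrix with zero diagonal whose entries above the diagonal are independent,
centered and bounded by `1`. This is the part of the adjacency matrix that is not explained by the
connection probabilities. -/
structure IsSymmetricNoise (μ : Measure Ω) {n : ℕ} (ξ : Ω → Matrix (Fin n) (Fin n) ℝ) : Prop where
  measurable_entry : ∀ i j, Measurable fun ω => ξ ω i j
  symm : ∀ ω i j, ξ ω i j = ξ ω j i
  diag_eq_zero : ∀ ω i, ξ ω i i = 0
  abs_le_one : ∀ ω i j, |ξ ω i j| ≤ 1
  mean_eq_zero : ∀ i j, ∫ ω, ξ ω i j ∂μ = 0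
  indep : iIndepFun (fun (e : {e : Fin n × Fin n // e.1 < e.2}) ω => ξ ω e.1.1 e.1.2) μ

/-- The pair of distinct indices `i` and `j` in increasing order, which is how the independent
entries of a symmetric matrix are indexed. -/
def orderedPair {n : ℕ} (i j : Fin n) (h : i ≠ j) : {e : Fin n × Fin n // e.1 < e.2} :=
  if hij : i < j then ⟨(i, j), hij⟩ else ⟨(j, i), lt_of_le_of_ne (not_lt.1 hij) h.symm⟩

theorem orderedPair_eq_iff {n : ℕ} {i j k l : Fin n} (h : i ≠ j) (h' : k ≠ l) :
    orderedPair i j h = orderedPair k l h' ↔ s(i, j) = s(k, l) := by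
  unfold orderedPair
  rw [Sym2.eq_iff]
  split_ifs with h1 h2 h2 <;> simp only [Subtype.mk.injEq, Prod.mk.injEq] <;> omega

namespace IsSymmetricNoise

variable {n : ℕ} {ξ : Ω → Matrix (Fin n) (Fin n) ℝ}

theorem apply_orderedPair (h : IsSymmetricNoise μ ξ) (ω : Ω) {i j : Fin n} (hij : i ≠ j) :
    ξ ω (orderedPair i j hij).1.1 (orderedPair i j hij).1.2 = ξ ω i j := by
  unfold orderedPair
  split_ifs
  · rfl
  · exact h.symm ω j i

theorem integral_mul_eq_zero (h : IsSymmetricNoise μ ξ) {i j k l : Fin n}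
    (hne : s(i, j) ≠ s(k, l)) : ∫ ω, ξ ω i j * ξ ω k l ∂μ = 0 := by
  by_cases hij : i = j
  · simp [hij, h.diag_eq_zero]
  by_cases hkl : k = l
  · simp [hkl, h.diag_eq_zero]
  simp only [← h.apply_orderedPair _ hij, ← h.apply_orderedPair _ hkl]
  exact integral_mul_eq_zero_of_ne (fun _ => h.measurable_entry _ _) h.indep
    (h.mean_eq_zero _ _) (by rwa [Ne, orderedPair_eq_iff])

theorem integral_mul_mul_mul_eq_zero (h : IsSymmetricNoise μ ξ) {i j k l p q r s : Fin n}
    (hkl : s(i, j) ≠ s(k, l)) (hpq : s(i, j) ≠ s(p, q)) (hrs : s(i, j) ≠ s(r, s)) :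
    ∫ ω, ξ ω i j * ξ ω k l * (ξ ω p q * ξ ω r s) ∂μ = 0 := by
  by_cases hi : i = j
  · simp [hi, h.diag_eq_zero]
  by_cases hk : k = l
  · simp [hk, h.diag_eq_zero]
  by_cases hp : p = q
  · simp [hp, h.diag_eq_zero]
  by_cases hr : r = s
  · simp [hr, h.diag_eq_zero]
  simp only [← h.apply_orderedPair _ hi, ← h.apply_orderedPair _ hk, ← h.apply_orderedPair _ hp,
    ← h.apply_orderedPair _ hr]
  exact integral_mul_mul_mul_eq_zero_of_ne (fun _ => h.measurable_entry _ _) h.indep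
    (h.mean_eq_zero _ _) (by rwa [Ne, orderedPair_eq_iff]) (by rwa [Ne, orderedPair_eq_iff])
    (by rwa [Ne, orderedPair_eq_iff])

theorem hasMeanLE_dotProduct_mulVec [IsProbabilityMeasure μ] (h : IsSymmetricNoise μ ξ)
    (u v : Fin n → ℝ) :
    HasMeanLE μ (fun ω => (u ⬝ᵥ ξ ω *ᵥ v) ^ 2) (2 * ((∑ i, u i ^ 2) * ∑ j, v j ^ 2)) := by
  have hsum (ω : Ω) : u ⬝ᵥ ξ ω *ᵥ v = ∑ e : Fin n × Fin n, ξ ω e.1 e.2 * (u e.1 * v e.2) := by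
    simp only [Fintype.sum_prod_type, mulVec, dotProduct, Finset.mul_sum, mul_left_comm]
  have hnorm : (∑ i, u i ^ 2) * ∑ j, v j ^ 2 = ∑ e : Fin n × Fin n, (u e.1 * v e.2) ^ 2 := by
    simp only [Finset.sum_mul_sum, Fintype.sum_prod_type, mul_pow]
  simp only [hsum, hnorm]
  refine hasMeanLE_sq_sum (f := fun (e : Fin n × Fin n) ω => ξ ω e.1 e.2)
    (fun e => h.measurable_entry _ _) (fun e ω => h.abs_le_one ω _ _) (Equiv.prodComm _ _)
    (fun s t hts hts' => h.integral_mul_eq_zero fun heq => ?_) _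
  rcases Sym2.eq_iff.1 heq with ⟨h1, h2⟩ | ⟨h1, h2⟩
  · exact hts (Prod.ext h1.symm h2.symm)
  · exact hts' (Prod.ext h2.symm h1.symm)

theorem integral_path_mul_path_eq_zero (h : IsSymmetricNoise μ ξ) {i j k j' k' : Fin n}
    (hk : k ≠ i) (hne : (j', k') ≠ (j, k)) :
    ∫ ω, ξ ω i j * ξ ω j k * (ξ ω i j' * ξ ω j' k') ∂μ = 0 := by
  by_cases hj : j = i
  · simp [hj, h.diag_eq_zero]
  by_cases hj' : j' = i
  · simp [hj', h.diag_eq_zero]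
  by_cases hjj : j = j'
  · simp only [mul_comm (ξ _ i j)]
    apply h.integral_mul_mul_mul_eq_zero <;> simp only [Ne, Sym2.eq_iff] <;> grind
  · apply h.integral_mul_mul_mul_eq_zero <;> simp only [Ne, Sym2.eq_iff] <;> grind

theorem sum_sq_row_le (h : IsSymmetricNoise μ ξ) (ω : Ω) (i : Fin n) : ∑ j, ξ ω i j ^ 2 ≤ n := by
  refine (Finset.sum_le_card_nsmul _ _ 1 fun j _ => ?_).trans_eq (by simp)
  exact (sq_le_one_iff_abs_le_one _).2 (h.abs_le_one ω i j)

-- Only the closed paths `i → j → i` contribute to the mean of `(ξ ξ v) i`.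
theorem hasMeanLE_mul_self_mulVec [IsProbabilityMeasure μ] (h : IsSymmetricNoise μ ξ) (i : Fin n)
    (v : Fin n → ℝ) :
    HasMeanLE μ (fun ω => ((ξ ω * ξ ω) *ᵥ v) i ^ 2)
      (2 * (n ^ 2 * v i ^ 2) + 2 * (2 * (n * ∑ k, v k ^ 2))) := by
  have hsplit (ω : Ω) : ((ξ ω * ξ ω) *ᵥ v) i = (∑ j, ξ ω i j ^ 2) * v i +
      ∑ e : Fin n × {k // k ≠ i}, ξ ω i e.1 * ξ ω e.1 e.2 * v e.2 := by
    rw [← mulVec_mulVec, Fintype.sum_prod_type, mulVec, dotProduct, Finset.sum_mul,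
      ← Finset.sum_add_distrib]
    refine Finset.sum_congr rfl fun j _ => ?_
    rw [mulVec, dotProduct, Fintype.sum_eq_add_sum_subtype_ne _ i, mul_add, Finset.mul_sum,
      h.symm ω j i]
    simp only [sq, mul_assoc]
  have hopen : HasMeanLE μ (fun ω => (∑ e : Fin n × {k // k ≠ i},
      ξ ω i e.1 * ξ ω e.1 e.2 * v e.2) ^ 2) (2 * (n * ∑ k, v k ^ 2)) := by
    refine (hasMeanLE_sq_sum
      (f := fun (e : Fin n × {k // k ≠ i}) ω => ξ ω i e.1 * ξ ω e.1 e.2)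
      (fun e => (h.measurable_entry _ _).mul (h.measurable_entry _ _)) (fun e ω => ?_) (.refl _)
      (fun s t hts _ => h.integral_path_mul_path_eq_zero s.2.2 fun heq => hts ?_)
      fun e => v e.2).mono ?_
    · rw [abs_mul]
      exact mul_le_one₀ (h.abs_le_one _ _ _) (abs_nonneg _) (h.abs_le_one _ _ _)
    · exact Prod.ext (Prod.ext_iff.1 heq).1 (Subtype.ext (Prod.ext_iff.1 heq).2)
    · simp only [Fintype.sum_prod_type, Finset.sum_const, Finset.card_univ, Fintype.card_fin,
        nsmul_eq_mul]
      rw [Fintype.sum_eq_add_sum_subtype_ne (fun k => v k ^ 2) i]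
      gcongr
      exact le_add_of_nonneg_left (sq_nonneg _)
  have hmeas : Measurable fun ω => ((ξ ω * ξ ω) *ᵥ v) i := by
    simp only [hsplit]
    have := h.measurable_entry
    fun_prop
  refine ((hasMeanLE_const (2 * (n ^ 2 * v i ^ 2))).add (hopen.const_mul zero_le_two)).of_le
    (hmeas.pow_const 2).aestronglyMeasurable (fun ω => sq_nonneg _) fun ω => ?_
  rw [hsplit]
  have hclosed : ((∑ j, ξ ω i j ^ 2) * v i) ^ 2 ≤ n ^ 2 * v i ^ 2 := by
    rw [mul_pow]
    have := h.sum_sq_row_le ω i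
    gcongr
  linarith [add_sq_le (a := (∑ j, ξ ω i j ^ 2) * v i)
    (b := ∑ e : Fin n × {k // k ≠ i}, ξ ω i e.1 * ξ ω e.1 e.2 * v e.2)]

end IsSymmetricNoise

end NoiseMoments

section NoiseLevel

open Matrix
open scoped Matrix.Norms.L2Operator

/-- The squared Frobenius norm of `M`, whose mean is easily computed when `M` is random. -/
def frobeniusSq {m r : Type*} [Fintype m] [Fintype r] (M : Matrix m r ℝ) : ℝ :=
  ∑ i, ∑ j, M i j ^ 2

/-- The squared Frobenius norm of `M`, in units of `n ^ k`. -/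
noncomputable def scaledFrobeniusSq {m r : Type*} [Fintype m] [Fintype r] (n k : ℕ)
    (M : Matrix m r ℝ) : ℝ :=
  frobeniusSq M / n ^ k

/-- The matrix `e_kᵀ` that selects the row with index `k`; it is `0` if there is no such row. -/
def selectRow (n k : ℕ) : Matrix Unit (Fin n) ℝ :=
  of fun _ j => if (j : ℕ) = k then 1 else 0

/-- The combined size of all functions of the noise `ξ` that have to be controlled for a factor of
`X Xᵀ + ξ` to be close to `X`, each relative to its order of magnitude. -/
noncomputable def noiseLevel {n d : ℕ} (X : Matrix (Fin n) (Fin d) ℝ)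
    (ξ : Matrix (Fin n) (Fin n) ℝ) : ℝ :=
  scaledFrobeniusSq n 3 (ξ * ξ) + scaledFrobeniusSq n 2 (ξ * X) +
    scaledFrobeniusSq n 2 (Xᵀ * (ξ * X)) + scaledFrobeniusSq n 0 (meanRow n * (ξ * X))

/-- The combined size of the functions of the noise `ξ` on which the first-order expansion of the
row with index `k` depends, each relative to its order of magnitude. -/
noncomputable def rowNoiseLevel {n d : ℕ} (X : Matrix (Fin n) (Fin d) ℝ)
    (ξ : Matrix (Fin n) (Fin n) ℝ) (k : ℕ) : ℝ :=
  scaledFrobeniusSq n 1 (selectRow n k * (ξ * X)) +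
    scaledFrobeniusSq n 2 (selectRow n k * (ξ * ξ * X))

section Frobenius

variable {n k : ℕ}

theorem selectRow_eq_zero (hk : n ≤ k) : selectRow n k = 0 := by
  ext _ j
  exact if_neg (j.2.trans_le hk).ne

theorem selectRow_mul_apply {r : Type*} (hk : k < n) (M : Matrix (Fin n) r ℝ) (u : Unit) (a : r) :
    (selectRow n k * M) u a = M ⟨k, hk⟩ a := by
  rw [mul_apply, Finset.sum_eq_single ⟨k, hk⟩ (fun j _ hj => ?_) (by simp)]
  · simp [selectRow]
  · simp [selectRow, Fin.ext_iff.not.1 hj]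

variable {m r : Type*} [Fintype m] [Fintype r]

theorem frobeniusSq_nonneg (M : Matrix m r ℝ) : 0 ≤ frobeniusSq M := by
  unfold frobeniusSq
  positivity

theorem scaledFrobeniusSq_nonneg (M : Matrix m r ℝ) : 0 ≤ scaledFrobeniusSq n k M :=
  div_nonneg (frobeniusSq_nonneg M) (by positivity)

theorem frobeniusSq_transpose (M : Matrix m r ℝ) : frobeniusSq Mᵀ = frobeniusSq M :=
  Finset.sum_comm

theorem frobeniusSq_one : frobeniusSq (1 : Matrix (Fin n) (Fin n) ℝ) = n := by
  simp [frobeniusSq, one_apply]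

theorem frobeniusSq_meanRow_le : frobeniusSq (meanRow n) ≤ (n : ℝ)⁻¹ := by
  rcases n.eq_zero_or_pos with rfl | hn
  · simp [frobeniusSq]
  · have : (n : ℝ) ≠ 0 := by positivity
    simp only [frobeniusSq, meanRow, of_apply, Finset.univ_unique, Finset.sum_const,
      Finset.card_univ, Finset.card_singleton, Fintype.card_fin, nsmul_eq_mul, one_smul]
    field_simp
    rfl

theorem frobeniusSq_le {M : Matrix (Fin n) r ℝ} (h : ∀ j, ∑ a, M j a ^ 2 ≤ 1) :
    frobeniusSq M ≤ n := by
  simpa [frobeniusSq] using Finset.sum_le_card_nsmul Finset.univ _ 1 fun j _ => h j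

theorem frobeniusSq_selectRow_mul (hk : k < n) (M : Matrix (Fin n) r ℝ) :
    frobeniusSq (selectRow n k * M) = ∑ a, M ⟨k, hk⟩ a ^ 2 := by
  simp [frobeniusSq, selectRow_mul_apply hk]

theorem frobeniusSq_selectRow_mul_le {M : Matrix (Fin n) r ℝ} {C : ℝ} (hC : 0 ≤ C)
    (h : ∀ j, ∑ a, M j a ^ 2 ≤ C) : frobeniusSq (selectRow n k * M) ≤ C := by
  rcases lt_or_ge k n with hk | hk
  · exact (frobeniusSq_selectRow_mul hk M).trans_le (h _)
  · simpa [selectRow_eq_zero hk, frobeniusSq] using hC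

theorem frobeniusSq_selectRow_le : frobeniusSq (selectRow n k) ≤ 1 := by
  have h := frobeniusSq_selectRow_mul_le (k := k) (M := (1 : Matrix (Fin n) (Fin n) ℝ))
    zero_le_one fun j => by simp [one_apply]
  rwa [Matrix.mul_one] at h

end Frobenius

section Deterministic

variable {ι : Type*} {l : Filter ι} {n : ι → ℕ} {d : ℕ} {X : ∀ i, Matrix (Fin (n i)) (Fin d) ℝ}
  {ξ : ∀ i, Matrix (Fin (n i)) (Fin (n i)) ℝ} {B : ℝ}

theorem hasOrder_of_frobeniusSq_le {m r : ι → Type*} [∀ i, Fintype (m i)] [∀ i, Fintype (r i)]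
    [∀ i, DecidableEq (r i)] {M : ∀ i, Matrix (m i) (r i) ℝ} {C : ℝ} (k : ℕ)
    (h : ∀ᶠ i in l, frobeniusSq (M i) ≤ C * n i ^ k) : HasOrder l n M (k / 2) := by
  refine hasOrder_of_l2_opNorm_le (C := √C) (h.mono fun i hi => ?_)
  rw [div_eq_mul_one_div, Real.rpow_mul (Nat.cast_nonneg _), Real.rpow_natCast,
    ← Real.sqrt_eq_rpow, ← Real.sqrt_mul' _ (by positivity)]
  exact Real.le_sqrt_of_sq_le ((l2_opNorm_sq_le_sum_sq _).trans hi)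

theorem hasOrder_of_scaledFrobeniusSq_le (hn : Tendsto n l atTop) {m r : ι → Type*}
    [∀ i, Fintype (m i)] [∀ i, Fintype (r i)] [∀ i, DecidableEq (r i)]
    {M : ∀ i, Matrix (m i) (r i) ℝ} {C : ℝ} (k : ℕ)
    (h : ∀ᶠ i in l, scaledFrobeniusSq (n i) k (M i) ≤ C) : HasOrder l n M (k / 2) := by
  refine hasOrder_of_frobeniusSq_le (C := C) k ?_
  filter_upwards [h, hn.eventually_gt_atTop 0] with i hi hpos
  exact (div_le_iff₀ (by positivity)).1 hi

theorem hasOrder_of_mul_self {p : ℝ} (hξ : ∀ᶠ i in l, (ξ i)ᵀ = ξ i)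
    (h : HasOrder l n (fun i => ξ i * ξ i) (p * 2)) : HasOrder l n ξ p := by
  obtain ⟨C, hC, h⟩ := h.exists_pos_bound
  refine hasOrder_of_l2_opNorm_le (C := √C) ?_
  filter_upwards [h, hξ] with i hi hsymm
  nth_rewrite 1 [← hsymm] at hi
  rw [l2_opNorm_transpose_mul_self, Real.rpow_mul (Nat.cast_nonneg _), Real.rpow_two] at hi
  refine le_of_sq_le_sq (hi.trans_eq ?_) (by positivity)
  rw [mul_pow, Real.sq_sqrt hC.le]

theorem hasOrder_meanRow_mul_of_noiseLevel_le (hn : Tendsto n l atTop)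
    (hB : ∀ᶠ i in l, noiseLevel (X i) (ξ i) ≤ B) :
    HasOrder l n (fun i => meanRow (n i) * (ξ i * X i)) 0 :=
  (hasOrder_of_scaledFrobeniusSq_le hn 0 (hB.mono fun _ hi =>
    (le_add_of_nonneg_left (add_nonneg (add_nonneg (scaledFrobeniusSq_nonneg _)
      (scaledFrobeniusSq_nonneg _)) (scaledFrobeniusSq_nonneg _))).trans hi)).mono hn (by norm_num)

theorem isTamePerturbation_of_noiseLevel_le (hn : Tendsto n l atTop)
    (hc : ∃ c > 0, ∀ᶠ i in l, CoerciveWith (c * n i) ((X i)ᵀ * X i))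
    (hX : ∀ i j, ∑ a, X i j a ^ 2 ≤ 1) (hξ : ∀ i, (ξ i)ᵀ = ξ i)
    (hB : ∀ᶠ i in l, noiseLevel (X i) (ξ i) ≤ B) : IsTamePerturbation l n X ξ := by
  have hterms : ∀ᶠ i in l, scaledFrobeniusSq (n i) 3 (ξ i * ξ i) ≤ B ∧
      scaledFrobeniusSq (n i) 2 (ξ i * X i) ≤ B ∧
      scaledFrobeniusSq (n i) 2 ((X i)ᵀ * (ξ i * X i)) ≤ B := by
    filter_upwards [hB] with i hi
    have h₁ := scaledFrobeniusSq_nonneg (n := n i) (k := 3) (ξ i * ξ i)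
    have h₂ := scaledFrobeniusSq_nonneg (n := n i) (k := 2) (ξ i * X i)
    have h₃ := scaledFrobeniusSq_nonneg (n := n i) (k := 2) ((X i)ᵀ * (ξ i * X i))
    have h₄ := scaledFrobeniusSq_nonneg (n := n i) (k := 0) (meanRow (n i) * (ξ i * X i))
    unfold noiseLevel at hi
    exact ⟨by linarith, by linarith, by linarith⟩
  exact {
    tendsto := hn
    symm := .of_forall hξ
    exists_coercive := hc
    signal := (hasOrder_of_frobeniusSq_le (C := 1) 1 (.of_forall fun i => by
      simpa using frobeniusSq_le (hX i))).mono hn (by norm_num)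
    noise := hasOrder_of_mul_self (.of_forall hξ)
      ((hasOrder_of_scaledFrobeniusSq_le hn 3 (hterms.mono fun _ hi => hi.1)).mono hn
        (by norm_num))
    noise_mul := (hasOrder_of_scaledFrobeniusSq_le hn 2 (hterms.mono fun _ hi => hi.2.1)).mono hn
      (by norm_num)
    quadratic := (hasOrder_of_scaledFrobeniusSq_le hn 2 (hterms.mono fun _ hi => hi.2.2)).mono hn
      (by norm_num) }

theorem isTameRow_selectRow (hn : Tendsto n l atTop) (hX : ∀ i j, ∑ a, X i j a ^ 2 ≤ 1)
    (hξ : ∀ i j, ∑ k, ξ i j k ^ 2 ≤ n i) {k : ℕ}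
    (hB : ∀ᶠ i in l, rowNoiseLevel (X i) (ξ i) k ≤ B) :
    IsTameRow l n X ξ (fun i => selectRow (n i) k) where
  signal := (hasOrder_of_frobeniusSq_le (C := 1) 0 (.of_forall fun i => by
    simpa using frobeniusSq_selectRow_mul_le zero_le_one (hX i))).mono hn (by norm_num)
  noise := (hasOrder_of_frobeniusSq_le (C := 1) 1 (.of_forall fun i => by
    simpa using frobeniusSq_selectRow_mul_le (Nat.cast_nonneg _) (hξ i))).mono hn (by norm_num)
  noise_mul := (hasOrder_of_scaledFrobeniusSq_le hn 1 (hB.mono fun _ hi =>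
    (le_add_of_nonneg_right (scaledFrobeniusSq_nonneg _)).trans hi)).mono hn (by norm_num)
  noise_noise_mul := by
    have h := (hasOrder_of_scaledFrobeniusSq_le hn 2 (hB.mono fun _ hi =>
      (le_add_of_nonneg_left (scaledFrobeniusSq_nonneg _)).trans hi)).mono hn
        (by norm_num : ((2 : ℕ) / 2 : ℝ) ≤ 5 / 4)
    simpa only [Matrix.mul_assoc] using h

end Deterministic

end NoiseLevel

section NoiseLevelMoments

open Matrix

variable {Ω : Type*} [MeasurableSpace Ω] {μ : Measure Ω}

theorem HasMeanLE.scaledFrobeniusSq {m r : Type*} [Fintype m] [Fintype r] {n k : ℕ}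
    {M : Ω → Matrix m r ℝ} {C : ℝ} (h : HasMeanLE μ (fun ω => frobeniusSq (M ω)) (C * n ^ k))
    (hC : 0 ≤ C) : HasMeanLE μ (fun ω => scaledFrobeniusSq n k (M ω)) C :=
  ⟨h.1.div_const _, (integral_div _ _).trans_le (div_le_of_le_mul₀ (by positivity) hC h.2)⟩

namespace IsSymmetricNoise

variable [IsProbabilityMeasure μ] {n d : ℕ} {ξ : Ω → Matrix (Fin n) (Fin n) ℝ}
  {X : Matrix (Fin n) (Fin d) ℝ} {k : ℕ}

theorem hasMeanLE_frobeniusSq_mul {m r : Type*} [Fintype m] [Fintype r] (h : IsSymmetricNoise μ ξ)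
    (L : Matrix m (Fin n) ℝ) (R : Matrix (Fin n) r ℝ) :
    HasMeanLE μ (fun ω => frobeniusSq (L * (ξ ω * R))) (2 * (frobeniusSq L * frobeniusSq R)) := by
  refine (HasMeanLE.sum fun a _ => HasMeanLE.sum fun b _ =>
    h.hasMeanLE_dotProduct_mulVec (L a) (R.col b)).mono (le_of_eq ?_)
  rw [← frobeniusSq_transpose R]
  simp only [← Finset.mul_sum, ← Finset.sum_mul]
  rfl

theorem hasMeanLE_frobeniusSq_mul_self (h : IsSymmetricNoise μ ξ) :
    HasMeanLE μ (fun ω => frobeniusSq (ξ ω * ξ ω)) (6 * n ^ 3) := by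
  have hentry (i j : Fin n) := h.hasMeanLE_mul_self_mulVec i (Pi.single j 1)
  simp only [mulVec_single_one, col_apply] at hentry
  refine (HasMeanLE.sum fun i _ => HasMeanLE.sum fun j _ => hentry i j).mono (le_of_eq ?_)
  simp [Pi.single_apply, Finset.sum_add_distrib]
  ring

theorem hasMeanLE_frobeniusSq_selectRow_mul (h : IsSymmetricNoise μ ξ)
    (hX : ∀ j, ∑ a, X j a ^ 2 ≤ 1) :
    HasMeanLE μ (fun ω => frobeniusSq (selectRow n k * (ξ ω * ξ ω * X))) (6 * n ^ 2) := by
  rcases lt_or_ge k n with hk | hk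
  · simp only [frobeniusSq_selectRow_mul hk]
    refine (HasMeanLE.sum fun a _ => h.hasMeanLE_mul_self_mulVec ⟨k, hk⟩ (X.col a)).mono ?_
    have hfrob : ∑ a, ∑ j, X.col a j ^ 2 ≤ n :=
      (frobeniusSq_transpose X).trans_le (frobeniusSq_le hX)
    have hrow : ∑ a, X.col a ⟨k, hk⟩ ^ 2 ≤ 1 := hX ⟨k, hk⟩
    simp only [Finset.sum_add_distrib, ← Finset.mul_sum]
    nlinarith [mul_le_mul_of_nonneg_left hfrob n.cast_nonneg,
      mul_le_mul_of_nonneg_left hrow (sq_nonneg (n : ℝ))]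
  · simpa [selectRow_eq_zero hk, frobeniusSq] using (hasMeanLE_const 0).mono (by positivity)

theorem hasMeanLE_noiseLevel (h : IsSymmetricNoise μ ξ) (hX : ∀ j, ∑ a, X j a ^ 2 ≤ 1) :
    HasMeanLE μ (fun ω => noiseLevel X (ξ ω)) (6 + 2 + 2 + 2) := by
  have hfrob := frobeniusSq_le hX
  refine ((h.hasMeanLE_frobeniusSq_mul_self.scaledFrobeniusSq (by norm_num)).add ?_).add ?_ |>.add
    ?_
  · have h₁ := h.hasMeanLE_frobeniusSq_mul (1 : Matrix (Fin n) (Fin n) ℝ) X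
    simp only [Matrix.one_mul, frobeniusSq_one] at h₁
    exact (h₁.mono (by nlinarith)).scaledFrobeniusSq zero_le_two
  · have h₁ := h.hasMeanLE_frobeniusSq_mul Xᵀ X
    rw [frobeniusSq_transpose, ← sq] at h₁
    exact (h₁.mono (by gcongr; exact frobeniusSq_nonneg X)).scaledFrobeniusSq zero_le_two
  · refine ((h.hasMeanLE_frobeniusSq_mul (meanRow n) X).mono ?_).scaledFrobeniusSq zero_le_two
    rw [pow_zero]
    gcongr
    refine (mul_le_mul frobeniusSq_meanRow_le hfrob (frobeniusSq_nonneg X) (by positivity)).trans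
      (inv_mul_le_one (a := (n : ℝ)))

theorem hasMeanLE_rowNoiseLevel (h : IsSymmetricNoise μ ξ) (hX : ∀ j, ∑ a, X j a ^ 2 ≤ 1) :
    HasMeanLE μ (fun ω => rowNoiseLevel X (ξ ω) k) (2 + 6) := by
  refine HasMeanLE.add (((h.hasMeanLE_frobeniusSq_mul (selectRow n k) X).mono
    ?_).scaledFrobeniusSq zero_le_two)
    ((h.hasMeanLE_frobeniusSq_selectRow_mul hX).scaledFrobeniusSq (by norm_num))
  rw [pow_one]
  gcongr
  exact (mul_le_mul frobeniusSq_selectRow_le (frobeniusSq_le hX) (frobeniusSq_nonneg X)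
    zero_le_one).trans_eq (one_mul _)

end IsSymmetricNoise

end NoiseLevelMoments

section RowExpansion

open Matrix
open scoped Matrix.Norms.L2Operator

variable {ι : Type*} {l : Filter ι} {n : ι → ℕ} {d : ℕ}
  {X Y : ∀ i, Matrix (Fin (n i)) (Fin d) ℝ} {E ξ D : ∀ i, Matrix (Fin (n i)) (Fin (n i)) ℝ}

section BoundedCorrection

theorem hasOrder_diagonal {v : ∀ i, Fin (n i) → ℝ} {C : ℝ} (hC : 0 ≤ C)
    (hv : ∀ i j, |v i j| ≤ C) : HasOrder l n (fun i => diagonal (v i)) 0 := by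
  refine hasOrder_of_l2_opNorm_le (C := C) (.of_forall fun i => ?_)
  rw [l2_opNorm_diagonal, Real.rpow_zero, mul_one]
  exact (pi_norm_le_iff_of_nonneg hC).2 (hv i)

theorem hasOrder_selectRow_mul_diagonal_mul {v : ∀ i, Fin (n i) → ℝ} {C : ℝ} {k : ℕ}
    (hv : ∀ i j, |v i j| ≤ C) (hX : ∀ i j, ∑ a, X i j a ^ 2 ≤ 1) :
    HasOrder l n (fun i => selectRow (n i) k * (diagonal (v i) * X i)) 0 := by
  have hrow i (j) : ∑ a, (diagonal (v i) * X i) j a ^ 2 ≤ C ^ 2 := by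
    simp only [diagonal_mul, mul_pow, ← Finset.mul_sum]
    exact (mul_le_of_le_one_right (sq_nonneg _) (hX i j)).trans
      (sq_le_sq' (abs_le.1 (hv i j)).1 (abs_le.1 (hv i j)).2)
  simpa using hasOrder_of_frobeniusSq_le (C := C ^ 2) 0 (.of_forall fun i => by
    simpa using frobeniusSq_selectRow_mul_le (sq_nonneg C) (hrow i))

theorem IsTamePerturbation.sub (h : IsTamePerturbation l n X ξ) (hD : HasOrder l n D 0)
    (hDt : ∀ i, (D i)ᵀ = D i) : IsTamePerturbation l n X (fun i => ξ i - D i) where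
  tendsto := h.tendsto
  symm := h.symm.mono fun i hi => by rw [transpose_sub, hi, hDt]
  exists_coercive := h.exists_coercive
  signal := h.signal
  noise := h.noise.sub (hD.mono h.tendsto (by norm_num))
  noise_mul := (h.noise_mul.sub ((hD.mul h.signal).mono h.tendsto (by norm_num))).congr'
    (.of_forall fun i => (Matrix.sub_mul _ _ _).symm)
  quadratic := (h.quadratic.sub ((h.signal.transpose.mul (hD.mul h.signal)).mono h.tendsto
    (by norm_num))).congr' (.of_forall fun i => by rw [Matrix.sub_mul, Matrix.mul_sub])

variable {m : ι → Type*} [∀ i, Fintype (m i)] {q r : ∀ i, Matrix (m i) (Fin (n i)) ℝ}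

theorem IsTameRow.sub_noise (hq : IsTameRow l n X ξ q) (h : IsTamePerturbation l n X ξ)
    (hq0 : HasOrder l n q 0) (hD : HasOrder l n D 0) :
    IsTameRow l n X (fun i => ξ i - D i) q where
  signal := hq.signal
  noise := (hq.noise.sub ((hq0.mul hD).mono h.tendsto (by norm_num))).congr'
    (.of_forall fun i => (Matrix.mul_sub _ _ _).symm)
  noise_mul := (hq.noise_mul.sub ((hq0.mul (hD.mul h.signal)).mono h.tendsto
    (by norm_num))).congr' (.of_forall fun i => by rw [Matrix.sub_mul, Matrix.mul_sub])
  noise_noise_mul := by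
    have hDX := hD.mul h.signal
    have hqξ := hq.noise_noise_mul.sub ((hq.noise.mul hDX).mono h.tendsto (by norm_num))
    have hqD := (((hq0.mul hD).mul h.noise_mul).sub (((hq0.mul hD).mul hDX).mono h.tendsto
      (by norm_num))).mono h.tendsto (q := 5 / 4) (by norm_num)
    exact (hqξ.sub hqD).congr' (.of_forall fun i => by
      simp only [Matrix.mul_sub, Matrix.sub_mul]
      abel)

theorem IsTameRow.sub (hq : IsTameRow l n X E q) (hr : IsTameRow l n X E r) :
    IsTameRow l n X E fun i => q i - r i where
  signal := by simpa only [Matrix.sub_mul] using hq.signal.sub hr.signal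
  noise := by simpa only [Matrix.sub_mul] using hq.noise.sub hr.noise
  noise_mul := by simpa only [Matrix.sub_mul] using hq.noise_mul.sub hr.noise_mul
  noise_noise_mul := by
    simpa only [Matrix.sub_mul] using hq.noise_noise_mul.sub hr.noise_noise_mul

theorem IsTameRow.congr' (hq : IsTameRow l n X E q) (hqr : ∀ᶠ i in l, q i = r i) :
    IsTameRow l n X E r where
  signal := hq.signal.congr' (hqr.mono fun i hi => by rw [hi])
  noise := hq.noise.congr' (hqr.mono fun i hi => by rw [hi])
  noise_mul := hq.noise_mul.congr' (hqr.mono fun i hi => by rw [hi])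
  noise_noise_mul := hq.noise_noise_mul.congr' (hqr.mono fun i hi => by rw [hi])

end BoundedCorrection

section CenteredRow

variable {k : ℕ}

theorem selectRow_mul_centering {n : ℕ} (hk : k < n) :
    selectRow n k * centering n = selectRow n k - meanRow n := by
  ext u j
  rw [selectRow_mul_apply hk]
  simp [centering, selectRow, meanRow, one_apply, Fin.ext_iff, eq_comm]

theorem hasOrder_selectRow : HasOrder l n (fun i => selectRow (n i) k) 0 := by
  simpa using hasOrder_of_frobeniusSq_le (C := 1) 0 (.of_forall fun i => by
    simpa using frobeniusSq_selectRow_le)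

theorem IsTameRow.selectRow_mul_centering (hk : IsTameRow l n X E fun i => selectRow (n i) k)
    (h : IsTamePerturbation l n X E)
    (hE : HasOrder l n (fun i => meanRow (n i) * (E i * X i)) 0) :
    IsTameRow l n X E fun i => selectRow (n i) k * centering (n i) :=
  (hk.sub (h.isTameRow_meanRow hE)).congr' <| (h.tendsto.eventually_gt_atTop k).mono fun _ hi =>
    (_root_.selectRow_mul_centering hi).symm

-- The mean of all rows fluctuates less than a single row, so centering does not matter.
theorem IsNearlyAligned.hasOrder_selectRow_mul_centering_mul_sub_sub
    (hY : IsNearlyAligned l n X (fun i => ξ i - D i) Y) (h : IsTamePerturbation l n X ξ)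
    (hξ : HasOrder l n (fun i => meanRow (n i) * (ξ i * X i)) 0)
    (hk : IsTameRow l n X ξ fun i => selectRow (n i) k) (hD : HasOrder l n D 0)
    (hkD : HasOrder l n (fun i => selectRow (n i) k * (D i * X i)) 0) :
    HasOrder l n (fun i => selectRow (n i) k * centering (n i) * (Y i - X i) -
      selectRow (n i) k * (ξ i * X i) * ((X i)ᵀ * X i)⁻¹) (-3 / 4) := by
  have hDX := hD.mul h.signal
  have hmean := hasOrder_meanRow h.tendsto
  have hinv := hasOrder_inv_of_coerciveWith h.tendsto h.exists_coercive
  have hq := hY.hasOrder_mul_sub_sub (((hk.sub_noise h hasOrder_selectRow hD).sub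
    ((h.isTameRow_meanRow hξ).sub_noise h (hmean.mono h.tendsto (by norm_num)) hD)))
  have hcorr := ((hkD.add (hξ.sub ((hmean.mul hDX).mono h.tendsto (by norm_num)))).mul
    hinv).mono h.tendsto (q := -3 / 4) (by norm_num)
  refine (hq.sub hcorr).congr' ((h.tendsto.eventually_gt_atTop k).mono fun i hi => ?_)
  rw [_root_.selectRow_mul_centering hi]
  simp only [Matrix.mul_sub, Matrix.sub_mul, Matrix.add_mul]
  abel

end CenteredRow

section Resolution

variable (h : IsTamePerturbation l n X E)
  (hE : HasOrder l n (fun i => meanRow (n i) * (E i * X i)) 0)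
  (hY : ∀ᶠ i in l, IsRotatedASE (X i * (X i)ᵀ + E i) (Y i))
  (hsep : ∃ c > 0, ∀ᶠ i in l, (secondMoment (centering (n i) * X i)).IsDiag ∧ ∀ a b, a ≠ b →
    c ≤ |secondMoment (centering (n i) * X i) a a - secondMoment (centering (n i) * X i) b b|)
  (hmatch : ∀ᶠ i in l, HasMatchingDiagonalGram (centering (n i) * Y i) (centering (n i) * X i))

include h hE hY hsep hmatch

theorem IsTamePerturbation.isNearlyAligned_of_column_signs
    (hsign : ∀ᶠ i in l, ∀ a, 0 ≤ ∑ j, Y i j a * X i j a) : IsNearlyAligned l n X E Y := by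
  obtain ⟨V, hV, hYV⟩ := h.exists_isAlignedFactor hY
  exact ⟨V, hV, hYV, hYV.hasOrder_sub_one_of_column_signs hV
    (hYV.exists_abs_apply_le hE hV hsep hmatch) hsign⟩

theorem IsTamePerturbation.isNearlyAligned_of_row_signs {q : ∀ i, Matrix Unit (Fin (n i)) ℝ}
    (hq : IsTameRow l n X E q) (hpos : ∃ c > 0, ∀ᶠ i in l, ∀ a, c ≤ (q i * X i) () a)
    (hsign : ∀ᶠ i in l, ∀ a, 0 ≤ (q i * Y i) () a) : IsNearlyAligned l n X E Y := by
  obtain ⟨V, hV, hYV⟩ := h.exists_isAlignedFactor hY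
  exact ⟨V, hV, hYV, hYV.hasOrder_sub_one_of_row_signs hV
    (hYV.exists_abs_apply_le hE hV hsep hmatch) hq hpos hsign⟩

end Resolution

end RowExpansion

section CharacteristicFunctions

open Complex (I)

theorem norm_prod_sub_prod_le_sum {ι : Type*} (s : Finset ι) {f g : ι → ℂ}
    (hf : ∀ i ∈ s, ‖f i‖ ≤ 1) (hg : ∀ i ∈ s, ‖g i‖ ≤ 1) :
    ‖∏ i ∈ s, f i - ∏ i ∈ s, g i‖ ≤ ∑ i ∈ s, ‖f i - g i‖ := by
  classical
  induction s using Finset.induction_on with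
  | empty => simp
  | insert a s ha ih =>
    rw [Finset.forall_mem_insert] at hf hg
    rw [Finset.prod_insert ha, Finset.prod_insert ha, Finset.sum_insert ha]
    calc ‖f a * ∏ i ∈ s, f i - g a * ∏ i ∈ s, g i‖
        = ‖(f a - g a) * ∏ i ∈ s, f i + g a * (∏ i ∈ s, f i - ∏ i ∈ s, g i)‖ := by ring_nf
      _ ≤ ‖f a - g a‖ * ‖∏ i ∈ s, f i‖ + ‖g a‖ * ‖∏ i ∈ s, f i - ∏ i ∈ s, g i‖ := by
          exact (norm_add_le _ _).trans_eq (by rw [norm_mul, norm_mul])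
      _ ≤ ‖f a - g a‖ * 1 + 1 * ∑ i ∈ s, ‖f i - g i‖ := by
          gcongr
          · rw [norm_prod]
            exact Finset.prod_le_one (fun i _ => norm_nonneg _) hf.2
          · exact hg.1
          · exact ih hf.2 hg.2
      _ = ‖f a - g a‖ + ∑ i ∈ s, ‖f i - g i‖ := by rw [mul_one, one_mul]

theorem norm_exp_mul_I_sub_taylor_le {θ : ℝ} (hθ : |θ| ≤ 1) :
    ‖Complex.exp (θ * I) - (1 + θ * I - θ ^ 2 / 2)‖ ≤ |θ| ^ 3 := by
  have hnorm : ‖(θ : ℂ) * I‖ = |θ| := by simp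
  have hsum : ∑ m ∈ Finset.range 3, ((θ : ℂ) * I) ^ m / (m.factorial : ℂ) =
      1 + θ * I - θ ^ 2 / 2 := by
    simp [Finset.sum_range_succ, mul_pow, Nat.factorial]
    ring
  have hbound := Complex.exp_bound (x := θ * I) (n := 3) (hnorm.trans_le hθ) (by norm_num)
  rw [hnorm, hsum] at hbound
  exact hbound.trans (mul_le_of_le_one_right (by positivity) (by norm_num [Nat.factorial]))

theorem norm_exp_mul_I_sub_exp_mul_I_le (x y : ℝ) :
    ‖Complex.exp (x * I) - Complex.exp (y * I)‖ ≤ |x - y| := by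
  have hfactor : Complex.exp (x * I) - Complex.exp (y * I) =
      Complex.exp (y * I) * (Complex.exp (I * ((x - y : ℝ) : ℂ)) - 1) := by
    rw [mul_sub, ← Complex.exp_add, mul_one]
    push_cast
    ring_nf
  rw [hfactor, norm_mul, Complex.norm_exp_ofReal_mul_I, one_mul]
  exact Real.norm_exp_I_mul_ofReal_sub_one_le

variable {Ω : Type*} [MeasurableSpace Ω] {μ : Measure Ω} [IsProbabilityMeasure μ]

theorem integrable_exp_mul_I {f : Ω → ℝ} (hf : AEMeasurable f μ) :
    Integrable (fun ω => Complex.exp (f ω * I)) μ :=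
  Integrable.of_bound (C := 1) (Complex.measurable_exp.comp_aemeasurable
      ((Complex.measurable_ofReal.comp_aemeasurable hf).mul_const _)).aestronglyMeasurable
    (ae_of_all _ fun _ => (Complex.norm_exp_ofReal_mul_I _).le)

theorem norm_integral_exp_mul_I_sub_le {f g : Ω → ℝ} (hf : AEMeasurable f μ)
    (hg : AEMeasurable g μ) {δ ε : ℝ} (hδ : 0 ≤ δ) (hε : 0 ≤ ε) {B : Set Ω}
    (hB : μ B ≤ ENNReal.ofReal ε) (h : ∀ᵐ ω ∂μ, ω ∉ B → |f ω - g ω| ≤ δ) :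
    ‖∫ ω, Complex.exp (f ω * I) ∂μ - ∫ ω, Complex.exp (g ω * I) ∂μ‖ ≤ δ + 2 * ε := by
  have hBm := measurableSet_toMeasurable μ B
  have hBε : μ.real (toMeasurable μ B) ≤ ε := by
    rw [measureReal_def, measure_toMeasurable]
    exact ENNReal.toReal_le_of_le_ofReal hε hB
  have hind := (integrable_const (μ := μ) (2 : ℝ)).indicator hBm
  have hint := (integrable_const (μ := μ) δ).fun_add hind
  have hpoint : ∀ᵐ ω ∂μ, ‖Complex.exp (f ω * I) - Complex.exp (g ω * I)‖ ≤
      δ + (toMeasurable μ B).indicator (fun _ => (2 : ℝ)) ω := by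
    filter_upwards [h] with ω hω
    by_cases hωB : ω ∈ toMeasurable μ B
    · rw [Set.indicator_of_mem hωB]
      refine (norm_sub_le _ _).trans ?_
      rw [Complex.norm_exp_ofReal_mul_I, Complex.norm_exp_ofReal_mul_I]
      linarith
    · rw [Set.indicator_of_notMem hωB, add_zero]
      exact (norm_exp_mul_I_sub_exp_mul_I_le _ _).trans
        (hω fun hmem => hωB (subset_toMeasurable μ B hmem))
  rw [← integral_sub (integrable_exp_mul_I hf) (integrable_exp_mul_I hg)]
  refine (norm_integral_le_of_norm_le hint hpoint).trans ?_
  rw [integral_add (integrable_const δ) hind, integral_indicator_const _ hBm]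
  simp only [integral_const, probReal_univ, smul_eq_mul, one_mul]
  linarith

theorem norm_integral_exp_mul_I_sub_taylor_le {ξ : Ω → ℝ} (hξ : Measurable ξ)
    (hb : ∀ ω, |ξ ω| ≤ 1) (hmean : ∫ ω, ξ ω ∂μ = 0) {s : ℝ} (hs : |s| ≤ 1) :
    ‖∫ ω, Complex.exp ((ξ ω * s : ℝ) * I) ∂μ -
      ((1 - (∫ ω, ξ ω ^ 2 ∂μ) * s ^ 2 / 2 : ℝ) : ℂ)‖ ≤ |s| ^ 3 := by
  have hint : Integrable ξ μ := Integrable.of_bound hξ.aestronglyMeasurable 1 (ae_of_all _ hb)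
  have hint2 : Integrable (fun ω => ξ ω ^ 2) μ :=
    Integrable.of_bound (hξ.pow_const 2).aestronglyMeasurable 1 (ae_of_all _ fun ω => by
      simpa using (sq_le_one_iff_abs_le_one _).2 (hb ω))
  have hθ (ω : Ω) : |ξ ω * s| ≤ |s| := by
    rw [abs_mul]
    exact mul_le_of_le_one_left (abs_nonneg _) (hb ω)
  have hlin : Integrable (fun ω => ((ξ ω * s : ℝ) : ℂ) * I) μ :=
    ((hint.mul_const s).ofReal).mul_const _
  have hsq (ω : Ω) : ((ξ ω * s : ℝ) : ℂ) ^ 2 / 2 = ((ξ ω ^ 2 * (s ^ 2 / 2) : ℝ) : ℂ) := by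
    push_cast
    ring
  have hquad : Integrable (fun ω => ((ξ ω * s : ℝ) : ℂ) ^ 2 / 2) μ := by
    simp only [hsq]
    exact (hint2.mul_const _).ofReal
  have haff := (integrable_const (μ := μ) (1 : ℂ)).fun_add hlin
  have htaylor : ∫ ω, (1 + ((ξ ω * s : ℝ) : ℂ) * I - ((ξ ω * s : ℝ) : ℂ) ^ 2 / 2) ∂μ =
      ((1 - (∫ ω, ξ ω ^ 2 ∂μ) * s ^ 2 / 2 : ℝ) : ℂ) := by
    rw [integral_sub haff hquad, integral_add (integrable_const _) hlin, integral_mul_const]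
    simp only [hsq]
    rw [integral_complex_ofReal, integral_complex_ofReal, integral_mul_const, integral_mul_const,
      hmean]
    simp [mul_div_assoc]
  have hpoly : Integrable
      (fun ω => 1 + ((ξ ω * s : ℝ) : ℂ) * I - ((ξ ω * s : ℝ) : ℂ) ^ 2 / 2) μ := haff.sub hquad
  rw [← htaylor, ← integral_sub (integrable_exp_mul_I (hξ.mul_const s).aemeasurable) hpoly]
  refine (norm_integral_le_of_norm_le_const (C := |s| ^ 3) (ae_of_all _ fun ω => ?_)).trans_eq
    (by simp)
  exact (norm_exp_mul_I_sub_taylor_le ((hθ ω).trans hs)).trans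
    (pow_le_pow_left₀ (abs_nonneg _) (hθ ω) 3)

theorem norm_integral_exp_mul_I_sub_gaussian_le {ξ : Ω → ℝ} (hξ : Measurable ξ)
    (hb : ∀ ω, |ξ ω| ≤ 1) (hmean : ∫ ω, ξ ω ∂μ = 0) {s : ℝ} (hs : |s| ≤ 1) :
    ‖∫ ω, Complex.exp ((ξ ω * s : ℝ) * I) ∂μ -
      Complex.exp (-((∫ ω, ξ ω ^ 2 ∂μ) * s ^ 2 / 2 : ℝ))‖ ≤ 2 * |s| ^ 3 := by
  have htaylor := norm_integral_exp_mul_I_sub_taylor_le hξ hb hmean hs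
  have hv1 : ∫ ω, ξ ω ^ 2 ∂μ ≤ 1 := by
    refine (Real.le_norm_self _).trans ?_
    refine (norm_integral_le_of_norm_le_const (C := 1) (ae_of_all _ fun ω => ?_)).trans_eq
      (by simp)
    simpa using (sq_le_one_iff_abs_le_one _).2 (hb ω)
  have hs2 : s ^ 2 ≤ 1 := (sq_le_one_iff_abs_le_one _).2 hs
  set x := (∫ ω, ξ ω ^ 2 ∂μ) * s ^ 2 / 2 with hx
  have hx0 : 0 ≤ x := by
    have : 0 ≤ ∫ ω, ξ ω ^ 2 ∂μ := integral_nonneg fun ω => sq_nonneg _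
    positivity
  have hxs : x ≤ s ^ 2 := by nlinarith [sq_nonneg s]
  have hgauss : ‖((1 - x : ℝ) : ℂ) - Complex.exp (-(x : ℝ))‖ ≤ |s| ^ 3 := by
    rw [← Complex.ofReal_neg, ← Complex.ofReal_exp, ← Complex.ofReal_sub, Complex.norm_real,
      Real.norm_eq_abs, abs_sub_comm]
    calc |Real.exp (-x) - (1 - x)| = |Real.exp (-x) - 1 - -x| := by ring_nf
      _ ≤ (-x) ^ 2 := Real.abs_exp_sub_one_sub_id_le (by rw [abs_neg, abs_of_nonneg hx0]; linarith)
      _ ≤ (|s| ^ 2) ^ 2 := by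
          rw [neg_sq, sq_abs]
          gcongr
      _ = |s| ^ 3 * |s| := by ring
      _ ≤ |s| ^ 3 := mul_le_of_le_one_right (by positivity) hs
  linarith [norm_sub_le_norm_sub_add_norm_sub (∫ ω, Complex.exp ((ξ ω * s : ℝ) * I) ∂μ)
    ((1 - x : ℝ) : ℂ) (Complex.exp (-(x : ℝ)))]

theorem norm_integral_exp_sum_mul_I_sub_gaussian_le {ι : Type*} [Fintype ι]
    {ξ : ι → Ω → ℝ} (hind : iIndepFun ξ μ) (hξ : ∀ j, Measurable (ξ j))
    (hb : ∀ j ω, |ξ j ω| ≤ 1) (hmean : ∀ j, ∫ ω, ξ j ω ∂μ = 0) {s : ι → ℝ}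
    (hs : ∀ j, |s j| ≤ 1) :
    ‖∫ ω, Complex.exp ((∑ j, ξ j ω * s j : ℝ) * I) ∂μ -
      Complex.exp (-((∑ j, (∫ ω, ξ j ω ^ 2 ∂μ) * s j ^ 2) / 2 : ℝ))‖ ≤ 2 * ∑ j, |s j| ^ 3 := by
  have hprod : ∫ ω, Complex.exp ((∑ j, ξ j ω * s j : ℝ) * I) ∂μ =
      ∏ j, ∫ ω, Complex.exp ((ξ j ω * s j : ℝ) * I) ∂μ := by
    rw [← hind.integral_fun_prod_comp (f := fun j (x : ℝ) => Complex.exp ((x * s j : ℝ) * I))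
      (fun j => (hξ j).aemeasurable) (fun j => Continuous.aestronglyMeasurable (by fun_prop))]
    simp only [← Complex.exp_sum, ← Finset.sum_mul, Complex.ofReal_sum]
  have hgauss : Complex.exp (-((∑ j, (∫ ω, ξ j ω ^ 2 ∂μ) * s j ^ 2) / 2 : ℝ)) =
      ∏ j, Complex.exp (-((∫ ω, ξ j ω ^ 2 ∂μ) * s j ^ 2 / 2 : ℝ)) := by
    rw [← Complex.exp_sum, Finset.sum_neg_distrib, ← Complex.ofReal_sum, ← Finset.sum_div]
  rw [hprod, hgauss, Finset.mul_sum]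
  refine (norm_prod_sub_prod_le_sum _ (fun j _ => ?_) (fun j _ => ?_)).trans
    (Finset.sum_le_sum fun j _ =>
      norm_integral_exp_mul_I_sub_gaussian_le (hξ j) (hb j) (hmean j) (hs j))
  · exact (norm_integral_le_of_norm_le_const (C := 1) (ae_of_all _ fun ω =>
      (Complex.norm_exp_ofReal_mul_I _).le)).trans_eq (by simp)
  · rw [← Complex.ofReal_neg, Complex.norm_exp_ofReal, Real.exp_le_one_iff, Left.neg_nonpos_iff]
    have : 0 ≤ ∫ ω, ξ j ω ^ 2 ∂μ := integral_nonneg fun ω => sq_nonneg _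
    positivity

theorem IsSymmetricNoise.norm_integral_exp_row_mul_I_sub_gaussian_le {n : ℕ}
    {ξ : Ω → Matrix (Fin n) (Fin n) ℝ} (h : IsSymmetricNoise μ ξ) (i : Fin n) {s : Fin n → ℝ}
    (hs : ∀ j, |s j| ≤ 1) :
    ‖∫ ω, Complex.exp ((∑ j, ξ ω i j * s j : ℝ) * I) ∂μ -
      Complex.exp (-((∑ j, (∫ ω, ξ ω i j ^ 2 ∂μ) * s j ^ 2) / 2 : ℝ))‖ ≤ 2 * ∑ j, |s j| ^ 3 := by
  have hind : iIndepFun (fun (j : {j // j ≠ i}) ω => ξ ω i j) μ := by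
    simpa only [h.apply_orderedPair] using
      h.indep.precomp (g := fun j : {j // j ≠ i} => orderedPair i j j.2.symm) fun j k hjk => by
        rw [orderedPair_eq_iff, Sym2.eq_iff] at hjk
        grind
  have hrow := norm_integral_exp_sum_mul_I_sub_gaussian_le hind
    (fun j => h.measurable_entry i j) (fun j ω => h.abs_le_one ω i j)
    (fun j => h.mean_eq_zero i j) (s := fun j => s j) fun j => hs j
  simp only [Fintype.sum_eq_add_sum_subtype_ne _ i, h.diag_eq_zero, zero_mul, zero_add, ne_eq,
    OfNat.ofNat_ne_zero, not_false_eq_true, zero_pow, integral_zero]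
  linarith [abs_nonneg (s i), pow_nonneg (abs_nonneg (s i)) 3]

end CharacteristicFunctions

section Network

variable {Ω : Type*} [MeasurableSpace Ω] {μ : Measure Ω} {n : ℕ}
  {P : Matrix (Fin n) (Fin n) ℝ} {A : Ω → Matrix (Fin n) (Fin n) ℝ}

/-- The off-diagonal part of `A - P`: the noise in a network `A` with connection probabilities
`P`. The diagonal is left out because `A` has no self-loops, whatever the diagonal of `P`. -/
def networkNoise (P A : Matrix (Fin n) (Fin n) ℝ) : Matrix (Fin n) (Fin n) ℝ :=
  Matrix.of fun i j => if i = j then 0 else A i j - P i j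

theorem networkNoise_apply_of_ne (P A : Matrix (Fin n) (Fin n) ℝ) {i j : Fin n} (h : i ≠ j) :
    networkNoise P A i j = A i j - P i j := by simp [networkNoise, h]

theorem networkNoise_apply_self (P A : Matrix (Fin n) (Fin n) ℝ) (i : Fin n) :
    networkNoise P A i i = 0 := by simp [networkNoise]

namespace IsBernoulliNetwork

theorem add_networkNoise_sub_diagonal (hA : IsBernoulliNetwork μ P A) (ω : Ω) :
    P + (networkNoise P (A ω) - Matrix.diagonal fun i => P i i) = A ω := by
  ext i j
  by_cases h : i = j
  · subst h
    simp [networkNoise_apply_self, hA.diag_eq_zero]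
  · simp [networkNoise_apply_of_ne _ _ h, Matrix.diagonal_apply_ne _ h]

theorem integral_entry (hA : IsBernoulliNetwork μ P A) (hP : ∀ i j, 0 ≤ P i j) {i j : Fin n}
    (hij : i ≠ j) : ∫ ω, A ω i j ∂μ = P i j := by
  have hindicator (ω : Ω) : A ω i j = Set.indicator {ω | A ω i j = 1} 1 ω := by
    rcases hA.binary ω i j with h | h
    · rw [Set.indicator_of_notMem (by simp [h]), h]
    · rw [Set.indicator_of_mem (by simpa using h), h, Pi.one_apply]
  have hm : MeasurableSet {ω | A ω i j = 1} := hA.measurable_entry i j (measurableSet_singleton 1)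
  rw [integral_congr_ae (ae_of_all _ hindicator), integral_indicator_one hm, measureReal_def,
    hA.prob_edge i j hij, ENNReal.toReal_ofReal (hP i j)]

variable [IsProbabilityMeasure μ]

theorem integrable_entry (hA : IsBernoulliNetwork μ P A) (i j : Fin n) :
    Integrable (fun ω => A ω i j) μ :=
  Integrable.of_bound (hA.measurable_entry i j).aestronglyMeasurable 1 (ae_of_all _ fun ω => by
    rcases hA.binary ω i j with h | h <;> simp [h])

theorem integral_networkNoise_sq (hA : IsBernoulliNetwork μ P A) (hP : ∀ i j, 0 ≤ P i j)
    {i j : Fin n} (hij : i ≠ j) :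
    ∫ ω, networkNoise P (A ω) i j ^ 2 ∂μ = P i j * (1 - P i j) := by
  have hsq (ω : Ω) : networkNoise P (A ω) i j ^ 2 = (1 - 2 * P i j) * A ω i j + P i j ^ 2 := by
    rw [networkNoise_apply_of_ne _ _ hij]
    rcases hA.binary ω i j with h | h <;> rw [h] <;> ring
  simp only [hsq]
  rw [integral_add ((hA.integrable_entry i j).const_mul _) (integrable_const _),
    integral_const_mul, hA.integral_entry hP hij, integral_const, probReal_univ, smul_eq_mul]
  ring

theorem isSymmetricNoise (hA : IsBernoulliNetwork μ P A) (hP : ∀ i j, 0 ≤ P i j ∧ P i j ≤ 1)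
    (hPs : P.IsSymm) : IsSymmetricNoise μ fun ω => networkNoise P (A ω) where
  measurable_entry i j := by
    by_cases h : i = j
    · simp only [h, networkNoise_apply_self, measurable_const]
    · simp only [networkNoise_apply_of_ne _ _ h]
      exact (hA.measurable_entry i j).sub_const _
  symm ω i j := by
    by_cases h : i = j
    · rw [h]
    · rw [networkNoise_apply_of_ne _ _ h, networkNoise_apply_of_ne _ _ (Ne.symm h), hA.symm,
        hPs.apply]
  diag_eq_zero ω i := networkNoise_apply_self _ _ i
  abs_le_one ω i j := by
    by_cases h : i = j
    · simp [h, networkNoise_apply_self]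
    · rw [networkNoise_apply_of_ne _ _ h, abs_le]
      have := hP i j
      rcases hA.binary ω i j with h | h <;> rw [h] <;> constructor <;> linarith
  mean_eq_zero i j := by
    by_cases h : i = j
    · simp [h, networkNoise_apply_self]
    · simp only [networkNoise_apply_of_ne _ _ h]
      rw [integral_sub (hA.integrable_entry i j) (integrable_const _),
        hA.integral_entry (fun i j => (hP i j).1) h]
      simp
  indep := by
    have h := hA.indep.comp (fun e x => x - P e.1.1 e.1.2) fun e => measurable_id.sub_const _
    refine h.congr fun e => ae_of_all _ fun ω => ?_
    simp [networkNoise_apply_of_ne _ _ e.2.ne]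

end IsBernoulliNetwork

end Network

section ConvergenceInDistribution

open Complex (I)

/-- The filter on pairs `(i, ω)` that describes what holds almost surely, eventually along `l`. It
turns limit theorems with random terms into limits along a single filter. -/
def eventualAE {ι : Type*} {Ω : ι → Type*} [∀ i, MeasurableSpace (Ω i)] (l : Filter ι)
    (μ : ∀ i, Measure (Ω i)) : Filter (Σ i, Ω i) :=
  l.bind fun i => (ae (μ i)).map (Sigma.mk i)

theorem eventually_eventualAE {ι : Type*} {Ω : ι → Type*} [∀ i, MeasurableSpace (Ω i)]
    {l : Filter ι} {μ : ∀ i, Measure (Ω i)} {p : (Σ i, Ω i) → Prop} :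
    (∀ᶠ q in eventualAE l μ, p q) ↔ ∀ᶠ i in l, ∀ᵐ ω ∂μ i, p ⟨i, ω⟩ :=
  Iff.rfl

theorem tendsto_fst_eventualAE {ι : Type*} {Ω : ι → Type*} [∀ i, MeasurableSpace (Ω i)]
    (l : Filter ι) (μ : ∀ i, Measure (Ω i)) : Tendsto Sigma.fst (eventualAE l μ) l :=
  fun s (hs : ∀ᶠ i in l, i ∈ s) => eventually_eventualAE (p := fun q => q.1 ∈ s).2
    (hs.mono fun _ hi => ae_of_all _ fun _ => hi)

theorem measure_lt_le_of_hasMeanLE {Ω : Type*} [MeasurableSpace Ω] {μ : Measure Ω}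
    [IsFiniteMeasure μ] {f : Ω → ℝ} {C B ε : ℝ} (hf : HasMeanLE μ f C) (h0 : ∀ ω, 0 ≤ f ω)
    (hB : 0 < B) (hC : C ≤ B * ε) : μ {ω | B < f ω} ≤ ENNReal.ofReal ε := by
  have hmarkov := mul_meas_ge_le_integral_of_nonneg (ae_of_all _ h0) hf.1 B
  have hle : B * μ.real {ω | B ≤ f ω} ≤ B * ε := (hmarkov.trans hf.2).trans hC
  refine (measure_mono fun ω (hω : B < f ω) => hω.le).trans
    ((ENNReal.le_ofReal_iff_toReal_le (measure_ne_top _ _) ?_).2 (le_of_mul_le_mul_left hle hB))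
  exact measureReal_nonneg.trans (le_of_mul_le_mul_left hle hB)

variable {Ω : ℕ → Type*} [∀ n, MeasurableSpace (Ω n)] {μ : ∀ n, Measure (Ω n)}
  [∀ n, IsProbabilityMeasure (μ n)] {Ω' : Type*} [MeasurableSpace Ω'] {μ' : Measure Ω'}
  [IsProbabilityMeasure μ'] {E : Type*} [NormedAddCommGroup E] [InnerProductSpace ℝ E]
  [FiniteDimensional ℝ E] [MeasurableSpace E] [BorelSpace E] {U V : ∀ n, Ω n → E} {Z : Ω' → E}

theorem tendstoInDistribution_iff_tendsto_integral_exp (hU : ∀ n, AEMeasurable (U n) (μ n))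
    (hZ : AEMeasurable Z μ') : TendstoInDistribution U atTop Z μ μ' ↔ ∀ t,
      Tendsto (fun n => ∫ ω, Complex.exp ((inner ℝ (U n ω) t : ℝ) * I) ∂μ n) atTop
        (𝓝 (charFun (μ'.map Z) t)) := by
  have hchar (n : ℕ) (t : E) : charFun ((μ n).map (U n)) t =
      ∫ ω, Complex.exp ((inner ℝ (U n ω) t : ℝ) * I) ∂μ n := by
    rw [charFun_apply, integral_map (hU n)]
    exact Continuous.aestronglyMeasurable (by fun_prop)
  simp only [← hchar]
  exact ⟨fun h => ProbabilityMeasure.tendsto_iff_tendsto_charFun.1 h.tendsto,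
    fun h => ⟨hU, hZ, ProbabilityMeasure.tendsto_iff_tendsto_charFun.2 h⟩⟩

theorem eventually_norm_integral_exp_inner_sub_le {F : ∀ n, Ω n → ℝ} {C : ℝ}
    (hU : ∀ n, AEMeasurable (U n) (μ n)) (hV : ∀ n, AEMeasurable (V n) (μ n))
    (hF0 : ∀ n ω, 0 ≤ F n ω) (hF : ∀ n, HasMeanLE (μ n) (F n) C)
    (hUV : ∀ B, Tendsto (fun q => U q.1 q.2 - V q.1 q.2)
      (eventualAE atTop μ ⊓ 𝓟 {q | F q.1 q.2 ≤ B}) (𝓝 0)) (t : E) {ε : ℝ} (hε : 0 < ε) :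
    ∀ᶠ n in atTop, ‖∫ ω, Complex.exp ((inner ℝ (U n ω) t : ℝ) * I) ∂μ n -
      ∫ ω, Complex.exp ((inner ℝ (V n ω) t : ℝ) * I) ∂μ n‖ ≤ ε + 2 * ε := by
  set B := (|C| + 1) / ε with hB
  have hinner := ((hUV B).inner (𝕜 := ℝ) (tendsto_const_nhds (x := t))).abs
  rw [inner_zero_left, abs_zero] at hinner
  have hgood := eventually_eventualAE.1 (eventually_inf_principal.1 (hinner.eventually_le_const hε))
  filter_upwards [hgood] with n hn
  refine norm_integral_exp_mul_I_sub_le ((hU n).inner_const) ((hV n).inner_const) hε.le hε.le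
    (measure_lt_le_of_hasMeanLE (hF n) (hF0 n) (B := B) (by positivity) ?_) ?_
  · rw [hB, div_mul_cancel₀ _ hε.ne']
    linarith [le_abs_self C]
  · filter_upwards [hn] with ω hω hB
    simpa only [inner_sub_left] using hω (not_lt.1 hB)

theorem tendstoInDistribution_of_hasMeanLE {F : ∀ n, Ω n → ℝ} {C : ℝ}
    (hV : TendstoInDistribution V atTop Z μ μ') (hU : ∀ n, AEMeasurable (U n) (μ n))
    (hF0 : ∀ n ω, 0 ≤ F n ω) (hF : ∀ n, HasMeanLE (μ n) (F n) C)
    (hUV : ∀ B, Tendsto (fun q => U q.1 q.2 - V q.1 q.2)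
      (eventualAE atTop μ ⊓ 𝓟 {q | F q.1 q.2 ≤ B}) (𝓝 0)) :
    TendstoInDistribution U atTop Z μ μ' := by
  refine (tendstoInDistribution_iff_tendsto_integral_exp hU hV.aemeasurable_limit).2 fun t => ?_
  refine tendsto_of_tendsto_of_dist ((tendstoInDistribution_iff_tendsto_integral_exp
    hV.forall_aemeasurable hV.aemeasurable_limit).1 hV t) (Metric.tendsto_nhds.2 fun ε hε => ?_)
  filter_upwards [eventually_norm_integral_exp_inner_sub_le hU hV.forall_aemeasurable hF0 hF hUV t
    (show 0 < ε / 4 by positivity)] with n hn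
  rw [dist_zero_right, Real.norm_of_nonneg dist_nonneg, dist_comm, dist_eq_norm]
  linarith

end ConvergenceInDistribution

section Rows

open Matrix
open scoped Matrix.Norms.L2Operator

variable {n d : ℕ} {X : Matrix (Fin n) (Fin d) ℝ}

theorem rowVec_eq_toLp_selectRow_mul (M : Matrix (Fin n) (Fin d) ℝ) (k : ℕ) :
    rowVec M k = WithLp.toLp 2 ((selectRow n k * M) ()) := by
  by_cases hk : k < n
  · rw [rowVec, dif_pos hk]
    congr 1
    exact funext fun a => (selectRow_mul_apply hk M () a).symm
  · rw [rowVec, dif_neg hk, selectRow_eq_zero (not_lt.1 hk), Matrix.zero_mul]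
    rfl

theorem norm_rowVec_le_l2_opNorm (M : Matrix (Fin n) (Fin d) ℝ) (k : ℕ) :
    ‖rowVec M k‖ ≤ ‖selectRow n k * M‖ := by
  have h := l2_opNorm_mulVec (selectRow n k * M)ᵀ (PiLp.single 2 () (1 : ℝ))
  rw [l2_opNorm_transpose, PiLp.norm_single, norm_one, mul_one, PiLp.ofLp_single,
    mulVec_single_one, col_transpose] at h
  rw [rowVec_eq_toLp_selectRow_mul]
  exact h

theorem aemeasurable_rowVec {Ω : Type*} [MeasurableSpace Ω] {μ : Measure Ω}
    {Y : Ω → Matrix (Fin n) (Fin d) ℝ} (hY : ∀ j a, AEMeasurable (fun ω => Y ω j a) μ) (k : ℕ) :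
    AEMeasurable (fun ω => rowVec (Y ω) k) μ := by
  unfold rowVec
  split_ifs with h
  · exact (WithLp.measurable_toLp 2 _).comp_aemeasurable (aemeasurable_pi_iff.2 (hY _))
  · exact aemeasurable_const

theorem inner_rowVec {i j : ℕ} (hi : i < n) (hj : j < n) :
    inner ℝ (rowVec X i) (rowVec X j) = (X * Xᵀ) ⟨i, hi⟩ ⟨j, hj⟩ := by
  rw [rowVec, dif_pos hi, rowVec, dif_pos hj, EuclideanSpace.inner_toLp_toLp, star_trivial,
    dotProduct_comm]
  rfl

theorem dotProduct_scoreCov_mulVec {i : ℕ} (hi : i < n) (u : Fin d → ℝ) :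
    u ⬝ᵥ scoreCov X i *ᵥ u = (n : ℝ)⁻¹ * ∑ j, (if j = ⟨i, hi⟩ then 0 else
      (X * Xᵀ) ⟨i, hi⟩ j * (1 - (X * Xᵀ) ⟨i, hi⟩ j)) * (X *ᵥ u) j ^ 2 := by
  rw [scoreCov, smul_mulVec, dotProduct_smul, smul_eq_mul, sum_mulVec, dotProduct_sum]
  congr 1
  refine Finset.sum_congr rfl fun j _ => ?_
  simp only [← Fin.val_inj (a := j) (b := ⟨i, hi⟩)]
  split_ifs
  · simp
  · have hrow : X j ⬝ᵥ u = (X *ᵥ u) j := rfl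
    rw [smul_mulVec, dotProduct_smul, smul_eq_mul, inner_rowVec hi j.2, vecMulVec_mulVec,
      dotProduct_smul, MulOpposite.smul_eq_mul_unop, MulOpposite.unop_op, dotProduct_comm u, hrow,
      sq]

theorem transpose_scoreCov (X : Matrix (Fin n) (Fin d) ℝ) (i : ℕ) :
    (scoreCov X i)ᵀ = scoreCov X i := by
  rw [scoreCov, transpose_smul, transpose_sum]
  congr 1
  refine Finset.sum_congr rfl fun j _ => ?_
  split_ifs
  · exact transpose_zero
  · rw [transpose_smul, transpose_vecMulVec]

theorem dotProduct_scoreCov_mulVec_nonneg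
    (hP : ∀ i j, 0 ≤ (X * Xᵀ) i j ∧ (X * Xᵀ) i j ≤ 1) {i : ℕ} (hi : i < n) (u : Fin d → ℝ) :
    0 ≤ u ⬝ᵥ scoreCov X i *ᵥ u := by
  rw [dotProduct_scoreCov_mulVec hi]
  refine mul_nonneg (by positivity) (Finset.sum_nonneg fun j _ => mul_nonneg ?_ (sq_nonneg _))
  split_ifs
  · exact le_rfl
  · exact mul_nonneg (hP _ j).1 (sub_nonneg.2 (hP _ j).2)

theorem isSymm_mul_transpose (X : Matrix (Fin n) (Fin d) ℝ) : (X * Xᵀ).IsSymm := by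
  rw [IsSymm, transpose_mul, transpose_transpose]

theorem sum_sq_row_le_one (hP : ∀ j, (X * Xᵀ) j j ≤ 1) (j : Fin n) : ∑ a, X j a ^ 2 ≤ 1 := by
  simpa only [mul_apply, transpose_apply, ← sq] using hP j

theorem transpose_mul_self_eq_smul_secondMoment (X : Matrix (Fin n) (Fin d) ℝ) :
    Xᵀ * X = (n : ℝ) • secondMoment X := by
  rcases n.eq_zero_or_pos with rfl | hn
  · ext
    simp [mul_apply]
  · rw [secondMoment, smul_inv_smul₀ (by positivity)]

theorem inv_transpose_mul_self (hn : 0 < n) (hX : IsUnit (secondMoment X).det) :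
    (Xᵀ * X)⁻¹ = (n : ℝ)⁻¹ • (secondMoment X)⁻¹ := by
  have hn0 : (n : ℝ) ≠ 0 := by positivity
  rw [transpose_mul_self_eq_smul_secondMoment]
  exact Matrix.inv_smul' _ (Units.mk0 (n : ℝ) hn0) hX

end Rows

section Limits

open Matrix
open scoped Matrix.Norms.L2Operator

variable {d : ℕ} {X : ∀ n : ℕ, Matrix (Fin n) (Fin d) ℝ} {MX Q : Matrix (Fin d) (Fin d) ℝ} {i : ℕ}

theorem posSemidef_of_tendsto_scoreCov
    (hP : ∀ n i j, 0 ≤ (X n * (X n)ᵀ) i j ∧ (X n * (X n)ᵀ) i j ≤ 1)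
    (hQ : Tendsto (fun n => scoreCov (X n) i) atTop (𝓝 Q)) : Q.PosSemidef := by
  refine PosSemidef.of_dotProduct_mulVec_nonneg ?_ fun u => ?_
  · have hQt := (Continuous.tendsto (f := transpose) (by fun_prop) Q).comp hQ
    simp only [Function.comp_def, transpose_scoreCov] at hQt
    rw [IsHermitian, conjTranspose_eq_transpose_of_trivial]
    exact tendsto_nhds_unique hQt hQ
  · rw [star_trivial]
    refine ge_of_tendsto ((Continuous.tendsto (f := fun M => u ⬝ᵥ M *ᵥ u)
      (by fun_prop) Q).comp hQ) ?_
    filter_upwards [eventually_gt_atTop i] with n hn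
    exact dotProduct_scoreCov_mulVec_nonneg (hP n) hn u

variable (hMX : Tendsto (fun n => secondMoment (X n)) atTop (𝓝 MX))

include hMX

theorem transpose_eq_of_tendsto_secondMoment : MXᵀ = MX := by
  have hMXt := (Continuous.tendsto (f := transpose) (by fun_prop) MX).comp hMX
  simp only [Function.comp_def, secondMoment, transpose_smul, transpose_mul,
    transpose_transpose] at hMXt
  exact tendsto_nhds_unique hMXt hMX

theorem posSemidef_inv_mul_mul_inv (hQ : Q.PosSemidef) : (MX⁻¹ * Q * MX⁻¹).PosSemidef := by
  have h := hQ.mul_mul_conjTranspose_same MX⁻¹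
  rwa [conjTranspose_eq_transpose_of_trivial, transpose_nonsing_inv,
    transpose_eq_of_tendsto_secondMoment hMX] at h

variable (hMX_inv : IsUnit MX.det)

include hMX_inv

theorem tendsto_inv_secondMoment : Tendsto (fun n => (secondMoment (X n))⁻¹) atTop (𝓝 MX⁻¹) := by
  refine (continuousAt_matrix_inv MX ?_).tendsto.comp hMX
  rw [Ring.inverse_eq_inv']
  exact continuousAt_inv₀ hMX_inv.ne_zero

theorem eventually_isUnit_det_secondMoment :
    ∀ᶠ n in atTop, IsUnit (secondMoment (X n)).det := by
  have hdet := ((Continuous.matrix_det continuous_id).tendsto MX).comp hMX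
  exact (hdet.eventually_ne hMX_inv.ne_zero).mono fun n hn => isUnit_iff_ne_zero.2 hn

theorem exists_coerciveWith_of_tendsto_secondMoment :
    ∃ c > 0, ∀ᶠ n : ℕ in atTop, CoerciveWith (c * n) ((X n)ᵀ * X n) := by
  obtain ⟨b, hb⟩ := exists_gt ‖MX⁻¹‖
  have hb0 : 0 < b := (norm_nonneg _).trans_lt hb
  refine ⟨b⁻¹, inv_pos.2 hb0, ?_⟩
  filter_upwards [eventually_gt_atTop 0, eventually_isUnit_det_secondMoment hMX hMX_inv,
    (tendsto_inv_secondMoment hMX hMX_inv).norm.eventually_lt_const hb] with n hn hdet hnorm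
  have hn0 : (0 : ℝ) < n := Nat.cast_pos.2 hn
  have hinv : ‖((X n)ᵀ * X n)⁻¹‖ ≤ b / n := by
    rw [inv_transpose_mul_self hn hdet, norm_smul, norm_inv, Real.norm_natCast, inv_mul_eq_div]
    gcongr
  have hunit : IsUnit ((X n)ᵀ * X n).det := by
    rw [transpose_mul_self_eq_smul_secondMoment, det_smul]
    exact (isUnit_iff_ne_zero.2 (pow_ne_zero _ hn0.ne')).mul hdet
  rw [inv_mul_eq_div, ← inv_div]
  exact coerciveWith_transpose_mul_self hunit (by positivity) hinv

end Limits

section Closeness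

open Matrix
open scoped Matrix.Norms.L2Operator

variable {ι : Type*} {l : Filter ι} {n : ι → ℕ} {d : ℕ}
  {X Y : ∀ i, Matrix (Fin (n i)) (Fin d) ℝ} {E ξ : ∀ i, Matrix (Fin (n i)) (Fin (n i)) ℝ}

/-- The factors `Y` are oriented, eventually along `l`, by one of the two conventions that resolve
the rotation indeterminacy relative to `X`: they are nearest to `X`, or their centered Gram matrix
is diagonal and their column signs are fixed. -/
def IsResolved (l : Filter ι) (n : ι → ℕ) (X Y : ∀ i, Matrix (Fin (n i)) (Fin d) ℝ) : Prop :=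
  (∀ᶠ i in l, IsNearestRotation (Y i) (X i)) ∨
    ((∃ c > 0, ∀ᶠ i in l, (secondMoment (centering (n i) * X i)).IsDiag ∧ ∀ a b, a ≠ b →
        c ≤ |secondMoment (centering (n i) * X i) a a -
          secondMoment (centering (n i) * X i) b b|) ∧
      (∀ᶠ i in l, HasMatchingDiagonalGram (centering (n i) * Y i) (centering (n i) * X i)) ∧
      ((∀ᶠ i in l, ∀ a, 0 ≤ ∑ j, Y i j a * X i j a) ∨
        ((∃ c > 0, ∀ᶠ i in l, ∀ a, c ≤ rowVec (centering (n i) * X i) 0 a) ∧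
          ∀ᶠ i in l, ∀ a, 0 ≤ rowVec (centering (n i) * Y i) 0 a)))

theorem IsTamePerturbation.isNearlyAligned_of_isResolved (h : IsTamePerturbation l n X E)
    (hE : HasOrder l n (fun i => meanRow (n i) * (E i * X i)) 0)
    (h0 : IsTameRow l n X E fun i => selectRow (n i) 0)
    (hY : ∀ᶠ i in l, IsRotatedASE (X i * (X i)ᵀ + E i) (Y i)) (hYX : IsResolved l n X Y) :
    IsNearlyAligned l n X E Y := by
  obtain hnear | ⟨hsep, hmatch, hcol | hrow⟩ := hYX
  · exact h.isNearlyAligned hY hnear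
  · exact h.isNearlyAligned_of_column_signs hE hY hsep hmatch hcol
  · simp only [rowVec_eq_toLp_selectRow_mul, ← Matrix.mul_assoc] at hrow
    exact h.isNearlyAligned_of_row_signs hE hY hsep hmatch (h0.selectRow_mul_centering h hE)
      hrow.1 hrow.2

/-- The size of all functions of the noise `ξ` on which the error in the row with index `k`
depends. The row with index `0` takes part because its signs may determine the orientation. -/
noncomputable def combinedNoiseLevel {n : ℕ} (X : Matrix (Fin n) (Fin d) ℝ)
    (ξ : Matrix (Fin n) (Fin n) ℝ) (k : ℕ) : ℝ :=
  noiseLevel X ξ + rowNoiseLevel X ξ 0 + rowNoiseLevel X ξ k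

section NoiseLevel

variable {n : ℕ} (X : Matrix (Fin n) (Fin d) ℝ) (ξ : Matrix (Fin n) (Fin n) ℝ) (k : ℕ)

theorem noiseLevel_nonneg : 0 ≤ noiseLevel X ξ :=
  add_nonneg (add_nonneg (add_nonneg (scaledFrobeniusSq_nonneg _) (scaledFrobeniusSq_nonneg _))
    (scaledFrobeniusSq_nonneg _)) (scaledFrobeniusSq_nonneg _)

theorem rowNoiseLevel_nonneg : 0 ≤ rowNoiseLevel X ξ k :=
  add_nonneg (scaledFrobeniusSq_nonneg _) (scaledFrobeniusSq_nonneg _)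

theorem combinedNoiseLevel_nonneg : 0 ≤ combinedNoiseLevel X ξ k :=
  add_nonneg (add_nonneg (noiseLevel_nonneg X ξ) (rowNoiseLevel_nonneg X ξ 0))
    (rowNoiseLevel_nonneg X ξ k)

theorem IsSymmetricNoise.hasMeanLE_combinedNoiseLevel {Ω : Type*} [MeasurableSpace Ω]
    {μ : Measure Ω} [IsProbabilityMeasure μ] {X : Matrix (Fin n) (Fin d) ℝ}
    {ξ : Ω → Matrix (Fin n) (Fin n) ℝ} (h : IsSymmetricNoise μ ξ)
    (hX : ∀ j, ∑ a, X j a ^ 2 ≤ 1) (k : ℕ) :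
    HasMeanLE μ (fun ω => combinedNoiseLevel X (ξ ω) k) 28 :=
  (((h.hasMeanLE_noiseLevel hX).add (h.hasMeanLE_rowNoiseLevel hX)).add
    (h.hasMeanLE_rowNoiseLevel hX)).mono (by norm_num)

end NoiseLevel

theorem rowVec_sub {n : ℕ} (M N : Matrix (Fin n) (Fin d) ℝ) (k : ℕ) :
    rowVec (M - N) k = rowVec M k - rowVec N k := by
  simp only [rowVec_eq_toLp_selectRow_mul, Matrix.mul_sub]
  rfl

theorem HasOrder.tendsto_sqrt_smul_rowVec {M : ∀ i, Matrix (Fin (n i)) (Fin d) ℝ} {k : ℕ} {p : ℝ}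
    (h : HasOrder l n (fun i => selectRow (n i) k * M i) p) (hn : Tendsto n l atTop)
    (hp : p < -1 / 2) : Tendsto (fun i => √(n i : ℝ) • rowVec (M i) k) l (𝓝 0) := by
  refine Metric.tendsto_nhds.2 fun ε hε => ?_
  filter_upwards [h.eventually_lt hn hp hε, hn.eventually_gt_atTop 0] with i hi hpos
  have hsqrt : √(n i : ℝ) * (n i : ℝ) ^ (-1 / 2 : ℝ) = 1 := by
    rw [Real.sqrt_eq_rpow, ← Real.rpow_add (by exact_mod_cast hpos)]
    norm_num
  rw [dist_zero_right, norm_smul, Real.norm_of_nonneg (Real.sqrt_nonneg _)]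
  calc √(n i : ℝ) * ‖rowVec (M i) k‖ ≤ √(n i : ℝ) * ‖selectRow (n i) k * M i‖ := by
        gcongr
        exact norm_rowVec_le_l2_opNorm _ _
    _ < √(n i : ℝ) * (ε * (n i : ℝ) ^ (-1 / 2 : ℝ)) := by gcongr
    _ = ε := by rw [mul_left_comm, hsqrt, mul_one]

variable {v : ∀ i, Fin (n i) → ℝ} {k : ℕ} {B : ℝ}

theorem isTamePerturbation_and_isTameRow_of_combinedNoiseLevel_le (hn : Tendsto n l atTop)
    (hc : ∃ c > 0, ∀ᶠ i in l, CoerciveWith (c * n i) ((X i)ᵀ * X i))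
    (hX : ∀ i j, ∑ a, X i j a ^ 2 ≤ 1) (hξ : ∀ i, (ξ i)ᵀ = ξ i)
    (hξn : ∀ i j, ∑ m, ξ i j m ^ 2 ≤ n i)
    (hB : ∀ᶠ i in l, combinedNoiseLevel (X i) (ξ i) k ≤ B) :
    IsTamePerturbation l n X ξ ∧ HasOrder l n (fun i => meanRow (n i) * (ξ i * X i)) 0 ∧
      IsTameRow l n X ξ (fun i => selectRow (n i) 0) ∧
      IsTameRow l n X ξ (fun i => selectRow (n i) k) := by
  have hterms : ∀ᶠ i in l, noiseLevel (X i) (ξ i) ≤ B ∧ rowNoiseLevel (X i) (ξ i) 0 ≤ B ∧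
      rowNoiseLevel (X i) (ξ i) k ≤ B := by
    filter_upwards [hB] with i hi
    have h₁ := noiseLevel_nonneg (X i) (ξ i)
    have h₂ := rowNoiseLevel_nonneg (X i) (ξ i) 0
    have h₃ := rowNoiseLevel_nonneg (X i) (ξ i) k
    unfold combinedNoiseLevel at hi
    exact ⟨by linarith, by linarith, by linarith⟩
  have hnoise := hterms.mono fun _ hi => hi.1
  exact ⟨isTamePerturbation_of_noiseLevel_le hn hc hX hξ hnoise,
    hasOrder_meanRow_mul_of_noiseLevel_le hn hnoise,
    isTameRow_selectRow hn hX hξn (hterms.mono fun _ hi => hi.2.1),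
    isTameRow_selectRow hn hX hξn (hterms.mono fun _ hi => hi.2.2)⟩

theorem tendsto_sqrt_smul_rowVec_sub_of_combinedNoiseLevel_le (hn : Tendsto n l atTop)
    (hc : ∃ c > 0, ∀ᶠ i in l, CoerciveWith (c * n i) ((X i)ᵀ * X i))
    (hX : ∀ i j, ∑ a, X i j a ^ 2 ≤ 1) (hξ : ∀ i, (ξ i)ᵀ = ξ i)
    (hξn : ∀ i j, ∑ m, ξ i j m ^ 2 ≤ n i) (hv : ∀ i j, |v i j| ≤ 1)
    (hB : ∀ᶠ i in l, combinedNoiseLevel (X i) (ξ i) k ≤ B)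
    (hY : ∀ᶠ i in l, IsRotatedASE (X i * (X i)ᵀ + (ξ i - diagonal (v i))) (Y i))
    (hYX : IsResolved l n X Y) :
    Tendsto (fun i => √(n i : ℝ) •
      (rowVec (centering (n i) * Y i) k - rowVec (centering (n i) * X i) k) -
      √(n i : ℝ) • rowVec (ξ i * X i * ((X i)ᵀ * X i)⁻¹) k) l (𝓝 0) := by
  obtain ⟨h, hmean, h0, hk⟩ :=
    isTamePerturbation_and_isTameRow_of_combinedNoiseLevel_le hn hc hX hξ hξn hB
  have hD : HasOrder l n (fun i => diagonal (v i)) 0 := hasOrder_diagonal zero_le_one hv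
  have hmeanE : HasOrder l n (fun i => meanRow (n i) * ((ξ i - diagonal (v i)) * X i)) 0 := by
    simpa only [Matrix.sub_mul, Matrix.mul_sub] using
      hmean.sub (((hasOrder_meanRow hn).mul (hD.mul h.signal)).mono hn (by norm_num))
  have hYE := (h.sub hD fun i => diagonal_transpose _).isNearlyAligned_of_isResolved hmeanE
    (h0.sub_noise h hasOrder_selectRow hD) hY hYX
  have hrow := hYE.hasOrder_selectRow_mul_centering_mul_sub_sub h hmean hk hD
    (hasOrder_selectRow_mul_diagonal_mul hv hX)
  have hrow' : HasOrder l n (fun i => selectRow (n i) k * (centering (n i) * Y i -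
      centering (n i) * X i - ξ i * X i * ((X i)ᵀ * X i)⁻¹)) (-3 / 4) := by
    simpa only [Matrix.mul_sub, Matrix.mul_assoc] using hrow
  simpa only [rowVec_sub, smul_sub] using hrow'.tendsto_sqrt_smul_rowVec hn (by norm_num)

end Closeness

section LeadingTerm

open Matrix
open Complex (I)

section FixedSize

variable {n d : ℕ} {X : Matrix (Fin n) (Fin d) ℝ}

theorem inner_rowVec_left {i : ℕ} (hi : i < n) (M : Matrix (Fin n) (Fin d) ℝ)
    (t : EuclideanSpace ℝ (Fin d)) : inner ℝ (rowVec M i) t = (M *ᵥ t) ⟨i, hi⟩ := by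
  rw [rowVec, dif_pos hi, EuclideanSpace.inner_eq_star_dotProduct, star_trivial, dotProduct_comm]
  rfl

theorem inner_sqrt_smul_rowVec_mul_inv {i : ℕ} (hi : i < n) (hX : IsUnit (secondMoment X).det)
    (ξ : Matrix (Fin n) (Fin n) ℝ) (t : EuclideanSpace ℝ (Fin d)) :
    inner ℝ (√(n : ℝ) • rowVec (ξ * X * (Xᵀ * X)⁻¹) i) t =
      ∑ j, ξ ⟨i, hi⟩ j * ((X *ᵥ (secondMoment X)⁻¹ *ᵥ t) j / √(n : ℝ)) := by
  have hsqrt : √(n : ℝ) * (n : ℝ)⁻¹ = (√(n : ℝ))⁻¹ := by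
    rw [← div_eq_mul_inv, Real.sqrt_div_self', one_div]
  rw [inner_smul_left, inner_rowVec_left hi, inv_transpose_mul_self (by omega) hX, Matrix.mul_smul,
    smul_mulVec, Pi.smul_apply, smul_eq_mul, RCLike.conj_to_real, ← mul_assoc, hsqrt,
    ← mulVec_mulVec, ← mulVec_mulVec, mulVec, dotProduct, Finset.mul_sum]
  exact Finset.sum_congr rfl fun j _ => by ring

theorem abs_mulVec_apply_le (hX : ∀ j, ∑ a, X j a ^ 2 ≤ 1) (u : Fin d → ℝ) (j : Fin n) :
    |(X *ᵥ u) j| ≤ √(u ⬝ᵥ u) := by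
  refine Real.abs_le_sqrt ((Finset.sum_mul_sq_le_sq_mul_sq Finset.univ (X j) u).trans ?_)
  simp only [dotProduct, ← sq]
  exact mul_le_of_le_one_left (Finset.sum_nonneg fun a _ => sq_nonneg (u a)) (hX j)

namespace IsBernoulliNetwork

variable {Ω : Type*} [MeasurableSpace Ω] {μ : Measure Ω} [IsProbabilityMeasure μ]
  {A : Ω → Matrix (Fin n) (Fin n) ℝ} (hA : IsBernoulliNetwork μ (X * Xᵀ) A)

include hA

theorem sum_integral_networkNoise_sq_mul_sq (hP : ∀ i j, 0 ≤ (X * Xᵀ) i j) {i : ℕ} (hi : i < n)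
    (u : Fin d → ℝ) :
    ∑ j, (∫ ω, networkNoise (X * Xᵀ) (A ω) ⟨i, hi⟩ j ^ 2 ∂μ) * ((X *ᵥ u) j / √(n : ℝ)) ^ 2 =
      u ⬝ᵥ scoreCov X i *ᵥ u := by
  rw [dotProduct_scoreCov_mulVec hi, Finset.mul_sum]
  refine Finset.sum_congr rfl fun j _ => ?_
  rw [div_pow, Real.sq_sqrt n.cast_nonneg]
  by_cases hj : j = ⟨i, hi⟩
  · simp [hj, networkNoise_apply_self]
  · rw [if_neg hj, hA.integral_networkNoise_sq hP (Ne.symm hj)]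
    ring

theorem norm_integral_exp_sub_exp_scoreCov_le (hP : ∀ i j, 0 ≤ (X * Xᵀ) i j ∧ (X * Xᵀ) i j ≤ 1)
    {i : ℕ} (hi : i < n) {u : Fin d → ℝ} (hu : √(u ⬝ᵥ u) ≤ √(n : ℝ)) :
    ‖∫ ω, Complex.exp ((∑ j, networkNoise (X * Xᵀ) (A ω) ⟨i, hi⟩ j *
        ((X *ᵥ u) j / √(n : ℝ)) : ℝ) * I) ∂μ -
      Complex.exp (-(u ⬝ᵥ scoreCov X i *ᵥ u / 2 : ℝ))‖ ≤ 2 * (√(u ⬝ᵥ u) ^ 3 / √(n : ℝ)) := by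
  have hs (j) : |(X *ᵥ u) j / √(n : ℝ)| ≤ √(u ⬝ᵥ u) / √(n : ℝ) := by
    rw [abs_div, abs_of_nonneg (Real.sqrt_nonneg _)]
    gcongr
    exact abs_mulVec_apply_le (sum_sq_row_le_one fun j => (hP j j).2) u j
  have hnoise := hA.isSymmetricNoise hP (isSymm_mul_transpose X)
  have hgauss := hnoise.norm_integral_exp_row_mul_I_sub_gaussian_le ⟨i, hi⟩ fun j =>
    (hs j).trans (div_le_one_of_le₀ hu (Real.sqrt_nonneg _))
  rw [hA.sum_integral_networkNoise_sq_mul_sq (fun i j => (hP i j).1) hi] at hgauss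
  refine hgauss.trans (mul_le_mul_of_nonneg_left ?_ zero_le_two)
  have hn : √(n : ℝ) ≠ 0 := (Real.sqrt_pos.2 (Nat.cast_pos.2 (by omega))).ne'
  calc ∑ j, |(X *ᵥ u) j / √(n : ℝ)| ^ 3 ≤ ∑ _j : Fin n, (√(u ⬝ᵥ u) / √(n : ℝ)) ^ 3 :=
        Finset.sum_le_sum fun j _ => pow_le_pow_left₀ (abs_nonneg _) (hs j) 3
    _ = √(n : ℝ) ^ 2 * (√(u ⬝ᵥ u) / √(n : ℝ)) ^ 3 := by
        rw [Finset.sum_const, Finset.card_univ, Fintype.card_fin, nsmul_eq_mul,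
          Real.sq_sqrt n.cast_nonneg]
    _ = √(u ⬝ᵥ u) ^ 3 / √(n : ℝ) := by field_simp

end IsBernoulliNetwork

end FixedSize

theorem tendsto_dotProduct_mulVec {ι m : Type*} [Fintype m] {l : Filter ι} {w : ι → m → ℝ}
    {S : ι → Matrix m m ℝ} {w₀ : m → ℝ} {S₀ : Matrix m m ℝ} (hw : Tendsto w l (𝓝 w₀))
    (hS : Tendsto S l (𝓝 S₀)) :
    Tendsto (fun i => w i ⬝ᵥ S i *ᵥ w i) l (𝓝 (w₀ ⬝ᵥ S₀ *ᵥ w₀)) := by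
  have hcont : Continuous fun q : (m → ℝ) × Matrix m m ℝ => q.1 ⬝ᵥ q.2 *ᵥ q.1 :=
    continuous_fst.dotProduct (continuous_snd.matrix_mulVec continuous_fst)
  exact (hcont.tendsto (w₀, S₀)).comp (hw.prodMk_nhds hS)

variable {d : ℕ} {X : ∀ n : ℕ, Matrix (Fin n) (Fin d) ℝ} {MX Q : Matrix (Fin d) (Fin d) ℝ} {i : ℕ}
  {Ω : ℕ → Type*} [∀ n, MeasurableSpace (Ω n)] {μ : ∀ n, Measure (Ω n)}
  [∀ n, IsProbabilityMeasure (μ n)] {A : ∀ n, Ω n → Matrix (Fin n) (Fin n) ℝ}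
  (hMX : Tendsto (fun n => secondMoment (X n)) atTop (𝓝 MX)) (hMX_inv : IsUnit MX.det)

include hMX hMX_inv

theorem tendsto_dotProduct_scoreCov_mulVec (hQ : Tendsto (fun n => scoreCov (X n) i) atTop (𝓝 Q))
    (t : Fin d → ℝ) :
    Tendsto (fun n => ((secondMoment (X n))⁻¹ *ᵥ t) ⬝ᵥ
      scoreCov (X n) i *ᵥ (secondMoment (X n))⁻¹ *ᵥ t) atTop
      (𝓝 (t ⬝ᵥ (MX⁻¹ * Q * MX⁻¹) *ᵥ t)) := by
  have hsymm : (MX⁻¹)ᵀ = MX⁻¹ := by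
    rw [transpose_nonsing_inv, transpose_eq_of_tendsto_secondMoment hMX]
  have hlim : t ⬝ᵥ (MX⁻¹ * Q * MX⁻¹) *ᵥ t = (MX⁻¹ *ᵥ t) ⬝ᵥ Q *ᵥ MX⁻¹ *ᵥ t := by
    rw [mulVec_mulVec, dotProduct_mulVec_mulVec, hsymm, Matrix.mul_assoc]
  have hweight := ((Continuous.tendsto (f := fun M : Matrix (Fin d) (Fin d) ℝ => M *ᵥ t)
    (by fun_prop)) MX⁻¹).comp (tendsto_inv_secondMoment hMX hMX_inv)
  rw [hlim]
  exact tendsto_dotProduct_mulVec hweight hQ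

theorem tendsto_integral_exp_inner_sqrt_smul_rowVec
    (hP : ∀ n i j, 0 ≤ (X n * (X n)ᵀ) i j ∧ (X n * (X n)ᵀ) i j ≤ 1)
    (hA : ∀ n, IsBernoulliNetwork (μ n) (X n * (X n)ᵀ) (A n))
    (hQ : Tendsto (fun n => scoreCov (X n) i) atTop (𝓝 Q)) (t : EuclideanSpace ℝ (Fin d)) :
    Tendsto (fun n => ∫ ω, Complex.exp ((inner ℝ (√(n : ℝ) • rowVec
      (networkNoise (X n * (X n)ᵀ) (A n ω) * X n * ((X n)ᵀ * X n)⁻¹) i) t : ℝ) * I) ∂μ n) atTop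
      (𝓝 (Complex.exp (-(t.ofLp ⬝ᵥ (MX⁻¹ * Q * MX⁻¹) *ᵥ t.ofLp / 2 : ℝ)))) := by
  have hnorm : Tendsto (fun n => √(((secondMoment (X n))⁻¹ *ᵥ t.ofLp) ⬝ᵥ
      ((secondMoment (X n))⁻¹ *ᵥ t.ofLp))) atTop (𝓝 √((MX⁻¹ *ᵥ t.ofLp) ⬝ᵥ (MX⁻¹ *ᵥ t.ofLp))) :=
    (Continuous.tendsto (f := fun M : Matrix (Fin d) (Fin d) ℝ =>
      √((M *ᵥ t.ofLp) ⬝ᵥ (M *ᵥ t.ofLp))) (by fun_prop) _).comp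
      (tendsto_inv_secondMoment hMX hMX_inv)
  have hsqrt : Tendsto (fun n : ℕ => √(n : ℝ)) atTop atTop :=
    Real.tendsto_sqrt_atTop.comp tendsto_natCast_atTop_atTop
  have herror := ((hnorm.pow 3).div_atTop hsqrt).const_mul 2
  have hgauss := (Continuous.tendsto (f := fun x : ℝ => Complex.exp (-(x / 2 : ℝ)))
    (by fun_prop) _).comp (tendsto_dotProduct_scoreCov_mulVec hMX hMX_inv hQ t.ofLp)
  rw [mul_zero] at herror
  refine tendsto_of_tendsto_of_dist hgauss (squeeze_zero' (.of_forall fun _ => dist_nonneg) ?_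
    herror)
  filter_upwards [eventually_gt_atTop i, eventually_isUnit_det_secondMoment hMX hMX_inv,
    hnorm.eventually_lt_const (lt_add_one _), hsqrt.eventually_ge_atTop _] with n hi hdet hlt hge
  simp only [inner_sqrt_smul_rowVec_mul_inv hi hdet]
  rw [dist_comm, dist_eq_norm]
  exact (hA n).norm_integral_exp_sub_exp_scoreCov_le (hP n) hi (hlt.le.trans hge)

theorem tendstoInDistribution_sqrt_smul_rowVec
    (hP : ∀ n i j, 0 ≤ (X n * (X n)ᵀ) i j ∧ (X n * (X n)ᵀ) i j ≤ 1)
    (hA : ∀ n, IsBernoulliNetwork (μ n) (X n * (X n)ᵀ) (A n))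
    (hQ : Tendsto (fun n => scoreCov (X n) i) atTop (𝓝 Q)) :
    TendstoInDistribution (fun (n : ℕ) ω => √(n : ℝ) • rowVec
      (networkNoise (X n * (X n)ᵀ) (A n ω) * X n * ((X n)ᵀ * X n)⁻¹) i) atTop id μ
      (multivariateGaussian 0 (MX⁻¹ * Q * MX⁻¹)) := by
  refine (tendstoInDistribution_iff_tendsto_integral_exp (fun n => ?_) aemeasurable_id).2
    fun t => ?_
  · have hξ := ((hA n).isSymmetricNoise (hP n) (isSymm_mul_transpose (X n))).measurable_entry
    refine (aemeasurable_rowVec (fun j a => ?_) i).const_smul (√(n : ℝ))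
    simp only [mul_apply]
    exact Measurable.aemeasurable (by fun_prop)
  · have hpsd := posSemidef_inv_mul_mul_inv hMX (posSemidef_of_tendsto_scoreCov hP hQ)
    rw [Measure.map_id, charFun_multivariateGaussian hpsd]
    simpa using tendsto_integral_exp_inner_sqrt_smul_rowVec hMX hMX_inv hP hA hQ t

end LeadingTerm

section AlmostSure

open Matrix

variable {d : ℕ} {Ω : ℕ → Type*} [∀ n, MeasurableSpace (Ω n)] {μ : ∀ n, Measure (Ω n)}
  {X : ∀ n : ℕ, Matrix (Fin n) (Fin d) ℝ} {Xhat : ∀ n, Ω n → Matrix (Fin n) (Fin d) ℝ}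

theorem isResolved_eventualAE
    (h_rot : (∀ᶠ n in atTop, ∀ᵐ ω ∂μ n, IsNearestRotation (Xhat n ω) (X n)) ∨
      (HasSeparatedDiagonalGram (fun n => centering n * X n) ∧
        (∀ᶠ n in atTop, ∀ᵐ ω ∂μ n,
          HasMatchingDiagonalGram (centering n * Xhat n ω) (centering n * X n)) ∧
        ((∀ᶠ n in atTop, ∀ᵐ ω ∂μ n, ∀ a, 0 ≤ ∑ j, Xhat n ω j a * X n j a) ∨
          ((∃ c : ℝ, 0 < c ∧ ∀ᶠ n in atTop, ∀ a, c ≤ rowVec (centering n * X n) 0 a) ∧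
            ∀ᶠ n in atTop, ∀ᵐ ω ∂μ n, ∀ a, 0 ≤ rowVec (centering n * Xhat n ω) 0 a)))) :
    IsResolved (eventualAE atTop μ) Sigma.fst (fun q => X q.1) (fun q => Xhat q.1 q.2) := by
  have hfst := tendsto_fst_eventualAE atTop μ
  refine h_rot.imp eventually_eventualAE.2 fun ⟨⟨c, hc, hsep⟩, hmatch, hsign⟩ =>
    ⟨⟨c, hc, hfst.eventually hsep⟩, eventually_eventualAE.2 hmatch, hsign.imp
      eventually_eventualAE.2 fun ⟨⟨c', hc', hpos⟩, hrow⟩ =>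
        ⟨⟨c', hc', hfst.eventually hpos⟩, eventually_eventualAE.2 hrow⟩⟩

theorem IsResolved.mono {ι : Type*} {l l' : Filter ι} {n : ι → ℕ}
    {X Y : ∀ i, Matrix (Fin (n i)) (Fin d) ℝ} (h : IsResolved l n X Y) (hl : l' ≤ l) :
    IsResolved l' n X Y :=
  h.imp (·.filter_mono hl) fun ⟨⟨c, hc, hsep⟩, hmatch, hsign⟩ =>
    ⟨⟨c, hc, hsep.filter_mono hl⟩, hmatch.filter_mono hl, hsign.imp (·.filter_mono hl)
      fun ⟨⟨c', hc', hpos⟩, hrow⟩ =>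
        ⟨⟨c', hc', hpos.filter_mono hl⟩, hrow.filter_mono hl⟩⟩

theorem tendsto_sqrt_smul_rowVec_sub_eventualAE [∀ n, IsProbabilityMeasure (μ n)]
    {A : ∀ n, Ω n → Matrix (Fin n) (Fin n) ℝ}
    (hP : ∀ n i j, 0 ≤ (X n * (X n)ᵀ) i j ∧ (X n * (X n)ᵀ) i j ≤ 1)
    (hA : ∀ n, IsBernoulliNetwork (μ n) (X n * (X n)ᵀ) (A n))
    (hc : ∃ c > 0, ∀ᶠ n : ℕ in atTop, CoerciveWith (c * n) ((X n)ᵀ * X n))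
    (hY : ∀ᶠ n in atTop, ∀ᵐ ω ∂μ n, IsRotatedASE (A n ω) (Xhat n ω))
    (hYX : IsResolved (eventualAE atTop μ) Sigma.fst (fun q => X q.1) (fun q => Xhat q.1 q.2))
    (k : ℕ) (B : ℝ) :
    Tendsto (fun q : Σ n, Ω n => √(q.1 : ℝ) •
        (rowVec (centering q.1 * Xhat q.1 q.2) k - rowVec (centering q.1 * X q.1) k) -
      √(q.1 : ℝ) • rowVec (networkNoise (X q.1 * (X q.1)ᵀ) (A q.1 q.2) * X q.1 *
        ((X q.1)ᵀ * X q.1)⁻¹) k)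
      (eventualAE atTop μ ⊓ 𝓟 {q | combinedNoiseLevel (X q.1)
        (networkNoise (X q.1 * (X q.1)ᵀ) (A q.1 q.2)) k ≤ B}) (𝓝 0) := by
  have hfst {s : Set (Σ n, Ω n)} : Tendsto Sigma.fst (eventualAE atTop μ ⊓ 𝓟 s) atTop :=
    (tendsto_fst_eventualAE atTop μ).mono_left inf_le_left
  have hnoise (n) := (hA n).isSymmetricNoise (hP n) (isSymm_mul_transpose (X n))
  obtain ⟨c, hc, hcoercive⟩ := hc
  refine tendsto_sqrt_smul_rowVec_sub_of_combinedNoiseLevel_le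
    (v := fun q i => (X q.1 * (X q.1)ᵀ) i i) hfst ⟨c, hc, hfst.eventually hcoercive⟩
    (fun q => sum_sq_row_le_one fun j => (hP q.1 j j).2)
    (fun q => ext fun i j => (hnoise q.1).symm q.2 j i)
    (fun q i => (hnoise q.1).sum_sq_row_le q.2 i)
    (fun q j => abs_le.2 ⟨by linarith [(hP q.1 j j).1], (hP q.1 j j).2⟩)
    (mem_inf_of_right (mem_principal_self _)) ?_ (hYX.mono inf_le_left)
  simp only [(hA _).add_networkNoise_sub_diagonal]
  exact (eventually_eventualAE.2 hY).filter_mono inf_le_left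

end AlmostSure

theorem theorem2 {d : ℕ} {Ω : ℕ → Type*} [∀ n, MeasurableSpace (Ω n)]
    (μ : ∀ n, Measure (Ω n)) [∀ n, IsProbabilityMeasure (μ n)]
    -- parameters of the network model with `n` nodes
    (α : ∀ n : ℕ, Fin n → ℝ) (Z X : ∀ n : ℕ, Matrix (Fin n) (Fin d) ℝ)
    (h_prob : ∀ n i j, 0 ≤ linkProb (α n) (Z n) i j ∧ linkProb (α n) (Z n) i j ≤ 1)
    -- the observed network
    (A : ∀ n, Ω n → Matrix (Fin n) (Fin n) ℝ)
    (hA : ∀ n, IsBernoulliNetwork (μ n) (linkProb (α n) (Z n)) (A n))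
    -- positive semidefiniteness and the lower bound on the largest expected degree
    (h_psd : ∀ n, (linkProb (α n) (Z n)).PosSemidef)
    (h_deg : ∃ a : ℝ, 0 < a ∧ ∀ᶠ n : ℕ in atTop,
      ∃ i, Real.log n ^ (4 + a) < ∑ j, linkProb (α n) (Z n) i j)
    -- the latent factors are centered
    (h_centered : ∀ n a, ∑ i, Z n i a = 0)
    -- the latent positions: `P = X Xᵀ`, oriented so that the centered `X` is `Z`
    (hX : ∀ n, X n * (X n)ᵀ = linkProb (α n) (Z n))
    (hXZ : ∀ n, centering n * X n = Z n)
    -- existence of the limits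
    (MX : Matrix (Fin d) (Fin d) ℝ) (hMX : Tendsto (fun n => secondMoment (X n)) atTop (𝓝 MX))
    (hMX_inv : IsUnit MX.det)
    (i : ℕ) (Q : Matrix (Fin d) (Fin d) ℝ)
    (hQ : Tendsto (fun n => scoreCov (X n) i) atTop (𝓝 Q))
    -- the spectral embedding, up to an orthogonal transformation that is fixed below
    (Xhat : ∀ n, Ω n → Matrix (Fin n) (Fin d) ℝ)
    (hXhat_meas : ∀ n j a, AEMeasurable (fun ω => Xhat n ω j a) (μ n))
    (hXhat : ∀ᶠ n in atTop, ∀ᵐ ω ∂(μ n), IsRotatedASE (A n ω) (Xhat n ω))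
    (h_rot :
      -- either it is the one that best aligns the embedding with the latent positions
      (∀ᶠ n in atTop, ∀ᵐ ω ∂(μ n), IsNearestRotation (Xhat n ω) (X n)) ∨
      -- or it makes the estimated factors satisfy the same identifiability condition as `Z`:
      -- a diagonal Gram matrix with distinct elements, and a convention for the column signs
      (HasSeparatedDiagonalGram Z ∧
        (∀ᶠ n in atTop, ∀ᵐ ω ∂(μ n),
          HasMatchingDiagonalGram (centering n * Xhat n ω) (Z n)) ∧
        ((∀ᶠ n in atTop, ∀ᵐ ω ∂(μ n), ∀ a, 0 ≤ ∑ j, Xhat n ω j a * X n j a) ∨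
          ((∃ c : ℝ, 0 < c ∧ ∀ᶠ n in atTop, ∀ a, c ≤ rowVec (Z n) 0 a) ∧
            ∀ᶠ n in atTop, ∀ᵐ ω ∂(μ n), ∀ a, 0 ≤ rowVec (centering n * Xhat n ω) 0 a)))) :
    TendstoInDistribution
      (fun (n : ℕ) ω => √(n : ℝ) • (rowVec (centering n * Xhat n ω) i - rowVec (Z n) i))
      atTop id μ (multivariateGaussian 0 (MX⁻¹ * Q * MX⁻¹)) := by
  obtain rfl : (fun n => centering n * X n) = Z := funext hXZ
  simp only [← hX] at h_prob hA
  have hnoise (n) := (hA n).isSymmetricNoise (h_prob n) (isSymm_mul_transpose (X n))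
  have hrows (n) : ∀ j, ∑ a, X n j a ^ 2 ≤ 1 := sum_sq_row_le_one fun j => (h_prob n j j).2
  have hcoercive := exists_coerciveWith_of_tendsto_secondMoment hMX hMX_inv
  refine tendstoInDistribution_of_hasMeanLE
    (tendstoInDistribution_sqrt_smul_rowVec hMX hMX_inv h_prob hA hQ) (fun n => ?_)
    (fun n ω => combinedNoiseLevel_nonneg _ _ i)
    (fun n => (hnoise n).hasMeanLE_combinedNoiseLevel (hrows n) i)
    (tendsto_sqrt_smul_rowVec_sub_eventualAE h_prob hA hcoercive hXhat
      (isResolved_eventualAE h_rot) i)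
  have hcentered (j a) : AEMeasurable (fun ω => (centering n * Xhat n ω) j a) (μ n) := by
    simp only [Matrix.mul_apply]
    fun_prop
  exact ((aemeasurable_rowVec hcentered i).sub_const _).const_smul (√(n : ℝ))
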